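/- Let $\Lambda$ be a Nakayama algebra without simple projective modules, that is, an artin algebra over a commutative artinian ring $k$ such that all indecomposable projective left and right $\Lambda$-modules are uniserial and no simple left $\Lambda$-module is projective. Modules are left $\Lambda$-modules of finite length. For a class $\mathcal M$ of modules, $\operatorname{add}\mathcal M$ denotes the class of all modules isomorphic to direct summands of finite direct sums of modules in $\mathcal M$. A module is Gorenstein projective if it is isomorphic to the image of a differential in an exact complex $P_\bullet$ (indexed by $\mathbb Z$) of finite length projective modules such that $\operatorname{Hom}_\Lambda(P_\bullet,\Lambda)$ is exact as well. The Gorenstein core $\mathcal C(\Lambda)$ is $\operatorname{add}$ of the class consisting of all indecomposable non-projective Gorenstein projective modules and of their projective covers. Let $\mathcal X$ be the class of simple modules $S$ whose projective cover $P(S)$ belongs to $\mathcal C(\Lambda)$. Write $\tau^-=\operatorname{Tr}D$, where $D=\operatorname{Hom}_k(-,E)$ with $E$ the injective hull of the $k$-module $k/\operatorname{rad}k$ and $\operatorname{Tr}$ is the transpose (defined by minimal projective presentations), let $\tau^-\mathcal X$ be the class of modules $\tau^-S$ with $S\in\mathcal X$, and let $\Omega M$ be the kernel of a projective cover of $M$.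 Then for every module $M$ of finite length the following conditions are equivalent: (i) $M$ belongs to $\mathcal C(\Lambda)$. (ii) $\operatorname{top}M$ belongs to $\operatorname{add}\mathcal X$ and $\operatorname{soc}M$ belongs to $\operatorname{add}\tau^-\mathcal X$. (iii) $\operatorname{top}M$ and $\operatorname{top}\Omega M$ both belong to $\operatorname{add}\mathcal X$. -/

import Mathlib

universe u v w

namespace NakayamaCore

/-- A module is indecomposable if it is non-zero and is not the direct sum of two
non-zero submodules. -/
def IsIndecomposable (R : Type*) [Ring R] (M : Type*) [AddCommGroup M] [Module R M] : Prop :=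
  Nontrivial M ∧ ∀ N N' : Submodule R M, IsCompl N N' → N = ⊥ ∨ N' = ⊥

/-- A module is uniserial if its submodules are linearly ordered by inclusion. -/
def IsUniserial (R : Type*) [Ring R] (M : Type*) [AddCommGroup M] [Module R M] : Prop :=
  ∀ N N' : Submodule R M, N ≤ N' ∨ N' ≤ N

/-- Every finitely generated indecomposable projective (left) `R`-module is uniserial. -/
def HasUniserialProjectives (R : Type u) [Ring R] : Prop :=
  ∀ (P : Type u) [AddCommGroup P] [Module R P], Module.Finite R P → Module.Projective R P →
    IsIndecomposable R P → IsUniserial R P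

/-- The Nakayama condition: the indecomposable projective left modules and the indecomposable
projective right modules are uniserial. Right `Λ`-modules are modules over `Λᵐᵒᵖ`. -/
def IsNakayama (Λ : Type u) [Ring Λ] : Prop :=
  HasUniserialProjectives Λ ∧ HasUniserialProjectives Λᵐᵒᵖ

/-- There are no simple projective left modules. -/
def NoSimpleProjective (Λ : Type u) [Ring Λ] : Prop :=
  ∀ (S : Type u) [AddCommGroup S] [Module Λ S], IsSimpleModule Λ S → ¬ Module.Projective Λ S

section Basic

variable {R : Type*} [Ring R]

/-- A submodule `K` of `M` is superfluous if `N + K = M` implies `N = M`. -/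
def IsSuperfluous {M : Type*} [AddCommGroup M] [Module R M] (K : Submodule R M) : Prop :=
  ∀ N : Submodule R M, N ⊔ K = ⊤ → N = ⊤

/-- `π : P → M` is a projective cover. -/
structure IsProjectiveCover {P M : Type*} [AddCommGroup P] [Module R P] [AddCommGroup M]
    [Module R M] (π : P →ₗ[R] M) : Prop where
  projective : Module.Projective R P
  surjective : Function.Surjective π
  superfluous : IsSuperfluous (LinearMap.ker π)

/-- `ι : A → E` is an injective hull. -/
structure IsInjectiveHull {A : Type*} {E : Type v} [AddCommGroup A] [Module R A]
    [AddCommGroup E] [Module R E] (ι : A →ₗ[R] E) : Prop where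
  injective_module : Module.Injective R E
  injective : Function.Injective ι
  essential : ∀ N : Submodule R E, N ⊓ LinearMap.range ι = ⊥ → N = ⊥

/-- `P₁ → P₀ → N → 0` is a minimal projective presentation of `N`. -/
structure IsMinimalProjectivePresentation {P₁ P₀ N : Type*} [AddCommGroup P₁] [Module R P₁]
    [AddCommGroup P₀] [Module R P₀] [AddCommGroup N] [Module R N]
    (f : P₁ →ₗ[R] P₀) (p : P₀ →ₗ[R] N) : Prop where
  cover : IsProjectiveCover p
  projective : Module.Projective R P₁
  exact : Function.Exact f p
  superfluous : IsSuperfluous (LinearMap.ker f)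

variable (R)

/-- The top `M / rad M`, where `rad M` is the intersection of the maximal submodules. -/
abbrev Top (M : Type*) [AddCommGroup M] [Module R M] : Type _ :=
  M ⧸ Module.jacobson R M

/-- The socle of `M`: the sum of its simple submodules. -/
def socle (M : Type*) [AddCommGroup M] [Module R M] : Submodule R M :=
  sSup {N : Submodule R M | IsSimpleModule R N}

end Basic

section Modules

variable (Λ : Type u) [Ring Λ]

/-- `M` belongs to `add 𝒳`: it is (isomorphic to) a direct summand of a finite direct sum
of modules in `𝒳`. -/
def InAdd {Λ : Type u} [Ring Λ] (𝒳 : ModuleCat.{u} Λ → Prop)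
    (M : Type u) [AddCommGroup M] [Module Λ M] : Prop :=
  ∃ (n : ℕ) (Y : Fin n → ModuleCat.{u} Λ), (∀ i, 𝒳 (Y i)) ∧
    ∃ (i : M →ₗ[Λ] (∀ j, Y j)) (r : (∀ j, Y j) →ₗ[Λ] M), r ∘ₗ i = LinearMap.id

/-- `K` is (isomorphic to) the first syzygy module `Ω M`, the kernel of a projective cover. -/
def IsSyzygy (M K : Type u) [AddCommGroup M] [Module Λ M] [AddCommGroup K] [Module Λ K] : Prop :=
  ∃ (P : ModuleCat.{u} Λ) (π : P →ₗ[Λ] M), IsProjectiveCover π ∧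
    Nonempty (K ≃ₗ[Λ] LinearMap.ker π)

/-- A complete projective resolution
`⋯ → P₂ → P₁ → P₀ → P₋₁ → ⋯`: an exact complex of finitely generated projective modules
which stays exact under `Hom(-, Λ)`. Here `d i` is the map `P_{i+1} → P_i`. -/
structure CompleteResolution where
  P : ℤ → ModuleCat.{u} Λ
  finite : ∀ i, Module.Finite Λ (P i)
  projective : ∀ i, Module.Projective Λ (P i)
  d : ∀ i, P (i + 1) →ₗ[Λ] P i
  exact : ∀ i, Function.Exact (d (i + 1)) (d i)
  hom_exact : ∀ i, Function.Exact (fun h : P i →ₗ[Λ] Λ => h ∘ₗ d i)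
    (fun g : P (i + 1) →ₗ[Λ] Λ => g ∘ₗ d (i + 1))

/-- Gorenstein projective modules: the images of the differentials of complete projective
resolutions. (By shifting, it does not matter which differential is taken.) -/
def IsGorensteinProjective (M : Type u) [AddCommGroup M] [Module Λ M] : Prop :=
  ∃ C : CompleteResolution Λ, Nonempty (M ≃ₗ[Λ] LinearMap.range (C.d 0))

/-- The indecomposable non-projective Gorenstein projective modules of finite length. -/
def IsIndecNonprojGP (N : ModuleCat.{u} Λ) : Prop :=
  IsFiniteLength Λ N ∧ IsIndecomposable Λ N ∧ ¬ Module.Projective Λ N ∧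
    IsGorensteinProjective Λ N

/-- The modules in the Gorenstein core: finite direct sums (up to direct summands) of
indecomposable non-projective Gorenstein projective modules and their projective covers. -/
def InCore (M : Type u) [AddCommGroup M] [Module Λ M] : Prop :=
  InAdd (fun N : ModuleCat.{u} Λ => IsIndecNonprojGP Λ N ∨
    ∃ (N' : ModuleCat.{u} Λ) (π : N →ₗ[Λ] N'), IsIndecNonprojGP Λ N' ∧ IsProjectiveCover π) M

/-- The simple modules whose projective cover belongs to the Gorenstein core. -/
def ClassX (S : ModuleCat.{u} Λ) : Prop :=
  IsSimpleModule Λ S ∧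
    ∃ (P : ModuleCat.{u} Λ) (π : P →ₗ[Λ] S), IsProjectiveCover π ∧ InCore Λ P

end Modules

section Duality

variable (k : Type v) [CommRing k] (Λ : Type u) [Ring Λ] [Algebra k Λ]

/-- The abelian group `Hom_k(M, E)`, for a left `Λ`-module `M` and a `k`-module `E`. -/
@[nolint unusedArguments]
def DualInto (M : Type w) [AddCommGroup M] [Module k M] [Module Λ M] (E : Type v)
    [AddCommGroup E] [Module k E] : Type (max w v) :=
  M →ₗ[k] E

section

variable (M : Type w) [AddCommGroup M] [Module k M] [Module Λ M] (E : Type v) [AddCommGroup E]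
  [Module k E]

instance : AddCommGroup (DualInto k Λ M E) :=
  inferInstanceAs (AddCommGroup (M →ₗ[k] E))

/-- `Hom_k(M, E)` is a right `Λ`-module by `(f a)(m) = f (a m)`. -/
instance [IsScalarTower k Λ M] : Module Λᵐᵒᵖ (DualInto k Λ M E) where
  smul a f := LinearMap.comp (show M →ₗ[k] E from f) (Algebra.lsmul k k M a.unop)
  one_smul f := LinearMap.ext fun m => congrArg (show M →ₗ[k] E from f) (one_smul Λ m)
  mul_smul a b f := LinearMap.ext fun m =>
    congrArg (show M →ₗ[k] E from f) (mul_smul b.unop a.unop m)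
  smul_zero _ := rfl
  smul_add _ _ _ := rfl
  add_smul a b f := LinearMap.ext fun m =>
    (congrArg (show M →ₗ[k] E from f) (add_smul a.unop b.unop m)).trans
      (map_add (show M →ₗ[k] E from f) _ _)
  zero_smul f := LinearMap.ext fun m =>
    (congrArg (show M →ₗ[k] E from f) (zero_smul Λ m)).trans
      (map_zero (show M →ₗ[k] E from f))

end

/-- For a map `f : P₁ → P₀` of right `Λ`-modules, the map of left `Λ`-modules
`Hom_Λ(P₀, Λ) → Hom_Λ(P₁, Λ)`, `g ↦ g ∘ f`; the left module structures are
`(a g)(x) = a g(x)`. -/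
def homMap {Λ : Type u} [Ring Λ] {P₁ P₀ : Type*} [AddCommGroup P₁] [Module Λᵐᵒᵖ P₁]
    [AddCommGroup P₀] [Module Λᵐᵒᵖ P₀] (f : P₁ →ₗ[Λᵐᵒᵖ] P₀) :
    (P₀ →ₗ[Λᵐᵒᵖ] Λ) →ₗ[Λ] (P₁ →ₗ[Λᵐᵒᵖ] Λ) where
  toFun g := g ∘ₗ f
  map_add' _ _ := rfl
  map_smul' _ _ := rfl

/-- The left `Λ`-module `T` is (isomorphic to) the transpose `Tr N` of the right `Λ`-module `N`:
the cokernel of `Hom_Λ(P₀, Λ) → Hom_Λ(P₁, Λ)`, where `P₁ → P₀ → N → 0` is a minimal projective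
presentation. -/
def IsTranspose (N : Type w) [AddCommGroup N] [Module Λᵐᵒᵖ N]
    (T : Type u) [AddCommGroup T] [Module Λ T] : Prop :=
  ∃ (P₁ P₀ : ModuleCat.{u} Λᵐᵒᵖ) (f : P₁ →ₗ[Λᵐᵒᵖ] P₀) (p : P₀ →ₗ[Λᵐᵒᵖ] N),
    IsMinimalProjectivePresentation f p ∧
      Nonempty (T ≃ₗ[Λ] ((P₁ →ₗ[Λᵐᵒᵖ] Λ) ⧸ LinearMap.range (homMap f)))

/-- `T` is (isomorphic to) `τ⁻ M = Tr D M`, where `D = Hom_k(-, E)` and `E` is the injective hull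
of the `k`-module `k / rad k`;
a `Λ`-module is regarded as a `k`-module through `k → Λ`. -/
def IsTauInv (M : Type w) [AddCommGroup M] [Module Λ M]
    (T : Type u) [AddCommGroup T] [Module Λ T] : Prop :=
  letI : Module k M := Module.restrictScalars k Λ M
  haveI : IsScalarTower k Λ M := IsScalarTower.restrictScalars k Λ M
  ∃ (E : ModuleCat.{v} k) (ι : (k ⧸ Ring.jacobson k) →ₗ[k] E), IsInjectiveHull ι ∧
    IsTranspose Λ (DualInto k Λ M E) T

/-- The class `τ⁻ 𝒳` of the modules `τ⁻ S` with `S` in `𝒳`. -/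
def TauInvClass (𝒳 : ModuleCat.{u} Λ → Prop) (T : ModuleCat.{u} Λ) : Prop :=
  ∃ S : ModuleCat.{u} Λ, 𝒳 S ∧ IsTauInv k Λ S T

end Duality

end NakayamaCore

/-! Over a Nakayama algebra every finite length module is a finite direct sum of nonzero quotients Y
of uniserial modules `pim e`, with `e` a primitive idempotent. Each of the three conditions can be
tested on these summands, so the question concerns one local module Y at a time. Call `e` core
(`IsCoreIdem`) if `pim e` covers an indecomposable non-projective Gorenstein projective module; a
simple module lies in 𝒳 exactly when its idempotent is core (`classX_iff`). So the condition on top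
Y says that `e` is core, and for projective Y this already decides membership in the core.

Let Y be non-projective and let `g` be the idempotent of top ΩY. The heart is
`inCore_iff_of_not_projective`: Y is in the core iff `e` and `g` are core. Necessity holds because
syzygies of Gorenstein projectives are Gorenstein projective. For sufficiency, the class
`IsCoreQuot` is shown to be closed under syzygies and cosyzygies, taken along inclusions through
which all maps to Λ extend; splicing gives a complete resolution
(`isGorensteinProjective_of_class`). Two facts make this work. No indecomposable projective embeds
properly in `pim e` for core `e` (`IsCoreIdem.surjective_of_injective`), so every inclusion into
`pim e` has the extension property. And the radical of P(soc Y) maps onto ΩY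
(`exists_surjective_ker`), so the socle of Y and the top of ΩY determine each other
(`IsSerial.nonempty_linearEquiv_of_radical`).

The socle condition is a rewriting of the syzygy condition. If K is simple with rad P(K) nonzero,
then K is τ⁻S, for S simple, exactly when S is the top of rad P(K); this comes from the minimal
presentation of the simple right module DS, whose transpose is Λm/Λr. With K = soc Y that top is top
ΩY. For projective Y in the core the socle condition holds automatically
(`IsCoreIdem.exists_hasTop_ker`).

The main tool throughout is `IsSerial.exists_extension`, which combines left and right uniseriality;
it also yields the decomposition into local modules. -/

namespace NakayamaCore

/-! ### Uniserial modules and projective covers -/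

section General

variable {R : Type*} [Ring R] {M N P P' M' : Type*} [AddCommGroup M] [Module R M]
  [AddCommGroup N] [Module R N] [AddCommGroup P] [Module R P] [AddCommGroup P'] [Module R P']
  [AddCommGroup M'] [Module R M']

theorem IsUniserial.of_surjective (h : IsUniserial R M) (f : M →ₗ[R] N)
    (hf : Function.Surjective f) : IsUniserial R N := fun A B =>
  (h (A.comap f) (B.comap f)).imp (Submodule.comap_le_comap_iff_of_surjective hf).1
    (Submodule.comap_le_comap_iff_of_surjective hf).1

theorem IsUniserial.of_injective (h : IsUniserial R N) (f : M →ₗ[R] N)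
    (hf : Function.Injective f) : IsUniserial R M := fun A B =>
  (h (A.map f) (B.map f)).imp (Submodule.map_le_map_iff_of_injective hf _ _).1
    (Submodule.map_le_map_iff_of_injective hf _ _).1

theorem IsUniserial.eq_bot_or_eq_bot (h : IsUniserial R M) {A B : Submodule R M}
    (hAB : A ⊓ B = ⊥) : A = ⊥ ∨ B = ⊥ := by
  rcases h A B with h | h
  · left; rwa [inf_eq_left.2 h] at hAB
  · right; rwa [inf_eq_right.2 h] at hAB

theorem IsUniserial.eq_top_or_eq_top (h : IsUniserial R M) {A B : Submodule R M}
    (hAB : A ⊔ B = ⊤) : A = ⊤ ∨ B = ⊤ := by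
  rcases h A B with h | h
  · right; rwa [sup_eq_right.2 h] at hAB
  · left; rwa [sup_eq_left.2 h] at hAB

theorem IsUniserial.isIndecomposable [Nontrivial M] (h : IsUniserial R M) :
    IsIndecomposable R M :=
  ⟨inferInstance, fun _ _ hc => h.eq_bot_or_eq_bot hc.inf_eq_bot⟩

theorem IsUniserial.isSuperfluous (h : IsUniserial R M) {K : Submodule R M} (hK : K ≠ ⊤) :
    IsSuperfluous K := fun _ hN => (h.eq_top_or_eq_top hN).resolve_right hK

theorem IsUniserial.isProjectiveCover (h : IsUniserial R P) [Module.Projective R P]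
    [Nontrivial M] (f : P →ₗ[R] M) (hf : Function.Surjective f) : IsProjectiveCover f where
  projective := inferInstance
  surjective := hf
  superfluous := h.isSuperfluous fun hk => by
    obtain ⟨m, hm⟩ := exists_ne (0 : M)
    obtain ⟨x, rfl⟩ := hf m
    exact hm (LinearMap.mem_ker.1 (hk ▸ Submodule.mem_top))

/-- An endomorphism of `P'` over the identity of `M'` is onto, since its image and the superfluous
kernel span `P'`. So the lift `J ∘ I` splits, and composing `J` with the splitting corrects it to
the identity. Only `π'` has to be a cover, so retracts of images in an arbitrary resolution can be
lifted. -/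
theorem IsProjectiveCover.exists_lifts {π : P →ₗ[R] M} {π' : P' →ₗ[R] M'}
    (h' : IsProjectiveCover π') [Module.Projective R P] (hπ : Function.Surjective π)
    (i : M' →ₗ[R] M) (r : M →ₗ[R] M') (hri : r ∘ₗ i = LinearMap.id) :
    ∃ (I : P' →ₗ[R] P) (J : P →ₗ[R] P'), J ∘ₗ I = LinearMap.id ∧ π ∘ₗ I = i ∘ₗ π' ∧
      π' ∘ₗ J = r ∘ₗ π := by
  have := h'.projective
  obtain ⟨I, hI⟩ := Module.projective_lifting_property π (i ∘ₗ π') hπ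
  obtain ⟨J, hJ⟩ := Module.projective_lifting_property π' (r ∘ₗ π) h'.surjective
  have hα : π' ∘ₗ (J ∘ₗ I) = π' := by
    rw [← LinearMap.comp_assoc, hJ, LinearMap.comp_assoc, hI, ← LinearMap.comp_assoc, hri,
      LinearMap.id_comp]
  have surj : ∀ β : P' →ₗ[R] P', π' ∘ₗ β = π' → Function.Surjective β := by
    intro β hβ
    rw [← LinearMap.range_eq_top]
    apply h'.superfluous
    rw [eq_top_iff]
    intro x _
    have : x = β x + (x - β x) := by abel
    rw [this]
    refine Submodule.add_mem_sup ⟨x, rfl⟩ ?_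
    have := LinearMap.congr_fun hβ x
    simp only [LinearMap.comp_apply] at this
    simp [this]
  obtain ⟨σ, hσ⟩ := Module.projective_lifting_property (J ∘ₗ I) LinearMap.id (surj _ hα)
  have hσ' : π' ∘ₗ σ = π' := by
    conv_lhs => rw [← hα]
    rw [LinearMap.comp_assoc, hσ, LinearMap.comp_id]
  -- `σ` also lies over the identity, hence is onto; so this right inverse of `J ∘ I` is a left
  -- inverse as well.
  refine ⟨I, σ ∘ₗ J, ?_, hI, ?_⟩
  · ext x
    obtain ⟨y, rfl⟩ := surj σ hσ' x
    exact congrArg σ (LinearMap.congr_fun hσ y)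
  · rw [← LinearMap.comp_assoc, hσ', hJ]

theorem IsProjectiveCover.exists_equiv {π : P →ₗ[R] M} {π' : P' →ₗ[R] M}
    (h : IsProjectiveCover π) (h' : IsProjectiveCover π') :
    ∃ φ : P' ≃ₗ[R] P, ∀ x, π (φ x) = π' x := by
  have := h.projective
  obtain ⟨I, J, hJI, hI, hJ⟩ := h'.exists_lifts h.surjective LinearMap.id LinearMap.id rfl
  have hinj : Function.Injective I := fun x y hxy => by
    have := congrArg J hxy
    rwa [← LinearMap.comp_apply, ← LinearMap.comp_apply, hJI] at this
  have hsurj : Function.Surjective I := by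
    rw [← LinearMap.range_eq_top]
    apply h.superfluous
    rw [eq_top_iff]
    intro x _
    have hx : x = I (J x) + (x - I (J x)) := by abel
    rw [hx]
    refine Submodule.add_mem_sup ⟨_, rfl⟩ ?_
    have h1 := LinearMap.congr_fun hI (J x)
    have h2 := LinearMap.congr_fun hJ x
    simp only [LinearMap.comp_apply, LinearMap.id_apply] at h1 h2
    simp [h1, h2]
  exact ⟨LinearEquiv.ofBijective I ⟨hinj, hsurj⟩, fun x => LinearMap.congr_fun hI x⟩

/-- A linear map factors through a surjection with smaller kernel. -/
theorem exists_factor (p : P →ₗ[R] M) (hp : Function.Surjective p) (f : P →ₗ[R] N)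
    (h : ∀ x, p x = 0 → f x = 0) : ∃ g : M →ₗ[R] N, ∀ x, g (p x) = f x := by
  refine ⟨(LinearMap.ker p).liftQ f h ∘ₗ (p.quotKerEquivOfSurjective hp).symm.toLinearMap,
    fun x => ?_⟩
  have : (p.quotKerEquivOfSurjective hp).symm (p x) = Submodule.Quotient.mk x := by
    rw [LinearEquiv.symm_apply_eq]; rfl
  rw [LinearMap.comp_apply, LinearEquiv.coe_coe, this]
  exact Submodule.liftQ_apply _ _ _

theorem exists_factor_of_span {b : M} (hb : Submodule.span R {b} = ⊤) (a : N)
    (h : ∀ x : R, x • b = 0 → x • a = 0) : ∃ g : M →ₗ[R] N, g b = a := by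
  have hs : Function.Surjective (LinearMap.toSpanSingleton R M b) := by
    rw [← LinearMap.range_eq_top, LinearMap.range_toSpanSingleton, hb]
  obtain ⟨g, hg⟩ := exists_factor _ hs (LinearMap.toSpanSingleton R N a) (by simpa using h)
  exact ⟨g, by simpa using hg 1⟩

theorem injective_endo_bijective [IsArtinian R M] (f : M →ₗ[R] M) (hf : Function.Injective f) :
    Function.Bijective f := ⟨hf, IsArtinian.surjective_of_injective_endomorphism f hf⟩

theorem bijective_of_injective_of_length_le [IsNoetherian R M] [IsArtinian R M]
    (f : N →ₗ[R] M) (hf : Function.Injective f) (h : Module.length R M ≤ Module.length R N) :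
    Function.Bijective f := by
  refine ⟨hf, ?_⟩
  rw [← LinearMap.range_eq_top]
  by_contra hne
  have h1 := Submodule.length_lt hne
  rw [← (LinearEquiv.ofInjective f hf).length_eq] at h1
  exact absurd h (not_le.2 h1)

/-- The image of `i` meets the kernel of `f` trivially, so one of them is zero, and it cannot be the
image. Hence a map out of a uniserial module is injective once it is so on one nonzero submodule. -/
theorem IsUniserial.injective_of_comp_injective (h : IsUniserial R M) [Nontrivial N]
    (i : N →ₗ[R] M) (f : M →ₗ[R] P) (hfi : Function.Injective (f ∘ₗ i)) :
    Function.Injective f := by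
  have hd : LinearMap.range i ⊓ LinearMap.ker f = ⊥ := by
    rw [eq_bot_iff]
    rintro _ ⟨⟨x, rfl⟩, hx⟩
    have : x = 0 := hfi (by simpa using hx)
    simp [this]
  rcases h.eq_bot_or_eq_bot hd with h | h
  · obtain ⟨x, hx⟩ := exists_ne (0 : N)
    have hix : i x = 0 := by
      have : i x ∈ LinearMap.range i := ⟨x, rfl⟩
      rwa [h, Submodule.mem_bot] at this
    exact absurd (hfi (by simp [hix]) : x = 0) hx
  · exact LinearMap.ker_eq_bot.1 h

/-- A non-trivial artinian uniserial module has a smallest non-zero submodule. -/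
theorem IsUniserial.exists_mem_of_ne_bot [IsArtinian R M] [Nontrivial M] (h : IsUniserial R M) :
    ∃ K : Submodule R M, IsSimpleModule R K ∧ ∀ N : Submodule R M, N ≠ ⊥ → K ≤ N := by
  obtain ⟨K, hK⟩ := IsAtomic.exists_atom (Submodule R M)
  refine ⟨K, isSimpleModule_iff_isAtom.2 hK, fun N hN => (h K N).elim id fun hle => ?_⟩
  rcases hK.le_iff.1 hle with h | h
  · exact absurd h hN
  · exact h.ge

end General

/-! ### Primitive idempotents and the left ideals they generate -/

section Idempotents

variable {R : Type*} [Ring R]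

/-- Primitive idempotents. -/
def IsPrim (e : R) : Prop :=
  IsIdempotentElem e ∧ e ≠ 0 ∧ ∀ f, IsIdempotentElem f → e * f = f → f * e = f → f = 0 ∨ f = e

/-- Splitting a non-primitive idempotent as `f + (e - f)` strictly shrinks the left ideals, so the
process stops. The additive closure suffices because orthogonality of the summands is never needed,
only induction over sums. -/
theorem one_mem_closure_isPrim [IsArtinianRing R] :
    (1 : R) ∈ AddSubmonoid.closure {e : R | IsPrim e} := by
  suffices ∀ I : Submodule R R, ∀ e : R, Submodule.span R {e} = I → IsIdempotentElem e →
      e ∈ AddSubmonoid.closure {e : R | IsPrim e} from this _ 1 rfl IsIdempotentElem.one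
  intro I
  induction I using WellFoundedLT.induction with
  | ind I ih =>
  rintro e rfl he
  by_cases hp : IsPrim e
  · exact AddSubmonoid.subset_closure hp
  by_cases h0 : e = 0
  · rw [h0]; exact zero_mem _
  have : ∃ f, IsIdempotentElem f ∧ e * f = f ∧ f * e = f ∧ f ≠ 0 ∧ f ≠ e := by
    by_contra hcon
    push Not at hcon
    exact hp ⟨he, h0, fun f hf h1 h2 => or_iff_not_imp_left.2 (hcon f hf h1 h2)⟩
  obtain ⟨f, hf, hef, hfe, hf0, hfne⟩ := this
  have hg : IsIdempotentElem (e - f) := by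
    unfold IsIdempotentElem at *
    rw [mul_sub, sub_mul, sub_mul, he, hfe, hef, hf, sub_self, sub_zero]
  have key : ∀ g : R, g * e = g → e * g = g → g * g = g → g ≠ e →
      Submodule.span R {g} < Submodule.span R {e} := by
    intro g hge heg hgg hne
    refine lt_of_le_of_ne ?_ fun heq => ?_
    · rw [Submodule.span_singleton_le_iff_mem, Submodule.mem_span_singleton]
      exact ⟨g, hge⟩
    · have : e ∈ Submodule.span R {g} := heq ▸ Submodule.mem_span_singleton_self e
      obtain ⟨y, hy⟩ := Submodule.mem_span_singleton.1 this
      apply hne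
      rw [← heg, ← hy, smul_eq_mul, mul_assoc, hgg]
  have h1 := ih _ (key f hfe hef hf hfne) f rfl hf
  have h2 := ih _ (key (e - f) (by rw [sub_mul, he, hfe]) (by rw [mul_sub, he, hef]) hg
    (by simpa using hf0)) (e - f) rfl hg
  simpa using add_mem h1 h2

/-- The left ideal generated by `e`; an indecomposable projective module if `e` is a
primitive idempotent. -/
abbrev pim (e : R) : Submodule R R := Submodule.span R {e}

theorem mem_pim {e x : R} (he : IsIdempotentElem e) : x ∈ pim e ↔ x * e = x := by
  rw [Submodule.mem_span_singleton]
  refine ⟨?_, fun h => ⟨x, h⟩⟩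
  rintro ⟨y, rfl⟩
  rw [smul_eq_mul, mul_assoc, he]

/-- The generator `e` of `pim e`. -/
def pimGen (e : R) : pim e := ⟨e, Submodule.mem_span_singleton_self e⟩

theorem smul_pimGen {e : R} (he : IsIdempotentElem e) : e • pimGen e = pimGen e :=
  Subtype.ext he

theorem eq_smul_pimGen {e : R} (he : IsIdempotentElem e) (x : pim e) : x = x.1 • pimGen e :=
  Subtype.ext ((mem_pim he).1 x.2).symm

theorem span_pimGen {e : R} (he : IsIdempotentElem e) : Submodule.span R {pimGen e} = ⊤ := by
  rw [eq_top_iff]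
  intro x _
  rw [eq_smul_pimGen he x]
  exact Submodule.smul_mem _ _ (Submodule.mem_span_singleton_self _)

variable {A B : Type*} [AddCommGroup A] [Module R A] [AddCommGroup B] [Module R B]

/-- The homomorphism `pim e → A` given by right multiplication on `a`. -/
def pimHom (e : R) (a : A) : pim e →ₗ[R] A :=
  (LinearMap.toSpanSingleton R A a).domRestrict (pim e)

theorem pimHom_apply (e : R) (a : A) (x : pim e) : pimHom e a x = x.1 • a := rfl

theorem pimHom_ext {e : R} (he : IsIdempotentElem e) {f g : pim e →ₗ[R] A}
    (h : f (pimGen e) = g (pimGen e)) : f = g := by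
  ext x
  rw [eq_smul_pimGen he x, map_smul, map_smul, h]

theorem projective_pim {e : R} (he : IsIdempotentElem e) : Module.Projective R (pim e) := by
  refine Module.Projective.of_split (pim e).subtype
    (LinearMap.toSpanSingleton R (pim e) (pimGen e)) ?_
  ext x
  simp [pimGen, (mem_pim he).1 x.2]

theorem finite_pim (e : R) : Module.Finite R (pim e) :=
  Module.Finite.iff_fg.2 (Submodule.fg_span_singleton e)

theorem IsPrim.nontrivial {e : R} (he : IsPrim e) : Nontrivial (pim e) :=
  ⟨pimGen e, 0, fun h => he.2.1 (congrArg Subtype.val h)⟩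

/-- A decomposition writes the generator as `f + f'`; comparing components shows that `f` is an
idempotent below `e`, so primitivity applies. -/
theorem IsPrim.isIndecomposable {e : R} (he : IsPrim e) : IsIndecomposable R (pim e) := by
  refine ⟨he.nontrivial, fun N N' hN => ?_⟩
  have hg : pimGen e ∈ N ⊔ N' := hN.sup_eq_top ▸ Submodule.mem_top
  obtain ⟨f, hf, f', hf', hff⟩ := Submodule.mem_sup.1 hg
  have hsum : f.1 + f'.1 = e := congrArg Subtype.val hff
  have hfe := (mem_pim he.1).1 f.2
  have h1 : f.1 • f ∈ N := N.smul_mem _ hf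
  have h2 : f.1 • f' ∈ N' := N'.smul_mem _ hf'
  have hdisj : ∀ x, x ∈ N → x ∈ N' → x = 0 := fun x hx hx' => by
    have : x ∈ N ⊓ N' := ⟨hx, hx'⟩
    rwa [hN.inf_eq_bot] at this
  have h3 : f = f.1 • f + f.1 • f' := by
    apply Subtype.ext
    change f.1 = f.1 * f.1 + f.1 * f'.1
    rw [← mul_add, hsum, hfe]
  have h4 : f.1 • f' = 0 := hdisj _ (by
    have : f.1 • f' = f - f.1 • f := by nth_rw 2 [h3]; abel
    rw [this]; exact N.sub_mem hf h1) h2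
  have h5 : f.1 * f.1 = f.1 := by
    have := congrArg Subtype.val h3
    rw [h4, add_zero] at this
    exact this.symm
  have h6 : f'.1 • f = 0 := by
    have hx : f'.1 • f = f' - f'.1 • f' := by
      apply Subtype.ext
      change f'.1 * f.1 = f'.1 - f'.1 * f'.1
      rw [eq_sub_iff_add_eq, ← mul_add, hsum, (mem_pim he.1).1 f'.2]
    exact hdisj _ (N.smul_mem _ hf) (by rw [hx]; exact N'.sub_mem hf' (N'.smul_mem _ hf'))
  have h7 : e * f.1 = f.1 := by
    have h8 := congrArg (· * f.1) hsum
    have h9 : f'.1 * f.1 = 0 := congrArg Subtype.val h6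
    simp only [add_mul, h5, h9, add_zero] at h8
    exact h8.symm
  have htop : ∀ L : Submodule R (pim e), pimGen e ∈ L → L = ⊤ := fun L hL => by
    rw [eq_top_iff, ← span_pimGen he.1, Submodule.span_singleton_le_iff_mem]
    exact hL
  rcases he.2.2 f.1 h5 h7 hfe with h | h
  · left
    have hf0 : f = 0 := Subtype.ext h
    rw [hf0, zero_add] at hff
    have := htop N' (hff ▸ hf')
    simpa [this] using hN.inf_eq_bot
  · right
    have hf0 : f = pimGen e := Subtype.ext h
    have := htop N (hf0 ▸ hf)
    simpa [this] using hN.inf_eq_bot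

/-- `A` is generated by an element of `e A`; for a primitive idempotent `e` and `A ≠ 0` this
means that `A` is local with projective cover `pim e`. -/
def HasTop (e : R) (A : Type*) [AddCommGroup A] [Module R A] : Prop :=
  ∃ a : A, e • a = a ∧ Submodule.span R {a} = ⊤

theorem pimHom_surjective {e : R} {a : A} (ha : e • a = a) (hs : Submodule.span R {a} = ⊤) :
    Function.Surjective (pimHom e a) := by
  rw [← LinearMap.range_eq_top, eq_top_iff, ← hs, Submodule.span_singleton_le_iff_mem]
  exact ⟨pimGen e, ha⟩

theorem HasTop.exists_surjective {e : R} (h : HasTop e A) :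
    ∃ p : pim e →ₗ[R] A, Function.Surjective p :=
  let ⟨_, ha, hs⟩ := h
  ⟨_, pimHom_surjective ha hs⟩

theorem HasTop.of_surjective {e : R} (h : HasTop e A) (f : A →ₗ[R] B)
    (hf : Function.Surjective f) : HasTop e B := by
  obtain ⟨a, ha, hs⟩ := h
  refine ⟨f a, by rw [← map_smul, ha], ?_⟩
  rw [← Set.image_singleton, ← Submodule.map_span, hs, Submodule.map_top,
    LinearMap.range_eq_top.2 hf]

theorem hasTop_pim {e : R} (he : IsIdempotentElem e) : HasTop e (pim e) :=
  ⟨pimGen e, smul_pimGen he, span_pimGen he⟩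

theorem HasTop.finite {e : R} (h : HasTop e A) : Module.Finite R A := by
  obtain ⟨a, _, hs⟩ := h
  exact ⟨⟨{a}, by simpa using hs⟩⟩

/-- Two surjections from a module to local modules: the top can be lifted. -/
theorem HasTop.lift {e : R} (he : IsIdempotentElem e) (hA : IsUniserial R A) [Nontrivial B]
    (f : A →ₗ[R] B) (hf : Function.Surjective f) (h : HasTop e B) : HasTop e A := by
  obtain ⟨b, hb, hs⟩ := h
  obtain ⟨a, rfl⟩ := hf b
  refine ⟨e • a, by rw [← mul_smul, he], ?_⟩
  have hsup : Submodule.span R {e • a} ⊔ LinearMap.ker f = ⊤ := by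
    rw [eq_top_iff]
    intro x _
    have hx : f x ∈ Submodule.span R {f a} := hs ▸ Submodule.mem_top
    obtain ⟨y, hy⟩ := Submodule.mem_span_singleton.1 hx
    have : x = y • e • a + (x - y • e • a) := by abel
    rw [this]
    refine Submodule.add_mem_sup
      (Submodule.smul_mem _ _ (Submodule.mem_span_singleton_self _)) ?_
    rw [LinearMap.mem_ker, map_sub, map_smul, map_smul, hb, hy, sub_self]
  refine (hA.eq_top_or_eq_top hsup).resolve_right fun hk => ?_
  obtain ⟨m, hm⟩ := exists_ne (0 : B)
  obtain ⟨x, rfl⟩ := hf m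
  exact hm (LinearMap.mem_ker.1 (hk ▸ Submodule.mem_top))

end Idempotents

end NakayamaCore

/-! ### Serial rings and the extension of homomorphisms -/

namespace NakayamaCore

/-- Primitive idempotents generate uniserial left and right ideals. -/
structure IsSerial (R : Type*) [Ring R] : Prop where
  left : ∀ e : R, IsPrim e → IsUniserial R (pim e)
  right : ∀ h : R, IsPrim h → ∀ x y, h * x = x → h * y = y →
    (∃ t, x = y * t) ∨ (∃ t, y = x * t)

section

variable {R : Type*} [Ring R]
variable {A B X : Type*} [AddCommGroup A] [Module R A] [AddCommGroup B] [Module R B]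
  [AddCommGroup X] [Module R X]

theorem isPrim_op {e : R} (he : IsPrim e) : IsPrim (MulOpposite.op e) := by
  obtain ⟨h1, h2, h3⟩ := he
  refine ⟨congrArg MulOpposite.op h1, fun h => h2 (MulOpposite.op_injective h), fun f hf h4 h5 => ?_⟩
  refine (h3 f.unop (congrArg MulOpposite.unop hf) (congrArg MulOpposite.unop h5)
    (congrArg MulOpposite.unop h4)).imp (fun h => ?_) (fun h => ?_)
  · rw [← MulOpposite.op_unop f, h, MulOpposite.op_zero]
  · rw [← MulOpposite.op_unop f, h]

theorem IsUniserial.exists_mul {e x y : R} (he : IsIdempotentElem e)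
    (h : IsUniserial R (pim e)) (hx : x * e = x) (hy : y * e = y) :
    (∃ t, x = t * y) ∨ (∃ t, y = t * x) := by
  let x' : pim e := ⟨x, (mem_pim he).2 hx⟩
  let y' : pim e := ⟨y, (mem_pim he).2 hy⟩
  rcases h (Submodule.span R {x'}) (Submodule.span R {y'}) with h | h
  · left
    obtain ⟨t, ht⟩ := Submodule.mem_span_singleton.1
      (h (Submodule.mem_span_singleton_self x'))
    exact ⟨t, (congrArg Subtype.val ht).symm⟩
  · right
    obtain ⟨t, ht⟩ := Submodule.mem_span_singleton.1
      (h (Submodule.mem_span_singleton_self y'))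
    exact ⟨t, (congrArg Subtype.val ht).symm⟩

/-- Left ideals of the opposite ring are right ideals, and their comparability becomes divisibility
among elements of `hΛ`. -/
theorem IsNakayama.isSerial {Λ : Type u} [Ring Λ] (h : IsNakayama Λ) : IsSerial Λ where
  left e he := h.1 _ (finite_pim e) (projective_pim he.1) he.isIndecomposable
  right e he x y hx hy := by
    have he' := isPrim_op he
    have := IsUniserial.exists_mul (x := MulOpposite.op x) (y := MulOpposite.op y) he'.1
      (h.2 _ (finite_pim _) (projective_pim he'.1) he'.isIndecomposable)
      (congrArg MulOpposite.op hx) (congrArg MulOpposite.op hy)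
    exact this.imp (fun ⟨t, ht⟩ => ⟨t.unop, congrArg MulOpposite.unop ht⟩)
      (fun ⟨t, ht⟩ => ⟨t.unop, congrArg MulOpposite.unop ht⟩)

theorem IsSerial.isUniserial (hR : IsSerial R) {e : R} (he : IsPrim e) (h : HasTop e A) :
    IsUniserial R A :=
  let ⟨p, hp⟩ := h.exists_surjective
  (hR.left e he).of_surjective p hp

theorem mem_of_forall_isPrim [IsArtinianRing R] (N : Submodule R A) (x : A)
    (h : ∀ e : R, IsPrim e → e • x ∈ N) : x ∈ N := by
  suffices ∀ a ∈ AddSubmonoid.closure {e : R | IsPrim e}, a • x ∈ N by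
    simpa using this 1 one_mem_closure_isPrim
  intro a ha
  induction ha using AddSubmonoid.closure_induction with
  | mem a ha => exact h a ha
  | zero => simp
  | add a b _ _ ha hb => rw [add_smul]; exact N.add_mem ha hb

theorem exists_isPrim_smul_ne_zero [IsArtinianRing R] {x : A} (hx : x ≠ 0) :
    ∃ e : R, IsPrim e ∧ e • x ≠ 0 := by
  by_contra h
  push Not at h
  exact hx ((Submodule.mem_bot R).1 (mem_of_forall_isPrim ⊥ x fun e he => by simp [h e he]))

/-- Among the submodules generated by some `u x` with `x` fixed by a primitive idempotent, take a
maximal one. Uniseriality makes it contain all the others, and these span the range. -/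
theorem IsUniserial.exists_generator [IsArtinianRing R] [IsNoetherian R A]
    (hA : IsUniserial R A) (u : X →ₗ[R] A) (hu : ∃ x, u x ≠ 0) :
    ∃ h : R, IsPrim h ∧ ∃ x, h • x = x ∧ LinearMap.range u = Submodule.span R {u x} := by
  let S : Set (Submodule R A) := {N | ∃ h : R, IsPrim h ∧ ∃ x, h • x = x ∧
    N = Submodule.span R {u x}}
  have hidem : ∀ h : R, IsPrim h → ∀ x : X, h • h • x = h • x := fun h hh x => by
    rw [← mul_smul, hh.1]
  have hS : S.Nonempty := by
    obtain ⟨x, _⟩ := hu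
    obtain ⟨h, hh, _⟩ := exists_isPrim_smul_ne_zero (R := R) ‹u x ≠ 0›
    exact ⟨_, h, hh, h • x, hidem h hh x, rfl⟩
  obtain ⟨N, ⟨h, hh, x, hx, rfl⟩, hmax⟩ :=
    WellFounded.has_min (wellFounded_gt (α := Submodule R A)) S hS
  refine ⟨h, hh, x, hx, le_antisymm ?_ ?_⟩
  · rintro _ ⟨y, rfl⟩
    refine mem_of_forall_isPrim _ _ fun e he => ?_
    rw [← map_smul]
    rcases hA (Submodule.span R {u (e • y)}) (Submodule.span R {u x}) with hle | hle
    · exact hle (Submodule.mem_span_singleton_self _)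
    · rcases hle.lt_or_eq with hlt | heq
      · exact absurd hlt (hmax _ ⟨e, he, e • y, hidem e he y, rfl⟩)
      · rw [heq]; exact Submodule.mem_span_singleton_self _
  · rw [Submodule.span_singleton_le_iff_mem]; exact ⟨x, rfl⟩

theorem IsUniserial.exists_hasTop [IsArtinianRing R] [IsNoetherian R A] [Nontrivial A]
    (hA : IsUniserial R A) : ∃ e : R, IsPrim e ∧ HasTop e A := by
  obtain ⟨a, ha⟩ := exists_ne (0 : A)
  obtain ⟨e, he, x, hx, hr⟩ := hA.exists_generator LinearMap.id ⟨a, ha⟩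
  exact ⟨e, he, x, hx, by simpa using hr.symm⟩

/-- Two local modules over a uniserial projective module whose submodules generated by `s`
times the generator agree: one embeds in the other. -/
theorem IsUniserial.exists_injective {f s : R} (hf : IsIdempotentElem f)
    (hU : IsUniserial R (pim f)) {a : A} {b : B} (hb : f • b = b)
    (hbs : Submodule.span R {b} = ⊤) (ha : f • a = a) (hsf : s * f = s) (hs : s • b ≠ 0)
    (hiff : ∀ y : R, (y * s) • b = 0 ↔ (y * s) • a = 0) :
    ∃ H : B →ₗ[R] A, Function.Injective H ∧ H b = a := by
  have hs' : s • a ≠ 0 := fun h => hs (by simpa [h] using hiff 1)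
  -- Annihilators are compared through `x * f` and `s` in `pim f`. If `x * f` is a multiple of `s`,
  -- use `hiff`; if `s` is a multiple of `x * f`, then `s` kills the generator, which is excluded.
  have h1 : ∀ x : R, x • b = 0 → x • a = 0 := fun x hx => by
    rcases hU.exists_mul hf (x := x * f) (y := s) (by rw [mul_assoc, hf]) hsf with ⟨t, ht⟩ | ⟨t, ht⟩
    · rw [← ha, ← mul_smul, ht, ← hiff, ← ht, mul_smul, hb, hx]
    · exact absurd (by rw [ht, mul_smul, mul_smul, hb, hx, smul_zero]) hs
  have h2 : ∀ x : R, x • a = 0 → x • b = 0 := fun x hx => by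
    rcases hU.exists_mul hf (x := x * f) (y := s) (by rw [mul_assoc, hf]) hsf with ⟨t, ht⟩ | ⟨t, ht⟩
    · rw [← hb, ← mul_smul, ht, hiff, ← ht, mul_smul, ha, hx]
    · exact absurd (by rw [ht, mul_smul, mul_smul, ha, hx, smul_zero]) hs'
  obtain ⟨H, hH⟩ := exists_factor_of_span hbs a h1
  refine ⟨H, ?_, hH⟩
  rw [injective_iff_map_eq_zero]
  intro z hz
  have hz' : z ∈ Submodule.span R {b} := hbs ▸ Submodule.mem_top
  obtain ⟨x, rfl⟩ := Submodule.mem_span_singleton.1 hz'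
  rw [map_smul, hH] at hz
  exact h2 x hz

/-- Send `b` to `(f * t) • a`: because `r = s * t`, this takes `v x₀ = s • b` to `u x₀`, and every
element of `X` is a multiple of `x₀` modulo the common kernel. -/
theorem exists_extension_of_eq_mul {f r s t : R} (hf : IsIdempotentElem f)
    (hU : IsUniserial R (pim f)) {a : A} {b : B} (hb : f • b = b)
    (hbs : Submodule.span R {b} = ⊤) (u : X →ₗ[R] A) (v : X →ₗ[R] B)
    (hk : ∀ x, u x = 0 ↔ v x = 0) {x₀ : X} (hx₀ : v x₀ ≠ 0) (hr : r • a = u x₀)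
    (hs : s • b = v x₀) (hsf : s * f = s) (hrst : r = s * t)
    (hrange : LinearMap.range u = Submodule.span R {u x₀}) :
    ∃ H : B →ₗ[R] A, Function.Injective H ∧ ∀ x, H (v x) = u x := by
  have hsa : s • (f * t) • a = u x₀ := by rw [← mul_smul, ← mul_assoc, hsf, ← hrst, hr]
  obtain ⟨H, hH, hHb⟩ := hU.exists_injective hf (a := (f * t) • a) hb hbs
    (by rw [← mul_smul, ← mul_assoc, hf]) hsf (by rwa [hs]) (fun y => by
      rw [mul_smul, hs, ← map_smul, ← hk, map_smul, ← hsa, ← mul_smul])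
  refine ⟨H, hH, fun x => ?_⟩
  have hx : u x ∈ Submodule.span R {u x₀} := hrange ▸ ⟨x, rfl⟩
  obtain ⟨y, hy⟩ := Submodule.mem_span_singleton.1 hx
  have : v (x - y • x₀) = 0 := by rw [← hk, map_sub, map_smul, hy, sub_self]
  rw [map_sub, map_smul, sub_eq_zero] at this
  rw [this, ← hs, map_smul, map_smul, hHb, hsa, hy]

/-- Given two homomorphisms with the same kernel to local modules, one of them factors through
the other. -/
theorem IsSerial.exists_extension [IsArtinianRing R] (hR : IsSerial R) {e f : R} (he : IsPrim e)
    (hf : IsPrim f) (hA : HasTop e A) (hB : HasTop f B) (u : X →ₗ[R] A) (v : X →ₗ[R] B)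
    (hk : ∀ x, u x = 0 ↔ v x = 0) (hu : ∃ x, u x ≠ 0) :
    (∃ G : A →ₗ[R] B, Function.Injective G ∧ ∀ x, G (u x) = v x) ∨
      (∃ H : B →ₗ[R] A, Function.Injective H ∧ ∀ x, H (v x) = u x) := by
  have := hA.finite
  have := hB.finite
  have hAu := hR.isUniserial he hA
  have hBu := hR.isUniserial hf hB
  obtain ⟨h, hh, x₀, hx₀, hrange⟩ := hAu.exists_generator u hu
  have hrange' : LinearMap.range v = Submodule.span R {v x₀} := by
    refine le_antisymm ?_ ?_
    · rintro _ ⟨x, rfl⟩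
      have hx : u x ∈ Submodule.span R {u x₀} := hrange ▸ ⟨x, rfl⟩
      obtain ⟨y, hy⟩ := Submodule.mem_span_singleton.1 hx
      have : v (x - y • x₀) = 0 := by rw [← hk, map_sub, map_smul, hy, sub_self]
      rw [map_sub, map_smul, sub_eq_zero] at this
      rw [this]
      exact Submodule.smul_mem _ _ (Submodule.mem_span_singleton_self _)
    · rw [Submodule.span_singleton_le_iff_mem]; exact ⟨x₀, rfl⟩
  have hux₀ : u x₀ ≠ 0 := fun h0 => by
    obtain ⟨x, hx⟩ := hu
    have hx' : u x ∈ Submodule.span R {u x₀} := hrange ▸ ⟨x, rfl⟩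
    rw [h0, Submodule.span_zero_singleton, Submodule.mem_bot] at hx'
    exact hx hx'
  have hvx₀ : v x₀ ≠ 0 := fun h0 => hux₀ ((hk _).2 h0)
  obtain ⟨a, ha, has⟩ := hA
  obtain ⟨b, hb, hbs⟩ := hB
  obtain ⟨r', hr'⟩ := Submodule.mem_span_singleton.1
    (has ▸ Submodule.mem_top : u x₀ ∈ Submodule.span R {a})
  obtain ⟨s', hs'⟩ := Submodule.mem_span_singleton.1
    (hbs ▸ Submodule.mem_top : v x₀ ∈ Submodule.span R {b})
  have hr : (h * r' * e) • a = u x₀ := by rw [mul_smul, ha, mul_smul, hr', ← map_smul, hx₀]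
  have hs : (h * s' * f) • b = v x₀ := by rw [mul_smul, hb, mul_smul, hs', ← map_smul, hx₀]
  -- Both coefficients lie in `hR`; right uniseriality decides which divides the other, hence which
  -- of the two maps extends.
  rcases hR.right h hh (h * r' * e) (h * s' * f) (by simp only [← mul_assoc, hh.1.eq])
    (by simp only [← mul_assoc, hh.1.eq]) with ⟨t, ht⟩ | ⟨t, ht⟩
  · right
    exact exists_extension_of_eq_mul hf.1 (hR.left f hf) hb hbs u v hk hvx₀ hr hs
      (by rw [mul_assoc, hf.1.eq]) ht hrange
  · left
    exact exists_extension_of_eq_mul he.1 (hR.left e he) ha has v u (fun x => (hk x).symm) hux₀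
      hs hr (by rw [mul_assoc, he.1.eq]) ht hrange'

end

/-! ### Splitting off local summands -/

section Decomposition

variable {R : Type*} [Ring R] [IsArtinianRing R]

/-- A local submodule `A` of maximal length splits off. If `N` is maximal among the submodules
meeting `A` trivially, the image `A'` of `A` is essential in `M ⧸ N`. The extension property maps
each local cyclic `B` to `A'`, compatibly with `A' ⊓ B`, and this forces `B ≤ A'`. Maximal length
rules out a proper embedding of `A'` into `B`. -/
theorem IsSerial.exists_isCompl (hR : IsSerial R) (M : Type*) [AddCommGroup M] [Module R M]
    [IsNoetherian R M] [IsArtinian R M] [Nontrivial M] :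
    ∃ A N : Submodule R M, IsCompl A N ∧ A ≠ ⊥ ∧ ∃ e : R, IsPrim e ∧ HasTop e A := by
  let S : Set (Submodule R M) := {A | ∃ e : R, IsPrim e ∧ ∃ a, e • a = a ∧
    A = Submodule.span R {a}}
  have htop := Module.length_ne_top (R := R) (M := M)
  have hidem : ∀ h : R, IsPrim h → ∀ x : M, h • h • x = h • x := fun h hh x => by
    rw [← mul_smul, hh.1]
  obtain ⟨m, hm⟩ := exists_ne (0 : M)
  obtain ⟨f, hf, hfm⟩ := exists_isPrim_smul_ne_zero (R := R) hm
  obtain ⟨A, hA, hmax⟩ : ∃ A ∈ S, ∀ B ∈ S, Module.length R B ≤ Module.length R A := by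
    obtain ⟨A, hA, hmin⟩ := WellFounded.has_min
      (measure fun A : Submodule R M => (Module.length R M).toNat -
        (Module.length R A).toNat).wf S ⟨_, f, hf, f • m, hidem f hf m, rfl⟩
    refine ⟨A, hA, fun B hB => ?_⟩
    have h1 := hmin B hB
    have hle : ∀ C : Submodule R M, Module.length R C ≤ Module.length R M := fun C =>
      Module.length_le_of_injective C.subtype C.injective_subtype
    have hn := hle A
    have hn' := hle B
    change ¬ ((Module.length R M).toNat - (Module.length R B).toNat <
      (Module.length R M).toNat - (Module.length R A).toNat) at h1
    lift Module.length R M to ℕ using htop with l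
    lift Module.length R A to ℕ using (ne_top_of_le_ne_top (by simp) hn) with l1
    lift Module.length R B to ℕ using (ne_top_of_le_ne_top (by simp) hn') with l2
    simp only [ENat.toNat_natCast] at h1
    norm_cast at *
    omega
  have hA0 : A ≠ ⊥ := fun h => by
    have h1 := hmax _ ⟨f, hf, f • m, hidem f hf m, rfl⟩
    rw [h, Module.length_bot, nonpos_iff_eq_zero, Module.length_eq_zero_iff,
      Submodule.subsingleton_iff_eq_bot, Submodule.span_singleton_eq_bot] at h1
    exact hfm h1
  obtain ⟨N, hN, hNmax⟩ := WellFounded.has_min (wellFounded_gt (α := Submodule R M))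
    {N | A ⊓ N = ⊥} ⟨⊥, by simp⟩
  obtain ⟨e, he, a, ha, hAa⟩ := hA
  have topA : ∀ (L : Type _) [AddCommGroup L] [Module R L] (x : L) (g : R), g • x = x →
      HasTop g (Submodule.span R {x}) := by
    intro L _ _ x g hx
    refine ⟨⟨x, Submodule.mem_span_singleton_self x⟩, Subtype.ext hx, ?_⟩
    rw [eq_top_iff]
    rintro ⟨y, hy⟩ _
    obtain ⟨t, rfl⟩ := Submodule.mem_span_singleton.1 hy
    exact Submodule.mem_span_singleton.2 ⟨t, rfl⟩
  refine ⟨A, N, ⟨disjoint_iff.2 hN, ?_⟩, hA0, e, he, hAa ▸ topA M a e ha⟩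
  let A' : Submodule R (M ⧸ N) := A.map N.mkQ
  have hess : ∀ L : Submodule R (M ⧸ N), A' ⊓ L = ⊥ → L = ⊥ := by
    intro L hL
    have h1 : A ⊓ L.comap N.mkQ = ⊥ := by
      rw [eq_bot_iff]
      rintro x ⟨hxA, hxL⟩
      have hx : N.mkQ x ∈ A' ⊓ L := ⟨⟨x, hxA, rfl⟩, hxL⟩
      rw [hL, Submodule.mem_bot, Submodule.mkQ_apply, Submodule.Quotient.mk_eq_zero] at hx
      exact hN ▸ (⟨hxA, hx⟩ : x ∈ A ⊓ N)
    have h2 : N ≤ L.comap N.mkQ := by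
      intro x hx
      have : N.mkQ x = 0 := by simpa using hx
      rw [Submodule.mem_comap, this]
      exact L.zero_mem
    have h3 : N = L.comap N.mkQ := by
      by_contra hne
      exact hNmax _ h1 (lt_of_le_of_ne h2 hne)
    rw [eq_bot_iff]
    intro y hy
    obtain ⟨x, rfl⟩ := N.mkQ_surjective y
    have : x ∈ N := by rw [h3]; exact hy
    simpa using this
  rw [codisjoint_iff, eq_top_iff]
  intro x _
  refine mem_of_forall_isPrim _ _ fun g hg => ?_
  set x' : M ⧸ N := N.mkQ (g • x) with hx'
  have hgx' : g • x' = x' := by rw [hx', ← map_smul, hidem g hg]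
  suffices h : x' ∈ A' by
    obtain ⟨y, hy, hyx⟩ := h
    have h1 : g • x - y ∈ N := by
      rw [← Submodule.Quotient.mk_eq_zero, ← Submodule.mkQ_apply, map_sub, hyx, sub_self]
    have h2 : g • x = y + (g • x - y) := by abel
    rw [h2]
    exact Submodule.add_mem_sup hy h1
  by_cases hx0 : x' = 0
  · rw [hx0]; exact A'.zero_mem
  let B : Submodule R (M ⧸ N) := Submodule.span R {x'}
  have hB0 : A' ⊓ B ≠ ⊥ := fun h => by
    have := hess B h
    rw [Submodule.span_singleton_eq_bot] at this
    exact hx0 this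
  have hA'top : HasTop e A' := by
    have : A' = Submodule.span R {N.mkQ a} := by
      change A.map N.mkQ = _
      rw [hAa, Submodule.map_span, Set.image_singleton]
    rw [this]
    exact topA _ _ e (by rw [← map_smul, ha])
  have hBtop : HasTop g B := topA _ _ g hgx'
  obtain ⟨φ, hφ⟩ : ∃ φ : B →ₗ[R] A', ∀ z : B, z.1 ∈ A' → (φ z).1 = z.1 := by
    rcases hR.exists_extension hg he hBtop hA'top
      (Submodule.inclusion (inf_le_right : A' ⊓ B ≤ B))
      (Submodule.inclusion (inf_le_left : A' ⊓ B ≤ A'))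
      (fun x => ⟨fun h => Subtype.ext (congrArg Subtype.val h :),
        fun h => Subtype.ext (congrArg Subtype.val h :)⟩)
      (by
        obtain ⟨z, hz, hz0⟩ := (Submodule.ne_bot_iff _).1 hB0
        exact ⟨⟨z, hz⟩, fun h => hz0 (congrArg Subtype.val h)⟩) with ⟨G, _, hG⟩ | ⟨H, hHi, hH⟩
    · exact ⟨G, fun z hz => congrArg Subtype.val (hG ⟨z.1, hz, z.2⟩)⟩
    · have hlen : Module.length R B ≤ Module.length R A' := by
        have h1 : Module.length R B ≤ Module.length R (Submodule.span R {g • x}) := by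
          have hB : B = (Submodule.span R {g • x}).map N.mkQ := by
            rw [Submodule.map_span, Set.image_singleton]
          rw [hB]
          exact Module.length_le_of_surjective (N.mkQ.submoduleMap _)
            (LinearMap.submoduleMap_surjective _ _)
        have h2 : Module.length R A ≤ Module.length R A' :=
          Module.length_le_of_injective (N.mkQ.submoduleMap A) (by
            rw [injective_iff_map_eq_zero]
            rintro ⟨y, hy⟩ h
            have h' : N.mkQ y = 0 := congrArg Subtype.val h
            rw [Submodule.mkQ_apply, Submodule.Quotient.mk_eq_zero] at h'
            have : y ∈ A ⊓ N := ⟨hy, h'⟩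
            rw [show A ⊓ N = ⊥ from hN, Submodule.mem_bot] at this
            exact Subtype.ext this)
        exact h1.trans ((hmax _ ⟨g, hg, g • x, hidem g hg x, rfl⟩).trans h2)
      have hbij := bijective_of_injective_of_length_le H hHi hlen
      refine ⟨(LinearEquiv.ofBijective H hbij).symm.toLinearMap, fun z hz => ?_⟩
      have h1 : H ⟨z.1, hz⟩ = z := by
        have := hH ⟨z.1, hz, z.2⟩
        exact this
      have h2 : (LinearEquiv.ofBijective H hbij).symm z = ⟨z.1, hz⟩ := by
        rw [LinearEquiv.symm_apply_eq]; exact h1.symm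
      rw [LinearEquiv.coe_coe, h2]
  let xB : B := ⟨x', Submodule.mem_span_singleton_self x'⟩
  -- The difference of `x'` and its image generates a submodule meeting the essential `A'`
  -- trivially.
  have hy : Submodule.span R {x' - (φ xB).1} = ⊥ := by
    apply hess
    rw [eq_bot_iff]
    rintro w ⟨hwA, hw⟩
    obtain ⟨z, rfl⟩ := Submodule.mem_span_singleton.1 hw
    have h1 : (z • xB).1 ∈ A' := by
      have : z • x' = z • (x' - (φ xB).1) + z • (φ xB).1 := by rw [smul_sub]; abel
      change z • x' ∈ A'
      rw [this]
      exact A'.add_mem hwA (A'.smul_mem _ (φ xB).2)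
    have h2 := hφ (z • xB) h1
    rw [map_smul] at h2
    change z • (φ xB).1 = z • x' at h2
    rw [Submodule.mem_bot, smul_sub, h2, sub_self]
  rw [Submodule.span_singleton_eq_bot, sub_eq_zero] at hy
  rw [hy]
  exact (φ xB).2

theorem IsSerial.exists_decomposition {R : Type u} [Ring R] [IsArtinianRing R]
    (hR : IsSerial R) (M : Type u) [AddCommGroup M] [Module R M] [IsNoetherian R M]
    [IsArtinian R M] :
    ∃ (n : ℕ) (Y : Fin n → ModuleCat.{u} R),
      (∀ j, Nontrivial (Y j) ∧ ∃ e : R, IsPrim e ∧ HasTop e (Y j)) ∧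
        Nonempty (M ≃ₗ[R] ∀ j, Y j) := by
  suffices ∀ (l : ℕ) (M : Type u) [AddCommGroup M] [Module R M] [IsNoetherian R M]
      [IsArtinian R M], Module.length R M = l → ∃ (n : ℕ) (Y : Fin n → ModuleCat.{u} R),
      (∀ j, Nontrivial (Y j) ∧ ∃ e : R, IsPrim e ∧ HasTop e (Y j)) ∧
        Nonempty (M ≃ₗ[R] ∀ j, Y j) from
    this _ M (ENat.natCast_toNat (Module.length_ne_top (R := R) (M := M))).symm
  intro l
  induction l using Nat.strong_induction_on with
  | _ l ih =>
  intro M _ _ _ _ hl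
  rcases subsingleton_or_nontrivial M with hM | hM
  · exact ⟨0, Fin.elim0, fun j => j.elim0, ⟨0, 0, fun _ => Subsingleton.elim _ _,
      fun _ => Subsingleton.elim _ _⟩⟩
  obtain ⟨A, N, hc, hA, e, he, htop⟩ := hR.exists_isCompl M
  have hNlt : Module.length R N < Module.length R M := Submodule.length_lt fun h => by
    subst h
    exact hA (by simpa using hc.inf_eq_bot)
  obtain ⟨n, Y, hY, ⟨ε⟩⟩ := ih (Module.length R N).toNat (by
    have := ENat.natCast_toNat (Module.length_ne_top (R := R) (M := N))
    rw [← this, hl] at hNlt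
    exact_mod_cast hNlt) N (ENat.natCast_toNat (Module.length_ne_top (R := R) (M := N))).symm
  refine ⟨n + 1, Fin.cons (ModuleCat.of R A) Y, ?_, ⟨?_⟩⟩
  · refine Fin.cases ⟨Submodule.nontrivial_iff_ne_bot.2 hA, e, he, htop⟩ hY
  · exact ((Submodule.prodEquivOfIsCompl A N hc).symm ≪≫ₗ
      (LinearEquiv.prodCongr (LinearEquiv.refl R A) ε)) ≪≫ₗ
      (Fin.consLinearEquiv R
        (fun j => ((Fin.cons (ModuleCat.of R A) Y : Fin (n + 1) → ModuleCat.{u} R) j)))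

end Decomposition

end NakayamaCore

namespace NakayamaCore

/-! ### Inclusions along which maps to the ring extend -/

section

variable {Λ : Type u} [Ring Λ]
variable {N P Q A : Type*} [AddCommGroup N] [Module Λ N] [AddCommGroup P] [Module Λ P]
  [AddCommGroup Q] [Module Λ Q] [AddCommGroup A] [Module Λ A]

/-- Every homomorphism `N → Λ` extends along `i : N → P`. -/
def HasRingExtension (i : N →ₗ[Λ] P) : Prop :=
  ∀ φ : N →ₗ[Λ] Λ, ∃ ψ : P →ₗ[Λ] Λ, ∀ x, ψ (i x) = φ x

theorem HasRingExtension.exists_extension {i : N →ₗ[Λ] P} (h : HasRingExtension i)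
    [Module.Finite Λ Q] [Module.Projective Λ Q] (φ : N →ₗ[Λ] Q) :
    ∃ ψ : P →ₗ[Λ] Q, ∀ x, ψ (i x) = φ x := by
  obtain ⟨n, f, g, _, _, hfg⟩ := Module.Finite.exists_comp_eq_id_of_projective Λ Q
  choose ψ hψ using fun j => h (LinearMap.proj j ∘ₗ g ∘ₗ φ)
  refine ⟨f ∘ₗ LinearMap.pi ψ, fun x => ?_⟩
  have : LinearMap.pi ψ (i x) = g (φ x) := funext fun j => hψ j x
  rw [LinearMap.comp_apply, this]
  exact LinearMap.congr_fun hfg (φ x)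

/-- Pulled back to `P (n + 1)`, a functional on the image is a cocycle of `Hom(-, Λ)`, hence a
coboundary. -/
theorem CompleteResolution.hasRingExtension (C : CompleteResolution Λ) (n : ℤ) :
    HasRingExtension (LinearMap.range (C.d n)).subtype := by
  intro φ
  obtain ⟨ψ, hψ⟩ := (C.hom_exact n (φ ∘ₗ (C.d n).rangeRestrict)).1 (by
    ext x
    have h0 : (C.d n).rangeRestrict (C.d (n + 1) x) = 0 :=
      Subtype.ext ((C.exact n).apply_apply_eq_zero x)
    simp [h0])
  refine ⟨ψ, ?_⟩
  rintro ⟨_, y, rfl⟩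
  exact LinearMap.congr_fun hψ y

/-- If a quotient of a uniserial module contains a non-zero projective module, the quotient
is not proper. -/
theorem IsUniserial.injective_of_projective (hP : IsUniserial Λ P) [Nontrivial Q]
    [Module.Projective Λ Q] (q : P →ₗ[Λ] A) (hq : Function.Surjective q) (H : Q →ₗ[Λ] A)
    (hH : Function.Injective H) : Function.Injective q := by
  obtain ⟨σ, hσ⟩ := Module.projective_lifting_property q H hq
  exact hP.injective_of_comp_injective σ q (hσ ▸ hH)

theorem IsUniserial.projective_of_injective (hP : IsUniserial Λ P) [Module.Projective Λ P]
    [Nontrivial Q] [Module.Projective Λ Q] (q : P →ₗ[Λ] A) (hq : Function.Surjective q)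
    (H : Q →ₗ[Λ] A) (hH : Function.Injective H) : Module.Projective Λ A :=
  Module.Projective.of_equiv
    (LinearEquiv.ofBijective q ⟨hP.injective_of_projective q hq H hH, hq⟩)

/-- Divide `pim T` by the image of `ker g` and compare with `pim f`. Either the quotient maps to
`pim f` as wanted, or `pim f` embeds in the quotient. In the latter case projectivity forces `K =
⊥`, and `hmin` makes the embedding an isomorphism, which can be inverted. -/
theorem IsSerial.extends_of_minimal [IsArtinianRing Λ] (hR : IsSerial Λ) {T : Λ} (hT : IsPrim T)
    (i : N →ₗ[Λ] pim T) (hi : Function.Injective i)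
    (hmin : ∀ f : Λ, IsPrim f → ∀ g : N →ₗ[Λ] pim f, Function.Injective g →
      ∀ H : pim f →ₗ[Λ] pim T, Function.Injective H → Function.Surjective H)
    {f : Λ} (hf : IsPrim f) (g : N →ₗ[Λ] pim f) :
    ∃ ψ : pim T →ₗ[Λ] pim f, ∀ x, ψ (i x) = g x := by
  by_cases hg : g = 0
  · exact ⟨0, fun x => by simp [hg]⟩
  have := projective_pim hf.1
  have := hf.nontrivial
  let K : Submodule Λ (pim T) := (LinearMap.ker g).map i
  have hK : ∀ x, i x ∈ K ↔ g x = 0 := fun x => by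
    refine ⟨?_, fun h => ⟨x, h, rfl⟩⟩
    rintro ⟨y, hy, hxy⟩
    rwa [← hi hxy]
  obtain ⟨x₀, hx₀⟩ : ∃ x, g x ≠ 0 := by
    by_contra h
    push Not at h
    exact hg (LinearMap.ext h)
  rcases hR.exists_extension hT hf ((hasTop_pim hT.1).of_surjective K.mkQ K.mkQ_surjective)
    (hasTop_pim hf.1) (K.mkQ ∘ₗ i) g (fun x => by simp [hK])
    ⟨x₀, by simpa [hK] using hx₀⟩ with ⟨G, _, hG⟩ | ⟨H, hHi, hH⟩
  · exact ⟨G ∘ₗ K.mkQ, hG⟩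
  · obtain ⟨H', hH'⟩ := Module.projective_lifting_property K.mkQ H K.mkQ_surjective
    have hq : Function.Injective K.mkQ :=
      (hR.left T hT).injective_of_comp_injective H' _ (hH' ▸ hHi)
    have hH'i : Function.Injective H' := by
      have : Function.Injective (K.mkQ ∘ₗ H') := hH' ▸ hHi
      exact Function.Injective.of_comp (f := K.mkQ) this
    have hgi : Function.Injective g := by
      rw [injective_iff_map_eq_zero]
      intro x hx
      have : K.mkQ (i x) = 0 := by simpa [hK] using hx
      exact (injective_iff_map_eq_zero i).1 hi _ ((injective_iff_map_eq_zero _).1 hq _ this)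
    have hs := hmin f hf g hgi H' hH'i
    refine ⟨(LinearEquiv.ofBijective H' ⟨hH'i, hs⟩).symm.toLinearMap, fun x => ?_⟩
    rw [LinearEquiv.coe_coe, LinearEquiv.symm_apply_eq]
    apply hq
    change _ = (K.mkQ ∘ₗ H') (g x)
    rw [hH', hH]
    rfl

/-- Right multiplication by primitive idempotents with sum `1` breaks a functional into maps to
modules `pim f`. -/
theorem IsSerial.hasRingExtension_of_minimal [IsArtinianRing Λ] (hR : IsSerial Λ) {T : Λ}
    (hT : IsPrim T) (i : N →ₗ[Λ] pim T) (hi : Function.Injective i)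
    (hmin : ∀ f : Λ, IsPrim f → ∀ g : N →ₗ[Λ] pim f, Function.Injective g →
      ∀ H : pim f →ₗ[Λ] pim T, Function.Injective H → Function.Surjective H) :
    HasRingExtension i := by
  intro φ
  suffices ∀ a ∈ AddSubmonoid.closure {e : Λ | IsPrim e},
      ∃ ψ : pim T →ₗ[Λ] Λ, ∀ x, ψ (i x) = φ x * a by
    simpa using this 1 one_mem_closure_isPrim
  intro a ha
  induction ha using AddSubmonoid.closure_induction with
  | mem f hf =>
    obtain ⟨ψ, hψ⟩ := hR.extends_of_minimal hT i hi hmin hf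
      (LinearMap.toSpanSingleton Λ (pim f) (pimGen f) ∘ₗ φ)
    exact ⟨(pim f).subtype ∘ₗ ψ, fun x => by
      rw [LinearMap.comp_apply, hψ]; rfl⟩
  | zero => exact ⟨0, fun x => by simp⟩
  | add a b _ _ ha hb =>
    obtain ⟨ψ, hψ⟩ := ha
    obtain ⟨ψ', hψ'⟩ := hb
    exact ⟨ψ + ψ', fun x => by rw [LinearMap.add_apply, hψ, hψ', mul_add]⟩

/-- A uniserial submodule of a projective module embeds in an indecomposable one. -/
theorem IsUniserial.exists_injective_pim [IsArtinianRing Λ] [IsArtinian Λ N] [Nontrivial N]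
    (hN : IsUniserial Λ N) [Module.Projective Λ P] (j : N →ₗ[Λ] P)
    (hj : Function.Injective j) :
    ∃ f : Λ, IsPrim f ∧ ∃ g : N →ₗ[Λ] pim f, Function.Injective g := by
  obtain ⟨K, hK, hmin⟩ := hN.exists_mem_of_ne_bot
  obtain ⟨c, hc, hc0⟩ := (Submodule.ne_bot_iff K).1 (isSimpleModule_iff_isAtom.1 hK).1
  obtain ⟨s, hs⟩ := Module.projective_def'.1 (inferInstance : Module.Projective Λ P)
  have h1 : s (j c) ≠ 0 := fun h => hc0 (by
    have h2 := LinearMap.congr_fun hs (j c)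
    rw [LinearMap.comp_apply, h, map_zero, LinearMap.id_apply] at h2
    exact (injective_iff_map_eq_zero j).1 hj _ h2.symm)
  obtain ⟨p, hp⟩ := Finsupp.ne_iff.1 h1
  obtain ⟨f, hf, hne⟩ : ∃ f : Λ, IsPrim f ∧ s (j c) p * f ≠ 0 := by
    by_contra hcon
    push Not at hcon
    suffices ∀ a ∈ AddSubmonoid.closure {e : Λ | IsPrim e}, s (j c) p * a = 0 from
      hp (by simpa using this 1 one_mem_closure_isPrim)
    intro a ha
    induction ha using AddSubmonoid.closure_induction with
    | mem a ha => exact hcon a ha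
    | zero => simp
    | add a b _ _ ha hb => rw [mul_add, ha, hb, add_zero]
  refine ⟨f, hf, LinearMap.toSpanSingleton Λ (pim f) (pimGen f) ∘ₗ Finsupp.lapply p ∘ₗ s ∘ₗ j, ?_⟩
  -- A nonzero kernel would contain the smallest submodule `K`, but `p` and `f` were chosen so that
  -- the map does not vanish on `c ∈ K`.
  rw [← LinearMap.ker_eq_bot]
  by_contra hker
  exact hne (congrArg Subtype.val (hmin _ hker hc))

end

/-! ### Splicing complete resolutions -/

section Resolutions

variable {Λ : Type u} [Ring Λ]

/-- There is an exact sequence `0 → N₁ → pim e → N → 0` along which homomorphisms to `Λ`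
extend. -/
def IsCoverStep (N₁ N : ModuleCat.{u} Λ) : Prop :=
  ∃ e : Λ, IsPrim e ∧ ∃ (i : N₁ →ₗ[Λ] pim e) (p : pim e →ₗ[Λ] N), Function.Injective i ∧
    Function.Surjective p ∧ Function.Exact i p ∧ HasRingExtension i

theorem exists_int_sequence {α : Type*} (r : α → α → Prop) (h₁ : ∀ a, ∃ b, r b a)
    (h₂ : ∀ a, ∃ b, r a b) (a : α) : ∃ s : ℤ → α, s 1 = a ∧ ∀ i, r (s (i + 1)) (s i) := by
  choose f hf using h₁
  choose g hg using h₂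
  let s : ℤ → α := fun i => Int.rec (fun n => f^[n] a) (fun n => g^[n + 1] a) i
  have hs : ∀ i, r (s (i + 1)) (s i) := by
    rintro (n | n)
    · change r (f^[n + 1] a) (f^[n] a)
      rw [Function.iterate_succ_apply']
      exact hf _
    · rcases n with _ | n
      · exact hg a
      · change r (g^[n + 1] a) (g^[n + 1 + 1] a)
        rw [Function.iterate_succ_apply' g (n + 1)]
        exact hg _
  -- The shift puts `a` at index `1`, because the image of the differential `d 0` is the module with
  -- index `1`.
  refine ⟨fun i => s (i - 1), rfl, fun i => ?_⟩
  have := hs (i - 1)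
  rwa [show i - 1 + 1 = i + 1 - 1 by ring] at this

/-- Splice the short exact sequences in both directions. A functional killed by the next
differential factors through `p (n + 1)` and then extends along `ι n`, which is exactness after
`Hom(-, Λ)`. -/
theorem isGorensteinProjective_of_class (𝒲 : ModuleCat.{u} Λ → Prop)
    (h₁ : ∀ N, 𝒲 N → ∃ N₁, 𝒲 N₁ ∧ IsCoverStep N₁ N)
    (h₂ : ∀ N, 𝒲 N → ∃ N₂, 𝒲 N₂ ∧ IsCoverStep N N₂) (N : ModuleCat.{u} Λ) (hN : 𝒲 N) :
    IsGorensteinProjective Λ N := by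
  obtain ⟨s, hs1, hs⟩ := exists_int_sequence (α := {N // 𝒲 N})
    (fun a b => IsCoverStep a.1 b.1)
    (fun a => let ⟨b, hb, hab⟩ := h₁ a.1 a.2; ⟨⟨b, hb⟩, hab⟩)
    (fun a => let ⟨b, hb, hab⟩ := h₂ a.1 a.2; ⟨⟨b, hb⟩, hab⟩) ⟨N, hN⟩
  choose e he ι p hι hp hex hext using hs
  have key : ∀ n, ∀ x, (ι n ∘ₗ p (n + 1)) x = 0 ↔ p (n + 1) x = 0 := fun n x =>
    map_eq_zero_iff (ι n) (hι n)
  let C : CompleteResolution Λ :=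
    { P := fun n => ModuleCat.of Λ (pim (e n))
      finite := fun n => finite_pim _
      projective := fun n => projective_pim (he n).1
      d := fun n => ι n ∘ₗ p (n + 1)
      exact := fun n x => by
        refine ((key n x).trans (hex (n + 1) x)).trans ⟨?_, ?_⟩
        · rintro ⟨y, rfl⟩
          obtain ⟨z, rfl⟩ := hp (n + 1 + 1) y
          exact ⟨z, rfl⟩
        · rintro ⟨z, rfl⟩
          exact ⟨_, rfl⟩
      hom_exact := fun n φ => by
        constructor
        · intro hφ
          obtain ⟨g, hg⟩ := exists_factor (p (n + 1)) (hp (n + 1)) φ (fun x hx => by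
            obtain ⟨y, rfl⟩ := (hex (n + 1) x).1 hx
            obtain ⟨z, rfl⟩ := hp (n + 1 + 1) y
            exact LinearMap.congr_fun hφ z)
          obtain ⟨ψ, hψ⟩ := hext n g
          exact ⟨ψ, LinearMap.ext fun x => (hψ _).trans (hg x)⟩
        · rintro ⟨ψ, rfl⟩
          ext x
          change ψ (ι n (p (n + 1) (ι (n + 1) (p (n + 1 + 1) x)))) = 0
          rw [(hex (n + 1)).apply_apply_eq_zero, map_zero, map_zero] }
  have hr : LinearMap.range (C.d 0) = LinearMap.range (ι 0) := by
    change LinearMap.range (ι 0 ∘ₗ p (0 + 1)) = _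
    rw [LinearMap.range_comp, LinearMap.range_eq_top.2 (hp (0 + 1)), Submodule.map_top]
  have hN1 : N = (s (0 + 1)).1 := by
    rw [zero_add, hs1]
  refine ⟨C, ?_⟩
  rw [hr]
  subst hN1
  exact ⟨LinearEquiv.ofInjective (ι 0) (hι 0)⟩

end Resolutions

end NakayamaCore

namespace NakayamaCore

/-! ### Syzygies and cosyzygies of Gorenstein projective modules -/

section

variable {Λ : Type u} [Ring Λ]

/-- Non-projective local modules which are direct summands of Gorenstein projective modules. -/
structure IsStableGP (N : Type u) [AddCommGroup N] [Module Λ N] : Prop where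
  nontrivial : Nontrivial N
  top : ∃ e : Λ, IsPrim e ∧ HasTop e N
  not_projective : ¬ Module.Projective Λ N
  retract : ∃ (C : CompleteResolution Λ) (n : ℤ) (i : N →ₗ[Λ] LinearMap.range (C.d n))
    (r : LinearMap.range (C.d n) →ₗ[Λ] N), r ∘ₗ i = LinearMap.id

theorem ker_ne_bot_of_not_projective {P N : Type*} [AddCommGroup N] [Module Λ N]
    [AddCommGroup P] [Module Λ P] [Module.Projective Λ P] (hN : ¬ Module.Projective Λ N)
    (p : P →ₗ[Λ] N) (hp : Function.Surjective p) : LinearMap.ker p ≠ ⊥ := fun h =>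
  hN (Module.Projective.of_equiv (LinearEquiv.ofBijective p ⟨LinearMap.ker_eq_bot.1 h, hp⟩))

theorem ker_ne_top_of_surjective {P N : Type*} [AddCommGroup N] [Module Λ N]
    [AddCommGroup P] [Module Λ P] [Nontrivial N]
    (p : P →ₗ[Λ] N) (hp : Function.Surjective p) : LinearMap.ker p ≠ ⊤ := fun hk => by
  obtain ⟨m, hm⟩ := exists_ne (0 : N)
  obtain ⟨x, rfl⟩ := hp m
  exact hm (LinearMap.mem_ker.1 (hk ▸ Submodule.mem_top))

theorem not_projective_quotient (hR : IsSerial Λ) {N : Type*} [AddCommGroup N] [Module Λ N]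
    [Nontrivial N] {T : Λ} (hT : IsPrim T) (i : N →ₗ[Λ] pim T) (hi : Function.Injective i)
    [Nontrivial (pim T ⧸ LinearMap.range i)] :
    ¬ Module.Projective Λ (pim T ⧸ LinearMap.range i) := fun _ => by
  have h1 := (hR.left T hT).injective_of_projective _ (LinearMap.range i).mkQ_surjective
    LinearMap.id Function.injective_id
  obtain ⟨x, hx⟩ := exists_ne (0 : N)
  refine hx (hi (h1 ?_))
  simp

theorem nontrivial_quotient {N : Type*} [AddCommGroup N] [Module Λ N] {T : Λ} (hT : IsPrim T)
    (hN : ¬ Module.Projective Λ N) (i : N →ₗ[Λ] pim T) (hi : Function.Injective i) :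
    Nontrivial (pim T ⧸ LinearMap.range i) := by
  rw [Submodule.Quotient.nontrivial_iff]
  intro h
  have := projective_pim hT.1
  exact hN (Module.Projective.of_equiv
    (LinearEquiv.ofBijective i ⟨hi, LinearMap.range_eq_top.1 h⟩).symm)

variable [IsArtinianRing Λ]

/-- The retraction lifts to the projective modules by `IsProjectiveCover.exists_lifts` and restricts
to kernels, so the syzygy is a retract of the next image and inherits its extension property. -/
theorem IsStableGP.ker (hR : IsSerial Λ) {N : Type u} [AddCommGroup N] [Module Λ N]
    (h : IsStableGP (Λ := Λ) N) {e : Λ} (he : IsPrim e) (p : pim e →ₗ[Λ] N)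
    (hp : Function.Surjective p) :
    IsStableGP (Λ := Λ) (LinearMap.ker p) ∧ HasRingExtension (LinearMap.ker p).subtype := by
  have := h.nontrivial
  have := projective_pim he.1
  have := finite_pim e
  have hu := hR.left e he
  have hcov := hu.isProjectiveCover p hp
  obtain ⟨C, n, i, r, hri⟩ := h.retract
  have := C.projective (n + 1)
  obtain ⟨I, J, hJI, hI, hJ⟩ := hcov.exists_lifts (C.d n).surjective_rangeRestrict i r hri
  have hIk : ∀ x : LinearMap.ker p, I x ∈ LinearMap.range (C.d (n + 1)) := fun x => by
    have h1 := LinearMap.congr_fun hI x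
    rw [LinearMap.comp_apply, LinearMap.comp_apply, LinearMap.mem_ker.1 x.2, map_zero] at h1
    exact (C.exact n (I x)).1 (congrArg Subtype.val h1)
  have hJk : ∀ y : LinearMap.range (C.d (n + 1)), J y ∈ LinearMap.ker p := fun y => by
    have h1 := LinearMap.congr_fun hJ y
    have h2 : (C.d n).rangeRestrict y = 0 := Subtype.ext ((C.exact n y).2 y.2)
    rw [LinearMap.comp_apply, LinearMap.comp_apply, h2, map_zero] at h1
    exact h1
  have hext : HasRingExtension (LinearMap.ker p).subtype := by
    intro φ
    obtain ⟨ψ, hψ⟩ := C.hasRingExtension (n + 1)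
      (φ ∘ₗ (J.domRestrict _).codRestrict (LinearMap.ker p) hJk)
    refine ⟨ψ ∘ₗ I, fun x => ?_⟩
    have h1 := hψ ⟨I x, hIk x⟩
    refine h1.trans (congrArg φ (Subtype.ext ?_))
    exact LinearMap.congr_fun hJI x
  have hk0 := ker_ne_bot_of_not_projective h.not_projective p hp
  have hnt : Nontrivial (LinearMap.ker p) := Submodule.nontrivial_iff_ne_bot.2 hk0
  have hku : IsUniserial Λ (LinearMap.ker p) :=
    hu.of_injective _ (LinearMap.ker p).injective_subtype
  refine ⟨⟨hnt, hku.exists_hasTop, fun hproj => ?_, C, n + 1,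
    (I.domRestrict _).codRestrict _ hIk, (J.domRestrict _).codRestrict _ hJk, ?_⟩, hext⟩
  -- A projective kernel would be a retract of `pim e`, hence a proper nonzero direct summand of a
  -- uniserial module.
  · obtain ⟨ρ, hρ⟩ := hext.exists_extension (LinearMap.id : LinearMap.ker p →ₗ[Λ] _)
    have hdis : LinearMap.ker p ⊓ LinearMap.ker ρ = ⊥ := by
      rw [eq_bot_iff]
      rintro x ⟨hx, hx'⟩
      have := hρ ⟨x, hx⟩
      rw [Submodule.subtype_apply, LinearMap.mem_ker.1 hx'] at this
      exact (congrArg Subtype.val this).symm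
    rcases hu.eq_bot_or_eq_bot hdis with h1 | h1
    · exact hk0 h1
    · refine ker_ne_top_of_surjective p hp (eq_top_iff.2 fun x _ => ?_)
      have : ρ (x - (ρ x).1) = 0 := by
        rw [map_sub, sub_eq_zero]
        exact (hρ (ρ x)).symm
      have := LinearMap.ker_eq_bot.1 h1 (this.trans ρ.map_zero.symm)
      rw [sub_eq_zero] at this
      rw [this]
      exact (ρ x).2
  · ext x
    exact congrArg Subtype.val (LinearMap.congr_fun hJI x)

/-- Let `pim T` be shortest among those into which `N` embeds; minimality gives the extension
property. The maps `α` and `β` compare this embedding with the one in the resolution, and they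
exhibit the cokernel as a retract of the next image. -/
theorem IsStableGP.exists_embedding (hR : IsSerial Λ) {N : Type u} [AddCommGroup N] [Module Λ N]
    (h : IsStableGP (Λ := Λ) N) :
    ∃ T : Λ, IsPrim T ∧ ∃ i : N →ₗ[Λ] pim T, Function.Injective i ∧ HasRingExtension i ∧
      IsStableGP (Λ := Λ) (pim T ⧸ LinearMap.range i) := by
  have := h.nontrivial
  obtain ⟨e, he, htop⟩ := h.top
  have := htop.finite
  have hu := hR.isUniserial he htop
  obtain ⟨C, n, ι, ρ, hρι⟩ := h.retract
  obtain ⟨m, rfl⟩ : ∃ m, n = m + 1 := ⟨n - 1, by ring⟩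
  have := C.projective (m + 1)
  have := C.finite (m + 1)
  have hιi : Function.Injective ι := fun x y hxy => by
    have := congrArg ρ hxy
    rwa [← LinearMap.comp_apply, ← LinearMap.comp_apply, hρι] at this
  let j : N →ₗ[Λ] C.P (m + 1) := (LinearMap.range (C.d (m + 1))).subtype ∘ₗ ι
  have hj : Function.Injective j := (Submodule.injective_subtype _).comp hιi
  obtain ⟨T, ⟨hT, i, hi⟩, hTmin⟩ := WellFounded.has_min
    (measure fun f : Λ => (Module.length Λ (pim f)).toNat).wf
    {f | IsPrim f ∧ ∃ g : N →ₗ[Λ] pim f, Function.Injective g} (hu.exists_injective_pim j hj)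
  have := finite_pim T
  have := projective_pim hT.1
  have hTu := hR.left T hT
  have hext : HasRingExtension i := hR.hasRingExtension_of_minimal hT i hi
    fun f hf g hg H hH => by
      have := finite_pim f
      have h1 : ¬ (Module.length Λ (pim f)).toNat < (Module.length Λ (pim T)).toNat :=
        hTmin f ⟨hf, g, hg⟩
      refine (bijective_of_injective_of_length_le H hH ?_).2
      rw [← ENat.natCast_toNat (Module.length_ne_top (R := Λ) (M := pim f)),
        ← ENat.natCast_toNat (Module.length_ne_top (R := Λ) (M := pim T))]
      exact_mod_cast not_lt.1 h1
  obtain ⟨α, hα⟩ := hext.exists_extension j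
  obtain ⟨β, hβ⟩ := (C.hasRingExtension (m + 1)).exists_extension (i ∘ₗ ρ)
  have hδ : ∀ x, (β ∘ₗ α) (i x) = i x := fun x => by
    rw [LinearMap.comp_apply, hα]
    refine (hβ (ι x)).trans ?_
    exact congrArg i (LinearMap.congr_fun hρι x)
  -- `β ∘ₗ α` fixes the nonzero submodule `N` of a uniserial module, so it is injective and hence
  -- invertible; its inverse `γ` corrects `β`.
  have hδb : Function.Bijective (β ∘ₗ α) := injective_endo_bijective _
    (hTu.injective_of_comp_injective i _ fun x y hxy => by
      rw [LinearMap.comp_apply, LinearMap.comp_apply _ i, hδ, hδ] at hxy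
      exact hi hxy)
  let γ := (LinearEquiv.ofBijective _ hδb).symm
  have hγ : ∀ x, γ (i x) = i x := fun x => by
    rw [LinearEquiv.symm_apply_eq]; exact (hδ x).symm
  have hnt := nontrivial_quotient hT h.not_projective i hi
  refine ⟨T, hT, i, hi, hext, hnt, ⟨T, hT, (hasTop_pim hT.1).of_surjective _
    (Submodule.mkQ_surjective _)⟩, not_projective_quotient hR hT i hi, C, m, ?_⟩
  obtain ⟨r, hr⟩ := exists_factor _ (C.d m).surjective_rangeRestrict
    ((LinearMap.range i).mkQ ∘ₗ γ.toLinearMap ∘ₗ β) (fun x hx => by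
      have hx' : x ∈ LinearMap.range (C.d (m + 1)) :=
        (C.exact m x).1 (congrArg Subtype.val hx)
      have h1 : β x = i (ρ ⟨x, hx'⟩) := hβ ⟨x, hx'⟩
      rw [LinearMap.comp_apply, LinearMap.comp_apply, h1, LinearEquiv.coe_coe, hγ]
      simp)
  refine ⟨(LinearMap.range i).liftQ ((C.d m).rangeRestrict ∘ₗ α) ?_, r, ?_⟩
  · rintro _ ⟨x, rfl⟩
    rw [LinearMap.mem_ker, LinearMap.comp_apply, hα]
    exact Subtype.ext ((C.exact m _).2 (ι x).2)
  · apply Submodule.linearMap_qext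
    ext x : 1
    change r ((C.d m).rangeRestrict (α x)) = _
    rw [hr]
    change (LinearMap.range i).mkQ (γ ((β ∘ₗ α) x)) = _
    have : γ ((β ∘ₗ α) x) = x := (LinearEquiv.ofBijective _ hδb).symm_apply_apply x
    rw [this]
    rfl

/-- A mere retract of an image becomes an image itself, because syzygies and cosyzygies stay in the
class and can be spliced. -/
theorem IsStableGP.isGorensteinProjective (hR : IsSerial Λ) {N : Type u} [AddCommGroup N]
    [Module Λ N] (h : IsStableGP (Λ := Λ) N) : IsGorensteinProjective Λ N := by
  refine isGorensteinProjective_of_class (fun N => IsStableGP (Λ := Λ) N) (fun N hN => ?_)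
    (fun N hN => ?_) (ModuleCat.of Λ N) h
  · obtain ⟨e, he, ht⟩ := hN.top
    obtain ⟨p, hp⟩ := ht.exists_surjective
    obtain ⟨h1, h2⟩ := hN.ker hR he p hp
    exact ⟨ModuleCat.of Λ (LinearMap.ker p), h1, e, he, (LinearMap.ker p).subtype, p,
      Submodule.injective_subtype _, hp, LinearMap.exact_subtype_ker_map p, h2⟩
  · obtain ⟨T, hT, i, hi, hext, h1⟩ := hN.exists_embedding hR
    exact ⟨ModuleCat.of Λ (pim T ⧸ LinearMap.range i), h1, T, hT, i, (LinearMap.range i).mkQ,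
      hi, Submodule.mkQ_surjective _, LinearMap.exact_map_mkQ_range i, hext⟩

theorem IsStableGP.isIndecNonprojGP (hR : IsSerial Λ) {N : ModuleCat.{u} Λ}
    (h : IsStableGP (Λ := Λ) N) : IsIndecNonprojGP Λ N := by
  obtain ⟨e, he, ht⟩ := h.top
  have := ht.finite
  have := h.nontrivial
  exact ⟨isFiniteLength_iff_isNoetherian_isArtinian.2 ⟨inferInstance, inferInstance⟩,
    (hR.isUniserial he ht).isIndecomposable, h.not_projective, h.isGorensteinProjective hR⟩

theorem IsIndecNonprojGP.isStableGP (hR : IsSerial Λ) {N : ModuleCat.{u} Λ}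
    (h : IsIndecNonprojGP Λ N) : IsStableGP (Λ := Λ) N := by
  obtain ⟨hf, hi, hp, C, ⟨ε⟩⟩ := h
  obtain ⟨_, _⟩ := isFiniteLength_iff_isNoetherian_isArtinian.1 hf
  have := hi.1
  obtain ⟨A, B, hAB, hA, e, he, ht⟩ := hR.exists_isCompl N
  have hB := (hi.2 A B hAB).resolve_left hA
  have hA' : A = ⊤ := by
    have := hAB.sup_eq_top
    rwa [hB, sup_bot_eq] at this
  exact ⟨hi.1, ⟨e, he, ht.of_surjective A.subtype fun x => ⟨⟨x, hA' ▸ Submodule.mem_top⟩, rfl⟩⟩,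
    hp, C, 0, ε.toLinearMap, ε.symm.toLinearMap, by ext; simp⟩

/-- The primitive idempotents `e` such that `pim e` is the projective cover of an
indecomposable non-projective Gorenstein projective module. -/
def IsCoreIdem (e : Λ) : Prop :=
  IsPrim e ∧ ∃ N : ModuleCat.{u} Λ, IsStableGP (Λ := Λ) N ∧ HasTop e N

/-- Compare the image of `H` with the syzygy `ker p` of a Gorenstein projective quotient. If it lies
inside, the local syzygy contains a nonzero projective and is itself projective, which is excluded.
Otherwise the syzygy lies in the image, and extending this inclusion to `pim e` gives an
endomorphism `H ∘ ψ` fixing the syzygy, hence invertible. -/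
theorem IsCoreIdem.surjective_of_injective (hR : IsSerial Λ) {e f : Λ} (he : IsCoreIdem e)
    (hf : IsPrim f) (H : pim f →ₗ[Λ] pim e) (hH : Function.Injective H) :
    Function.Surjective H := by
  obtain ⟨he, N, hN, ht⟩ := he
  obtain ⟨p, hp⟩ := ht.exists_surjective
  obtain ⟨hK, hext⟩ := hN.ker hR he p hp
  have := hf.nontrivial
  have := projective_pim hf.1
  have := finite_pim f
  have := finite_pim e
  have := hK.nontrivial
  rcases hR.left e he (LinearMap.range H) (LinearMap.ker p) with hle | hle
  · obtain ⟨g, hg, ht⟩ := hK.top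
    obtain ⟨q, hq⟩ := ht.exists_surjective
    have := projective_pim hg.1
    refine absurd ((hR.left g hg).projective_of_injective q hq
      (H.codRestrict (LinearMap.ker p) fun x => hle ⟨x, rfl⟩) fun x y hxy => ?_) hK.not_projective
    exact hH (congrArg Subtype.val hxy)
  · let ε := LinearEquiv.ofInjective H hH
    obtain ⟨ψ, hψ⟩ := hext.exists_extension (ε.symm.toLinearMap ∘ₗ Submodule.inclusion hle)
    have h1 : ∀ x : LinearMap.ker p, (H ∘ₗ ψ) x = x := fun x => by
      have h2 := congrArg ε (hψ x)
      rw [LinearMap.comp_apply, LinearEquiv.coe_coe, LinearEquiv.apply_symm_apply] at h2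
      exact congrArg Subtype.val h2
    have h2 : Function.Injective (H ∘ₗ ψ) :=
      (hR.left e he).injective_of_comp_injective (LinearMap.ker p).subtype _ fun x y hxy => by
        have hxy' : (H ∘ₗ ψ) x = (H ∘ₗ ψ) y := hxy
        rw [h1, h1] at hxy'
        exact Subtype.ext hxy'
    exact Function.Surjective.of_comp (g := ψ) (injective_endo_bijective _ h2).2

theorem IsCoreIdem.hasRingExtension (hR : IsSerial Λ) {e : Λ} (he : IsCoreIdem e) {N : Type*}
    [AddCommGroup N] [Module Λ N] (i : N →ₗ[Λ] pim e) (hi : Function.Injective i) :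
    HasRingExtension i :=
  hR.hasRingExtension_of_minimal he.1 i hi fun _ hf _ _ H hH =>
    he.surjective_of_injective hR hf H hH

end

/-! ### Socles, syzygies and radicals of projective covers -/

section Tau

variable {R : Type*} [Ring R]
variable {A K K' P : Type*} [AddCommGroup A] [Module R A] [AddCommGroup K] [Module R K]
  [AddCommGroup K'] [Module R K'] [AddCommGroup P] [Module R P]

theorem IsUniserial.apply_mem_of_isSimpleModule (hP : IsUniserial R P) [IsSimpleModule R K]
    (j : K →ₗ[R] P) {V : Submodule R P} (hV : V ≠ ⊥) (x : K) :
    j x ∈ V := by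
  rcases eq_bot_or_eq_top (V.comap j) with h | h
  · have hd : LinearMap.range j ⊓ V = ⊥ := by
      rw [eq_bot_iff]
      rintro _ ⟨⟨y, rfl⟩, hy⟩
      have : y ∈ V.comap j := hy
      rw [h, Submodule.mem_bot] at this
      simp [this]
    rcases hP.eq_bot_or_eq_bot hd with h | h
    · rw [LinearMap.range_eq_bot] at h
      simp [h]
    · exact absurd h hV
  · have : x ∈ V.comap j := h ▸ Submodule.mem_top
    exact this

/-- If the simple module `K` embeds in a quotient `A` of a uniserial module `P`, the radical
of the projective cover of `K` maps onto the kernel of `P → A`. -/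
theorem exists_surjective_ker (hP : IsUniserial R P) {l : R} (hl : IsIdempotentElem l)
    (q : P →ₗ[R] A) (hq : Function.Surjective q) {c : K} (hc : c ≠ 0) (hlc : l • c = c)
    (u : K →ₗ[R] A) (hu : Function.Injective u) :
    ∃ s : LinearMap.ker (pimHom l c) →ₗ[R] LinearMap.ker q, Function.Surjective s := by
  obtain ⟨x', hx'⟩ := hq (u c)
  let x := l • x'
  have hx : q x = u c := by rw [map_smul, hx', ← map_smul, hlc]
  have hlx : l • x = x := by rw [← mul_smul, hl]
  have key : ∀ y : pim l, q (pimHom l x y) = u (pimHom l c y) := fun y => by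
    rw [pimHom_apply, pimHom_apply, map_smul q y.1 x, map_smul u y.1 c, hx]
  refine ⟨((pimHom l x).domRestrict _).codRestrict _ fun y => ?_, ?_⟩
  · rw [LinearMap.mem_ker, LinearMap.domRestrict_apply, key, LinearMap.mem_ker.1 y.2, map_zero]
  · rintro ⟨w, hw⟩
    -- A kernel element is a multiple `t • x`, and then `t` kills `c`. The other comparison would
    -- put `x` in the kernel, against `c ≠ 0`.
    rcases hP (Submodule.span R {w}) (Submodule.span R {x}) with h | h
    · obtain ⟨t, ht⟩ := Submodule.mem_span_singleton.1
        (h (Submodule.mem_span_singleton_self w))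
      have h1 : pimHom l x (t • pimGen l) = w := by
        rw [map_smul, pimHom_apply]
        change t • l • x = w
        rw [hlx, ht]
      refine ⟨⟨t • pimGen l, ?_⟩, Subtype.ext h1⟩
      rw [LinearMap.mem_ker]
      apply (injective_iff_map_eq_zero u).1 hu
      rw [← key, h1, LinearMap.mem_ker.1 hw]
    · obtain ⟨t, ht⟩ := Submodule.mem_span_singleton.1
        (h (Submodule.mem_span_singleton_self x))
      refine absurd ((injective_iff_map_eq_zero u).1 hu _ ?_) hc
      rw [← hx, ← ht, map_smul, LinearMap.mem_ker.1 hw, smul_zero]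

theorem span_eq_top_of_ne_zero [IsSimpleModule R K] {c : K} (hc : c ≠ 0) :
    Submodule.span R {c} = ⊤ :=
  (eq_bot_or_eq_top _).resolve_left (by rwa [Submodule.span_singleton_eq_bot])

theorem hasTop_of_ne_zero [IsSimpleModule R K] {e : R} {c : K} (hc : c ≠ 0) (hec : e • c = c) :
    HasTop e K := ⟨c, hec, span_eq_top_of_ne_zero hc⟩

theorem HasTop.exists_ne_zero {e : R} [Nontrivial K] (h : HasTop e K) :
    ∃ c : K, c ≠ 0 ∧ e • c = c := by
  obtain ⟨c, hc, hs⟩ := h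
  refine ⟨c, fun h0 => ?_, hc⟩
  rw [h0, Submodule.span_zero_singleton] at hs
  exact bot_ne_top hs

theorem nonempty_linearEquiv_of_ker_le [IsSimpleModule R K] [IsSimpleModule R K']
    (p : P →ₗ[R] K) (hp : Function.Surjective p) (p' : P →ₗ[R] K') (hp' : Function.Surjective p')
    (hle : LinearMap.ker p ≤ LinearMap.ker p') : Nonempty (K ≃ₗ[R] K') := by
  obtain ⟨g, hg⟩ := exists_factor p hp p' fun x hx => hle hx
  refine ⟨LinearEquiv.ofBijective g (LinearMap.bijective_of_ne_zero fun h0 => ?_)⟩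
  have := IsSimpleModule.nontrivial R K'
  obtain ⟨m, hm⟩ := exists_ne (0 : K')
  obtain ⟨x, rfl⟩ := hp' m
  rw [← hg, h0] at hm
  exact hm rfl

theorem IsUniserial.nonempty_linearEquiv (hP : IsUniserial R P) [IsSimpleModule R K]
    [IsSimpleModule R K'] (p : P →ₗ[R] K) (hp : Function.Surjective p) (p' : P →ₗ[R] K')
    (hp' : Function.Surjective p') : Nonempty (K ≃ₗ[R] K') := by
  rcases hP (LinearMap.ker p) (LinearMap.ker p') with h | h
  · exact nonempty_linearEquiv_of_ker_le p hp p' hp' h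
  · exact (nonempty_linearEquiv_of_ker_le p' hp' p hp h).map LinearEquiv.symm

theorem IsSerial.nonempty_linearEquiv_of_hasTop (hR : IsSerial R) [IsSimpleModule R K]
    [IsSimpleModule R K'] {e : R} (he : IsPrim e) (h : HasTop e K) (h' : HasTop e K') :
    Nonempty (K ≃ₗ[R] K') :=
  let ⟨p, hp⟩ := h.exists_surjective
  let ⟨p', hp'⟩ := h'.exists_surjective
  (hR.left e he).nonempty_linearEquiv p hp p' hp'

/-- If `t` killed `c`, then `t = y * z`, and right multiplication by `t` would send both `pimGen l'`
and `y • z'` to `t`. So `pim l'` would be the sum of `ker (pimHom l' c')` and the kernel of that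
map; by uniseriality one of them is everything, which is absurd. -/
theorem smul_ne_zero_of_radical_eq_mul (hR : IsSerial R) {l l' t : R} (hl' : IsPrim l') {c : K}
    {c' : K'} (hc' : c' ≠ 0) (hlc' : l' • c' = c') {z : LinearMap.ker (pimHom l c)}
    (hz : Submodule.span R {z} = ⊤) (hz0 : z ≠ 0) {z' : LinearMap.ker (pimHom l' c')}
    (ht : l' * t = t) (htl : t ∈ pim l) (hzt : z.1.1 = z'.1.1 * t) : t • c ≠ 0 := by
  intro h0
  let t' : pim l := ⟨t, htl⟩
  have htk : t' ∈ LinearMap.ker (pimHom l c) := by rw [LinearMap.mem_ker, pimHom_apply]; exact h0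
  obtain ⟨y, hy⟩ := Submodule.mem_span_singleton.1
    (hz ▸ Submodule.mem_top : (⟨t', htk⟩ : LinearMap.ker (pimHom l c)) ∈ Submodule.span R {z})
  have hyz : y * z.1.1 = t := congrArg (fun w => w.1.1) hy
  let H : pim l' →ₗ[R] pim l := pimHom l' t'
  have hHz : H z'.1 = z.1 := Subtype.ext hzt.symm
  have hsup : LinearMap.ker (pimHom l' c') ⊔ LinearMap.ker H = ⊤ := by
    rw [eq_top_iff, ← span_pimGen hl'.1, Submodule.span_singleton_le_iff_mem]
    have : pimGen l' = y • z'.1 + (pimGen l' - y • z'.1) := by abel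
    rw [this]
    refine Submodule.add_mem_sup (Submodule.smul_mem _ _ z'.2) ?_
    rw [LinearMap.mem_ker, map_sub, map_smul, hHz, sub_eq_zero]
    apply Subtype.ext
    change l' * t = y * z.1.1
    rw [ht, hyz]
  rcases (hR.left l' hl').eq_top_or_eq_top hsup with h | h
  · have : pimGen l' ∈ LinearMap.ker (pimHom l' c') := h ▸ Submodule.mem_top
    rw [LinearMap.mem_ker, pimHom_apply] at this
    exact hc' (hlc'.symm.trans this)
  · rw [LinearMap.ker_eq_top] at h
    apply hz0
    apply Subtype.ext
    rw [← hHz, h]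
    rfl

/-- Simple modules are isomorphic if the radicals of their projective covers have the same
top. -/
theorem IsSerial.nonempty_linearEquiv_of_radical (hR : IsSerial R) [IsSimpleModule R K]
    [IsSimpleModule R K'] {g l l' : R} (hg : IsPrim g) (hl : IsPrim l) (hl' : IsPrim l')
    {c : K} {c' : K'} (hc : c ≠ 0) (hlc : l • c = c) (hc' : c' ≠ 0) (hlc' : l' • c' = c')
    [Nontrivial (LinearMap.ker (pimHom l c))] [Nontrivial (LinearMap.ker (pimHom l' c'))]
    (h : HasTop g (LinearMap.ker (pimHom l c))) (h' : HasTop g (LinearMap.ker (pimHom l' c'))) :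
    Nonempty (K ≃ₗ[R] K') := by
  obtain ⟨z, hz, hzs⟩ := h
  obtain ⟨z', hz', hzs'⟩ := h'
  have hz0 : z ≠ 0 := fun h0 => by
    rw [h0, Submodule.span_zero_singleton] at hzs; exact bot_ne_top hzs
  have hz0' : z' ≠ 0 := fun h0 => by
    rw [h0, Submodule.span_zero_singleton] at hzs'; exact bot_ne_top hzs'
  have hgz : g * z.1.1 = z.1.1 := congrArg (fun w => w.1.1) hz
  have hgz' : g * z'.1.1 = z'.1.1 := congrArg (fun w => w.1.1) hz'
  have hzl : z.1.1 * l = z.1.1 := (mem_pim hl.1).1 z.1.2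
  have hzl' : z'.1.1 * l' = z'.1.1 := (mem_pim hl'.1).1 z'.1.2
  -- The two radical generators are comparable in `gR`. The factor between them acts non-trivially
  -- on one of the simple modules, which therefore has the idempotent of the other.
  rcases hR.right g hg _ _ hgz hgz' with ⟨t, ht⟩ | ⟨t, ht⟩
  · have h1 := smul_ne_zero_of_radical_eq_mul hR (t := l' * t * l) hl' hc' hlc' hzs hz0 (z' := z')
      (by simp only [← mul_assoc, hl'.1.eq]) ((mem_pim hl.1).2 (by rw [mul_assoc, hl.1]))
      (by rw [← mul_assoc, ← mul_assoc, hzl', ← ht, hzl])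
    exact hR.nonempty_linearEquiv_of_hasTop hl'
      (hasTop_of_ne_zero h1 (by simp only [← mul_smul, ← mul_assoc, hl'.1.eq]))
      (hasTop_of_ne_zero hc' hlc')
  · have h1 := smul_ne_zero_of_radical_eq_mul hR (t := l * t * l') hl hc hlc hzs' hz0' (z' := z)
      (by simp only [← mul_assoc, hl.1.eq]) ((mem_pim hl'.1).2 (by rw [mul_assoc, hl'.1]))
      (by rw [← mul_assoc, ← mul_assoc, hzl, ← ht, hzl'])
    exact hR.nonempty_linearEquiv_of_hasTop hl (hasTop_of_ne_zero hc hlc)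
      (hasTop_of_ne_zero h1 (by simp only [← mul_smul, ← mul_assoc, hl.1.eq]))

end Tau

end NakayamaCore

namespace NakayamaCore

/-! ### Local modules with core top and core syzygy -/

section

variable {Λ : Type u} [Ring Λ] [IsArtinianRing Λ]

theorem exists_isPrim_generator (K : Type*) [AddCommGroup K] [Module Λ K] [IsSimpleModule Λ K] :
    ∃ l : Λ, IsPrim l ∧ ∃ c : K, c ≠ 0 ∧ l • c = c := by
  have := IsSimpleModule.nontrivial Λ K
  obtain ⟨x, hx⟩ := exists_ne (0 : K)
  obtain ⟨l, hl, hlx⟩ := exists_isPrim_smul_ne_zero (R := Λ) hx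
  exact ⟨l, hl, l • x, hlx, by rw [← mul_smul, hl.1]⟩

theorem IsUniserial.exists_socle {A : Type*} [AddCommGroup A] [Module Λ A] [IsArtinian Λ A]
    [Nontrivial A] (h : IsUniserial Λ A) : ∃ K : Submodule Λ A, IsSimpleModule Λ K ∧
      ∃ l : Λ, IsPrim l ∧ ∃ c : K, c ≠ 0 ∧ l • c = c := by
  obtain ⟨K, hK, _⟩ := h.exists_mem_of_ne_bot
  exact ⟨K, hK, exists_isPrim_generator K⟩

theorem IsSerial.isUniserial_submodule {R : Type*} [Ring R] (hR : IsSerial R) {e : R}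
    (he : IsPrim e) (V : Submodule R (pim e)) : IsUniserial R V :=
  (hR.left e he).of_injective V.subtype V.injective_subtype

/-- The simple `K` lies in the first syzygy of a Gorenstein projective quotient of `pim e`. So the
radical of its cover maps onto the second syzygy, whose top is core. -/
theorem IsCoreIdem.exists_hasTop_ker (hR : IsSerial Λ) {e : Λ} (he : IsCoreIdem e) {K : Type*}
    [AddCommGroup K] [Module Λ K] [IsSimpleModule Λ K] {l : Λ} (hl : IsPrim l) {c : K}
    (hc : c ≠ 0) (hlc : l • c = c) (j : K →ₗ[Λ] pim e) (hj : Function.Injective j) :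
    ∃ h : Λ, IsCoreIdem h ∧ HasTop h (LinearMap.ker (pimHom l c)) := by
  obtain ⟨he, N, hN, ht⟩ := he
  obtain ⟨p, hp⟩ := ht.exists_surjective
  have hV := (hN.ker hR he p hp).1
  obtain ⟨g, hg, htg⟩ := hV.top
  obtain ⟨q, hq⟩ := htg.exists_surjective
  have hW := (hV.ker hR hg q hq).1
  obtain ⟨h, hh, hth⟩ := hW.top
  have hmem := (hR.left e he).apply_mem_of_isSimpleModule j
    (Submodule.nontrivial_iff_ne_bot.1 hV.nontrivial)
  obtain ⟨s, hs⟩ := exists_surjective_ker (hR.left g hg) hl.1 q hq hc hlc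
    (j.codRestrict _ hmem) (fun x y hxy => hj (congrArg Subtype.val hxy))
  have := hW.nontrivial
  exact ⟨h, ⟨hh, ModuleCat.of Λ (LinearMap.ker q), hW, hth⟩,
    HasTop.lift hh.1 (hR.isUniserial_submodule hl _) s hs hth⟩

/-- Local non-projective modules for which the tops of the module and of its syzygy belong to
projective modules in the Gorenstein core. -/
structure IsCoreQuot (M : Type u) [AddCommGroup M] [Module Λ M] : Prop where
  nontrivial : Nontrivial M
  not_projective : ¬ Module.Projective Λ M
  cover : ∃ e : Λ, IsCoreIdem e ∧ ∃ p : pim e →ₗ[Λ] M, Function.Surjective p ∧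
    ∃ g : Λ, IsCoreIdem g ∧ HasTop g (LinearMap.ker p)

/-- The syzygy shares its socle with `pim e`, and this socle fixes the top of the second syzygy,
which is core by `IsCoreIdem.exists_hasTop_ker`. The syzygy is not projective, since no
indecomposable projective embeds properly in `pim e`. -/
theorem IsCoreQuot.exists_left (hR : IsSerial Λ) {M : ModuleCat.{u} Λ}
    (hM : IsCoreQuot (Λ := Λ) M) :
    ∃ N : ModuleCat.{u} Λ, IsCoreQuot (Λ := Λ) N ∧ IsCoverStep N M := by
  obtain ⟨hnt, hproj, e, he, p, hp, g, hg, htop⟩ := hM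
  refine ⟨ModuleCat.of Λ (LinearMap.ker p), ⟨?_, fun hU => ?_, g, hg, ?_⟩, e, he.1,
    (LinearMap.ker p).subtype, p, Submodule.injective_subtype _, hp,
    LinearMap.exact_subtype_ker_map p, he.hasRingExtension hR _ (Submodule.injective_subtype _)⟩
  · have := projective_pim he.1.1
    exact Submodule.nontrivial_iff_ne_bot.2 (ker_ne_bot_of_not_projective hproj p hp)
  · have := projective_pim he.1.1
    have : Nontrivial (LinearMap.ker p) :=
      Submodule.nontrivial_iff_ne_bot.2 (ker_ne_bot_of_not_projective hproj p hp)
    have hU' : Module.Projective Λ (LinearMap.ker p) := hU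
    obtain ⟨q, hq⟩ := htop.exists_surjective
    have hqi := (hR.left g hg.1).injective_of_projective q hq LinearMap.id
      Function.injective_id
    have hs := he.surjective_of_injective hR hg.1 ((LinearMap.ker p).subtype ∘ₗ q)
      ((Submodule.injective_subtype _).comp hqi)
    refine ker_ne_top_of_surjective p hp (eq_top_iff.2 fun x _ => ?_)
    obtain ⟨y, rfl⟩ := hs x
    exact (q y).2
  · have := projective_pim he.1.1
    have : Nontrivial (LinearMap.ker p) :=
      Submodule.nontrivial_iff_ne_bot.2 (ker_ne_bot_of_not_projective hproj p hp)
    obtain ⟨q, hq⟩ := htop.exists_surjective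
    refine ⟨q, hq, ?_⟩
    have := htop.finite
    obtain ⟨K, hK, l, hl, c, hc, hlc⟩ := (hR.isUniserial_submodule he.1
      (LinearMap.ker p)).exists_socle
    let J : K →ₗ[Λ] pim e := (LinearMap.ker p).subtype ∘ₗ K.subtype
    have hJ : Function.Injective J := fun x y h => Subtype.ext (Subtype.ext h)
    obtain ⟨h, hh, hth⟩ := IsCoreIdem.exists_hasTop_ker (K := K) hR he hl hc hlc J hJ
    obtain ⟨s, hs⟩ := exists_surjective_ker (K := K) (hR.left g hg.1) hl.1 q hq hc hlc K.subtype
      (Submodule.injective_subtype _)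
    exact ⟨h, hh, hth.of_surjective s hs⟩

/-- Choose a Gorenstein projective `N'` with the same top as the syzygy of `M`; let `Q` be its
cosyzygy and embed `Q` in `pim T`. The syzygies of `M` and `Q` have the same top, so the socles
agree and soc M embeds in `pim T`. This extends to an embedding of `M`; the alternative, `pim T`
inside `M`, would make `M` projective. -/
theorem IsCoreQuot.exists_right (hR : IsSerial Λ) {M : ModuleCat.{u} Λ}
    (hM : IsCoreQuot (Λ := Λ) M) :
    ∃ N : ModuleCat.{u} Λ, IsCoreQuot (Λ := Λ) N ∧ IsCoverStep M N := by
  obtain ⟨hnt, hproj, e, he, p, hp, g, hg, htop⟩ := hM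
  have := projective_pim he.1.1
  have hMtop : HasTop e M := (hasTop_pim he.1.1).of_surjective p hp
  have hMu := hR.isUniserial he.1 hMtop
  have := hMtop.finite
  have hkp : Nontrivial (LinearMap.ker p) :=
    Submodule.nontrivial_iff_ne_bot.2 (ker_ne_bot_of_not_projective hproj p hp)
  obtain ⟨_, N', hN', htN'⟩ := hg
  obtain ⟨e₁, he₁, i, hi, _, hQ⟩ := hN'.exists_embedding hR
  obtain ⟨T, hT, j, hj, _, hQ'⟩ := hQ.exists_embedding hR
  have hTc : IsCoreIdem T := ⟨hT, ModuleCat.of Λ _, hQ', (hasTop_pim hT.1).of_surjective _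
    (Submodule.mkQ_surjective _)⟩
  have := hQ.nontrivial
  have := hN'.nontrivial
  obtain ⟨K, hK, l, hl, c, hc, hlc⟩ := hMu.exists_socle
  obtain ⟨K', hK', l', hl', c', hc', hlc'⟩ := (hR.isUniserial he₁
    ((hasTop_pim he₁.1).of_surjective _ (LinearMap.range i).mkQ_surjective)).exists_socle
  obtain ⟨s, hs⟩ := exists_surjective_ker (hR.left e he.1) hl.1 p hp hc hlc K.subtype
    (Submodule.injective_subtype _)
  obtain ⟨s', hs'⟩ := exists_surjective_ker (hR.left e₁ he₁) hl'.1 (LinearMap.range i).mkQ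
    (Submodule.mkQ_surjective _) hc' hlc' K'.subtype (Submodule.injective_subtype _)
  have htop' : HasTop g (LinearMap.ker (LinearMap.range i).mkQ) := by
    rw [Submodule.ker_mkQ]
    exact htN'.of_surjective i.rangeRestrict i.surjective_rangeRestrict
  have : Nontrivial (LinearMap.ker (LinearMap.range i).mkQ) := by
    rw [Submodule.ker_mkQ]
    exact (LinearEquiv.ofInjective i hi).toEquiv.symm.nontrivial
  have hgp : IsPrim g := ‹IsPrim g›
  have hL := HasTop.lift hgp.1 (hR.isUniserial_submodule hl _) s hs htop
  have hL' := HasTop.lift hgp.1 (hR.isUniserial_submodule hl' _) s' hs' htop'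
  have := hs.nontrivial
  have := hs'.nontrivial
  obtain ⟨κ⟩ := hR.nonempty_linearEquiv_of_radical hgp hl hl' hc hlc hc' hlc' hL hL'
  have hv : Function.Injective (j ∘ₗ K'.subtype ∘ₗ κ.toLinearMap) :=
    hj.comp (K'.injective_subtype.comp κ.injective)
  have := projective_pim hT.1
  have := hT.nontrivial
  rcases hR.exists_extension he.1 hT hMtop (hasTop_pim hT.1) K.subtype
    (j ∘ₗ K'.subtype ∘ₗ κ.toLinearMap)
    (fun x => by rw [map_eq_zero_iff _ hv, map_eq_zero_iff _ K.injective_subtype])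
    ⟨c, fun h => hc (Subtype.ext h)⟩ with ⟨G, hG, _⟩ | ⟨H, hH, _⟩
  · have := nontrivial_quotient hT hproj G hG
    refine ⟨ModuleCat.of Λ (pim T ⧸ LinearMap.range G), ⟨this, not_projective_quotient hR hT G hG,
      T, hTc, (LinearMap.range G).mkQ, Submodule.mkQ_surjective _, e, he, ?_⟩, T, hT, G,
      (LinearMap.range G).mkQ, hG, Submodule.mkQ_surjective _, LinearMap.exact_map_mkQ_range G,
      hTc.hasRingExtension hR G hG⟩
    rw [Submodule.ker_mkQ]
    exact hMtop.of_surjective G.rangeRestrict G.surjective_rangeRestrict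
  · exact absurd ((hR.left e he.1).projective_of_injective p hp H hH) hproj

theorem IsCoreQuot.isIndecNonprojGP (hR : IsSerial Λ) {M : ModuleCat.{u} Λ}
    (hM : IsCoreQuot (Λ := Λ) M) : IsIndecNonprojGP Λ M := by
  have hgp := isGorensteinProjective_of_class (fun N => IsCoreQuot (Λ := Λ) N)
    (fun N hN => hN.exists_left hR) (fun N hN => hN.exists_right hR) M hM
  obtain ⟨hnt, hproj, e, he, p, hp, _⟩ := hM
  have ht : HasTop e M := (hasTop_pim he.1.1).of_surjective p hp
  have := ht.finite
  exact ⟨isFiniteLength_iff_isNoetherian_isArtinian.2 ⟨inferInstance, inferInstance⟩,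
    (hR.isUniserial he.1 ht).isIndecomposable, hproj, hgp⟩

end

/-! ### Transposes of simple right modules -/

section Transpose

open MulOpposite

variable {Λ : Type u} [Ring Λ]

theorem isPrim_unop {e : Λᵐᵒᵖ} (he : IsPrim e) : IsPrim e.unop := by
  obtain ⟨h1, h2, h3⟩ := he
  refine ⟨congrArg unop h1, fun h => h2 (unop_injective h), fun f hf h4 h5 => ?_⟩
  exact (h3 (op f) (congrArg op hf) (congrArg op h5) (congrArg op h4)).imp
    (fun h => congrArg unop h) (fun h => congrArg unop h)

/-- The cokernel of the transpose of a map between indecomposable projective modules. -/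
theorem exists_surjective_cokernel_homMap {m h r : Λ} (hm : IsIdempotentElem m)
    (hh : IsIdempotentElem h) (hhr : h * r = r) {P₁ P₀ : Type*}
    [AddCommGroup P₁] [Module Λᵐᵒᵖ P₁] [AddCommGroup P₀] [Module Λᵐᵒᵖ P₀]
    (ψ₁ : pim (op m) ≃ₗ[Λᵐᵒᵖ] P₁) (ψ₀ : pim (op h) ≃ₗ[Λᵐᵒᵖ] P₀) (F : P₁ →ₗ[Λᵐᵒᵖ] P₀)
    (hF : F (ψ₁ (pimGen (op m))) = op r • ψ₀ (pimGen (op h))) :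
    ∃ π : pim m →ₗ[Λ] ((P₁ →ₗ[Λᵐᵒᵖ] Λ) ⧸ LinearMap.range (homMap F)), Function.Surjective π ∧
      ∀ y, π y = 0 ↔ ∃ t, y.1 = t * r := by
  have hm' : IsIdempotentElem (op m) := congrArg op hm
  have hh' : IsIdempotentElem (op h) := congrArg op hh
  -- Functionals on `P₁` correspond to elements of `Λm` by evaluation at the generator.
  let σ : pim m →ₗ[Λ] (P₁ →ₗ[Λᵐᵒᵖ] Λ) :=
    { toFun := fun y => pimHom (op m) y.1 ∘ₗ ψ₁.symm.toLinearMap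
      map_add' := fun y y' => by
        ext x; exact add_mul y.1 y'.1 _
      map_smul' := fun a y => by
        ext x; exact mul_assoc a y.1 _ }
  have hσ : ∀ y, σ y (ψ₁ (pimGen (op m))) = y.1 := fun y => by
    change pimHom (op m) y.1 (ψ₁.symm (ψ₁ (pimGen (op m)))) = y.1
    rw [LinearEquiv.symm_apply_apply]
    exact (mem_pim hm).1 y.2
  have hext : ∀ φ φ' : P₁ →ₗ[Λᵐᵒᵖ] Λ, φ (ψ₁ (pimGen (op m))) = φ' (ψ₁ (pimGen (op m))) →
      φ = φ' := fun φ φ' hφ => by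
    have := pimHom_ext hm' (f := φ ∘ₗ ψ₁.toLinearMap) (g := φ' ∘ₗ ψ₁.toLinearMap) hφ
    ext x
    obtain ⟨y, rfl⟩ := ψ₁.surjective x
    exact LinearMap.congr_fun this y
  refine ⟨(LinearMap.range (homMap F)).mkQ ∘ₗ σ, (Submodule.mkQ_surjective _).comp ?_, ?_⟩
  · intro φ
    refine ⟨⟨φ (ψ₁ (pimGen (op m))), (mem_pim hm).2 ?_⟩, hext _ _ (hσ _)⟩
    change op m • φ _ = _
    rw [← map_smul, ← map_smul, smul_pimGen hm']
  · intro y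
    rw [LinearMap.comp_apply, Submodule.mkQ_apply, Submodule.Quotient.mk_eq_zero]
    constructor
    · rintro ⟨φ, hφ⟩
      refine ⟨φ (ψ₀ (pimGen (op h))), ?_⟩
      rw [← hσ y, ← hφ]
      change φ (F _) = _
      rw [hF, map_smul]
      rfl
    · rintro ⟨t, ht⟩
      refine ⟨pimHom (op h) (t * h) ∘ₗ ψ₀.symm.toLinearMap, hext _ _ ?_⟩
      rw [hσ, ht]
      change pimHom (op h) (t * h) (ψ₀.symm (F _)) = _
      rw [hF, map_smul, LinearEquiv.symm_apply_apply, map_smul]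
      change t * h * h * r = t * r
      rw [mul_assoc t, hh, mul_assoc, hhr]

variable [IsArtinianRing Λᵐᵒᵖ]

/-- The transpose of a simple right module, described by generators of radicals. -/
theorem exists_of_isTranspose (hL : ∀ e : Λᵐᵒᵖ, IsPrim e → IsUniserial Λᵐᵒᵖ (pim e))
    {D : Type w} [AddCommGroup D] [Module Λᵐᵒᵖ D] [IsSimpleModule Λᵐᵒᵖ D] {h : Λ} (hh : IsPrim h)
    {f : D} (hf : f ≠ 0) (hhf : op h • f = f) {T : Type u} [AddCommGroup T] [Module Λ T]
    [Nontrivial T] (hT : IsTranspose Λ D T) :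
    ∃ (m r : Λ) (π : pim m →ₗ[Λ] T), IsPrim m ∧ h * r = r ∧ r * m = r ∧ r ≠ 0 ∧
      (∀ y, h * y = y → (op y • f = 0 ↔ ∃ t, y = r * t)) ∧
      Function.Surjective π ∧ ∀ y, π y = 0 ↔ ∃ t, y.1 = t * r := by
  obtain ⟨P₁, P₀, F, p, ⟨hcov, hproj, hex, hsup⟩, ⟨ε⟩⟩ := hT
  have hh' := isPrim_op hh
  have := projective_pim hh'.1
  have := finite_pim (op h)
  have := IsSimpleModule.nontrivial Λᵐᵒᵖ D
  have hq : Function.Surjective (pimHom (op h) f) :=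
    pimHom_surjective hhf (span_eq_top_of_ne_zero hf)
  obtain ⟨ψ₀, hψ₀⟩ := hcov.exists_equiv ((hL _ hh').isProjectiveCover _ hq)
  have hP₀ : IsUniserial Λᵐᵒᵖ P₀ := (hL _ hh').of_surjective ψ₀.toLinearMap ψ₀.surjective
  have : Module.Finite Λᵐᵒᵖ P₀ := Module.Finite.equiv ψ₀
  -- If `F` vanished, minimality would give `P₁ = 0` and the transpose would be zero.
  have hF : ∃ x, F x ≠ 0 := by
    by_contra hF
    push Not at hF
    have h1 : (⊥ : Submodule Λᵐᵒᵖ P₁) = ⊤ := hsup ⊥ (by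
      rw [bot_sup_eq, eq_top_iff]
      exact fun x _ => hF x)
    have h2 : Subsingleton P₁ := (Submodule.subsingleton_iff Λᵐᵒᵖ).1
      (subsingleton_of_bot_eq_top h1)
    have h3 : Subsingleton (P₁ →ₗ[Λᵐᵒᵖ] Λ) :=
      ⟨fun φ φ' => LinearMap.ext fun x => by rw [Subsingleton.elim x 0, map_zero, map_zero]⟩
    have h4 := (Submodule.mkQ_surjective (LinearMap.range (homMap F))).subsingleton
    exact not_subsingleton T ε.toEquiv.subsingleton
  obtain ⟨m', hm', x, hx, hr⟩ := hP₀.exists_generator F hF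
  have hxs : Submodule.span Λᵐᵒᵖ {x} = ⊤ := hsup _ (by
    rw [eq_top_iff]
    intro y _
    have hy : F y ∈ Submodule.span Λᵐᵒᵖ {F x} := hr ▸ ⟨y, rfl⟩
    obtain ⟨t, ht⟩ := Submodule.mem_span_singleton.1 hy
    have : y = t • x + (y - t • x) := by abel
    rw [this]
    refine Submodule.add_mem_sup
      (Submodule.smul_mem _ _ (Submodule.mem_span_singleton_self _)) ?_
    rw [LinearMap.mem_ker, map_sub, map_smul, ht, sub_self])
  have : Nontrivial P₁ := by
    obtain ⟨y, hy⟩ := hF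
    exact ⟨y, 0, fun h => hy (by rw [h, map_zero])⟩
  have := projective_pim hm'.1
  have hsurj := pimHom_surjective hx hxs
  have hinj := (hL _ hm').injective_of_projective _ hsurj LinearMap.id Function.injective_id
  let ψ₁ : pim (op m'.unop) ≃ₗ[Λᵐᵒᵖ] P₁ := LinearEquiv.ofBijective _ ⟨hinj, hsurj⟩
  obtain ⟨w, hw⟩ := ψ₀.surjective (F x)
  have hm := isPrim_unop hm'
  have hwh : h * w.1.unop = w.1.unop := congrArg unop ((mem_pim hh'.1).1 w.2)
  have hFr : F (ψ₁ (pimGen (op m'.unop))) =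
      op (w.1.unop * m'.unop) • ψ₀ (pimGen (op h)) := by
    change F (m' • x) = (m' * w.1) • _
    rw [map_smul, ← hw, mul_smul, ← map_smul ψ₀ w.1, ← eq_smul_pimGen hh'.1]
  set r := w.1.unop * m'.unop with hrdef
  have hhr : h * r = r := by rw [hrdef, ← mul_assoc, hwh]
  have hFy : ∀ (v : pim (op m'.unop)) (hv : h * (r * v.1.unop) = r * v.1.unop),
      F (ψ₁ v) = ψ₀ ⟨op (r * v.1.unop), (mem_pim hh'.1).2 (congrArg op hv)⟩ := by
    intro v hv
    have h1 : F (ψ₁ v) = v.1 • op r • ψ₀ (pimGen (op h)) := by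
      rw [← hFr, ← map_smul, ← map_smul]
      exact congrArg (fun z => F (ψ₁ z)) (eq_smul_pimGen hm'.1 v)
    rw [h1, ← mul_smul, ← map_smul]
    exact congrArg ψ₀ (Subtype.ext (congrArg op hv))
  have hr0 : r ≠ 0 := fun h0 => by
    have h1 : x = ψ₁ (pimGen (op m'.unop)) := hx.symm
    rw [h0, op_zero, zero_smul, ← h1] at hFr
    rw [hFr, Submodule.span_zero_singleton, LinearMap.range_eq_bot] at hr
    obtain ⟨y, hy⟩ := hF
    exact hy (by rw [hr, LinearMap.zero_apply])
  obtain ⟨π, hπ, hk⟩ := exists_surjective_cokernel_homMap hm.1 hh.1 hhr ψ₁ ψ₀ F hFr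
  refine ⟨m'.unop, r, ε.symm.toLinearMap ∘ₗ π, hm, hhr, by rw [hrdef, mul_assoc, hm.1], hr0,
    fun y hy => ⟨fun hfy => ?_, ?_⟩, ε.symm.surjective.comp hπ, fun y => by
      rw [← hk]; exact ε.symm.map_eq_zero_iff⟩
  · let y' : pim (op h) := ⟨op y, (mem_pim hh'.1).2 (congrArg op hy)⟩
    have h1 : p (ψ₀ y') = 0 := (hψ₀ y').trans hfy
    obtain ⟨v', hv'⟩ := (hex _).1 h1
    obtain ⟨v, rfl⟩ := ψ₁.surjective v'
    rw [hFy v (by rw [← mul_assoc, hhr])] at hv'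
    exact ⟨v.1.unop, (congrArg (fun z => z.1.unop) (ψ₀.injective hv')).symm⟩
  · rintro ⟨t, rfl⟩
    have h2 : p (F (ψ₁ (pimGen (op m'.unop)))) = 0 := hex.apply_apply_eq_zero _
    rw [hFr, map_smul, hψ₀, pimHom_apply] at h2
    change op r • op h • f = 0 at h2
    rw [op_mul, mul_smul, ← hhf, h2, smul_zero]

/-- The presentation is `lΛ → gΛ → D`, the first map being left multiplication by `z`; dualizing it
gives `Λl/Λz`, which is `K`. The point to prove is that `zΛ` is the whole kernel of `gΛ → D`. -/
theorem isTranspose_of_radical (hR : IsSerial Λ)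
    (hL : ∀ e : Λᵐᵒᵖ, IsPrim e → IsUniserial Λᵐᵒᵖ (pim e))
    {D : Type w} [AddCommGroup D] [Module Λᵐᵒᵖ D] [IsSimpleModule Λᵐᵒᵖ D] {g l z : Λ}
    (hg : IsPrim g) (hl : IsPrim l) {f : D} (hf : f ≠ 0) (hgf : op g • f = f)
    {K : Type u} [AddCommGroup K] [Module Λ K] [IsSimpleModule Λ K] {c : K} (hc : c ≠ 0)
    (hlc : l • c = c) (hgz : g * z = z) (hzl : z * l = z) (hz0 : z ≠ 0)
    (hz : ∀ y : Λ, y * l = y → (y • c = 0 ↔ ∃ t, y = t * z)) (hfz : op z • f = 0) :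
    IsTranspose Λ D K := by
  have hg' := isPrim_op hg
  have hl' := isPrim_op hl
  have := projective_pim hg'.1
  have := finite_pim (op g)
  have := IsSimpleModule.nontrivial Λᵐᵒᵖ D
  let z' : pim (op g) := ⟨op z, (mem_pim hg'.1).2 (congrArg op hgz)⟩
  have hlz' : op l • z' = z' := Subtype.ext (congrArg op hzl)
  let F : pim (op l) →ₗ[Λᵐᵒᵖ] pim (op g) := pimHom (op l) z'
  have hp : Function.Surjective (pimHom (op g) f) :=
    pimHom_surjective hgf (span_eq_top_of_ne_zero hf)
  have hFgen : F (pimGen (op l)) = z' := hlz'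
  have hFmem : ∀ (y : pim (op g)) (t : Λ), y.1 = op (z * t) → y ∈ LinearMap.range F := by
    intro y t hy
    refine ⟨op t • pimGen (op l), ?_⟩
    rw [map_smul, hFgen]
    exact Subtype.ext hy.symm
  have hker : ∀ y : pim (op g), pimHom (op g) f y = 0 → y ∈ LinearMap.range F := by
    intro y hy
    refine mem_of_forall_isPrim _ _ fun m' hm' => ?_
    have hm := isPrim_unop hm'
    set m := m'.unop with hmdef
    set x : Λ := y.1.unop * m with hx
    have hyx : (m' • y).1 = op x := rfl
    have hgx : g * x = x := by
      have : g * y.1.unop = y.1.unop := congrArg unop ((mem_pim hg'.1).1 y.2)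
      rw [hx, ← mul_assoc, this]
    have hxm : x * m = x := by rw [hx, mul_assoc, hm.1]
    have hfx : op x • f = 0 := by
      have : op x = m' * y.1 := rfl
      rw [this, mul_smul]
      change m' • pimHom (op g) f y = 0
      rw [hy, smul_zero]
    rcases hR.right g hg x z hgx hgz with ⟨t, ht⟩ | ⟨t, ht⟩
    · exact hFmem _ t (by rw [hyx, ht])
    obtain ⟨t, htz, hmt, htl⟩ : ∃ t, z = x * t ∧ m * t = t ∧ t * l = t :=
      ⟨m * t * l, by rw [← mul_assoc, ← mul_assoc, hxm, ← ht, hzl],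
        by simp only [← mul_assoc, hm.1.eq], by rw [mul_assoc, hl.1]⟩
    -- If `t` kills `c`, then `t = w * z` and `z = x * w * g * z`. Left multiplication by `x * w *
    -- g` on `gΛ` fixes `z`, so it is invertible; since `x` kills `f`, this gives `f = 0`.
    by_cases htc : t • c = 0
    · exfalso
      obtain ⟨w, hw⟩ := (hz t htl).1 htc
      have hvz : x * w * g * z = z := by rw [mul_assoc, hgz, mul_assoc, ← hw, ← htz]
      let v' : pim (op g) := ⟨op (x * w * g), (mem_pim hg'.1).2
        (congrArg op (show g * (x * w * g) = x * w * g by simp only [← mul_assoc, hgx]))⟩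
      let H : pim (op g) →ₗ[Λᵐᵒᵖ] pim (op g) := pimHom (op g) v'
      have hHz : H z' = z' := Subtype.ext (congrArg op hvz)
      have : Nontrivial (Submodule.span Λᵐᵒᵖ {z'}) := by
        rw [Submodule.nontrivial_iff_ne_bot, Ne, Submodule.span_singleton_eq_bot]
        exact fun h => hz0 (op_injective (congrArg Subtype.val h))
      have hinj : Function.Injective H := (hL _ hg').injective_of_comp_injective
        (Submodule.span Λᵐᵒᵖ {z'}).subtype H (by
          rw [injective_iff_map_eq_zero]
          rintro ⟨_, hy⟩ h0
          obtain ⟨t, rfl⟩ := Submodule.mem_span_singleton.1 hy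
          have h1 : H (t • z') = 0 := h0
          rw [map_smul, hHz] at h1
          exact Subtype.ext h1)
      obtain ⟨y', hy'⟩ := (injective_endo_bijective H hinj).2 (pimGen (op g))
      have h1 : op g = y'.1 * op (x * w * g) := (congrArg Subtype.val hy').symm
      apply hf
      rw [← hgf, h1, op_mul, op_mul, mul_smul, mul_smul, mul_smul, hfx, smul_zero, smul_zero,
        smul_zero]
    -- Otherwise `t` generates `pim l`, say `w * t = l`. Then `t * (w * m)` is a nonzero idempotent
    -- below `m`, hence equal to `m`, and `x = z * (w * m)`.
    · let t' : pim l := ⟨t, (mem_pim hl.1).2 htl⟩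
      have hsup : Submodule.span Λ {t'} ⊔ LinearMap.ker (pimHom l c) = ⊤ := by
        rw [eq_top_iff]
        intro y _
        obtain ⟨s, hs⟩ := Submodule.mem_span_singleton.1
          (span_eq_top_of_ne_zero (R := Λ) htc ▸ Submodule.mem_top : y.1 • c ∈ Submodule.span Λ {t • c})
        have : y = s • t' + (y - s • t') := by abel
        rw [this]
        refine Submodule.add_mem_sup
          (Submodule.smul_mem _ _ (Submodule.mem_span_singleton_self _)) ?_
        rw [LinearMap.mem_ker, map_sub, map_smul, pimHom_apply, pimHom_apply, hs, sub_self]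
      have htop := ((hR.left l hl).eq_top_or_eq_top hsup).resolve_right fun h => by
        have : pimGen l ∈ LinearMap.ker (pimHom l c) := h ▸ Submodule.mem_top
        exact hc (hlc.symm.trans this)
      obtain ⟨w, hw⟩ := Submodule.mem_span_singleton.1
        (htop ▸ Submodule.mem_top : pimGen l ∈ Submodule.span Λ {t'})
      have hwt : w * t = l := congrArg Subtype.val hw
      have hidem : IsIdempotentElem (t * (w * m)) := by
        change t * (w * m) * (t * (w * m)) = _
        have : m * (t * (w * m)) = t * (w * m) := by rw [← mul_assoc, hmt]
        rw [mul_assoc t, mul_assoc w, this, ← mul_assoc w, hwt, ← mul_assoc, htl]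
      rcases hm.2.2 _ hidem (by rw [← mul_assoc, hmt]) (by
        rw [mul_assoc, mul_assoc w, hm.1]) with h0 | h0
      · exfalso
        apply hl.2.1
        have : l * l = w * (t * (w * m)) * t := by
          rw [mul_assoc, mul_assoc t, mul_assoc w, hmt, hwt, htl, hwt, hl.1]
        rw [← hl.1, this, h0, mul_zero, zero_mul]
      · refine hFmem _ (w * m) ?_
        rw [hyx, htz, mul_assoc, h0, hxm]
  have hex : Function.Exact F (pimHom (op g) f) := by
    intro y
    refine ⟨hker y, ?_⟩
    rintro ⟨x, rfl⟩
    have h1 : F x = x.1 • z' := rfl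
    rw [h1, map_smul]
    change x.1 • op z • f = 0
    rw [hfz, smul_zero]
  obtain ⟨π, hπ, hk⟩ := exists_surjective_cokernel_homMap hl.1 hg.1 hgz
    (LinearEquiv.refl Λᵐᵒᵖ (pim (op l))) (LinearEquiv.refl Λᵐᵒᵖ (pim (op g))) F (by
      refine hFgen.trans ?_
      exact eq_smul_pimGen hg'.1 z')
  have hq : Function.Surjective (pimHom l c) :=
    pimHom_surjective hlc (span_eq_top_of_ne_zero hc)
  have hkc : ∀ y : pim l, pimHom l c y = 0 ↔ π y = 0 := fun y => by
    rw [hk, ← hz y.1 ((mem_pim hl.1).1 y.2)]; rfl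
  obtain ⟨G, hG⟩ := exists_factor (pimHom l c) hq π fun y hy => (hkc y).1 hy
  refine ⟨ModuleCat.of Λᵐᵒᵖ (pim (op l)), ModuleCat.of Λᵐᵒᵖ (pim (op g)), F, pimHom (op g) f,
    ⟨(hL _ hg').isProjectiveCover _ hp, projective_pim hl'.1, hex,
      (hL _ hl').isSuperfluous fun h => ?_⟩, ⟨LinearEquiv.ofBijective G ⟨?_, ?_⟩⟩⟩
  · have : pimGen (op l) ∈ LinearMap.ker F := h ▸ Submodule.mem_top
    rw [LinearMap.mem_ker, hFgen] at this
    exact hz0 (op_injective (congrArg Subtype.val this))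
  · rw [injective_iff_map_eq_zero]
    intro y hy
    obtain ⟨x, rfl⟩ := hq y
    rw [hG] at hy
    exact (hkc x).2 hy
  · intro y
    obtain ⟨x, rfl⟩ := hπ y
    exact ⟨pimHom l c x, hG x⟩

end Transpose

end NakayamaCore

namespace NakayamaCore

/-! ### Existence of injective hulls -/

section InjectiveHull

variable {k : Type v} [Ring k]

/-- The range of `A → I` has an essential extension which is a direct summand of `I`. -/
theorem exists_essential_isCompl {A I : Type v} [AddCommGroup A] [Module k A] [AddCommGroup I]
    [Module k I] [Module.Injective k I] (ι : A →ₗ[k] I) :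
    ∃ E C : Submodule k I, LinearMap.range ι ≤ E ∧ IsCompl E C ∧
      ∀ N ≤ E, N ⊓ LinearMap.range ι = ⊥ → N = ⊥ := by
  set B := LinearMap.range ι
  -- `E` is a maximal essential extension of the range, and below `C` is maximal with `C ⊓ E = ⊥`,
  -- so that `E` becomes essential in `I ⧸ C`.
  obtain ⟨E, hBE, hE⟩ := zorn_le_nonempty₀
    {E : Submodule k I | B ≤ E ∧ ∀ N ≤ E, N ⊓ B = ⊥ → N = ⊥} (by
      intro c hc hchain y hy
      have hdir : DirectedOn (· ≤ ·) c := hchain.directedOn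
      refine ⟨sSup c, ⟨(hc hy).1.trans (le_sSup hy), fun N hN hNB => ?_⟩,
        fun z hz => le_sSup hz⟩
      rw [eq_bot_iff]
      intro x hx
      obtain ⟨F, hF, hxF⟩ := (Submodule.mem_sSup_of_directed ⟨y, hy⟩ hdir).1 (hN hx)
      have h1 := (hc hF).2 (N ⊓ F) inf_le_right (by
        rw [eq_bot_iff, ← hNB]
        exact inf_le_inf_right _ inf_le_left)
      exact h1 ▸ (⟨hx, hxF⟩ : x ∈ N ⊓ F)) B
    ⟨le_rfl, fun N hN hNB => by rwa [inf_eq_left.2 hN] at hNB⟩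
  obtain ⟨C, hC⟩ := zorn_le₀ {C : Submodule k I | C ⊓ E = ⊥} (by
      intro c hc hchain
      rcases c.eq_empty_or_nonempty with rfl | hne
      · exact ⟨⊥, by simp, by simp⟩
      refine ⟨sSup c, ?_, fun z hz => le_sSup hz⟩
      change sSup c ⊓ E = ⊥
      rw [eq_bot_iff]
      rintro x ⟨hx, hxE⟩
      obtain ⟨F, hF, hxF⟩ := (Submodule.mem_sSup_of_directed hne hchain.directedOn).1 hx
      exact (show F ⊓ E = ⊥ from hc hF) ▸ (⟨hxF, hxE⟩ : x ∈ F ⊓ E))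
  have hCE : C ⊓ E = ⊥ := hC.prop
  have hinj : Function.Injective (C.mkQ ∘ₗ E.subtype) := by
    rw [injective_iff_map_eq_zero]
    intro x hx
    have hx' : x.1 ∈ C := by simpa using hx
    have : x.1 ∈ C ⊓ E := ⟨hx', x.2⟩
    rw [hCE] at this
    exact Subtype.ext this
  -- `θ` is injective by essentiality, and its range is again an essential extension of the range of
  -- `ι`. Maximality gives `range θ = E`, and `θ` provides the projection onto `E` along `C`.
  obtain ⟨θ, hθ⟩ := Module.Injective.out (C.mkQ ∘ₗ E.subtype) hinj E.subtype
  have hess : ∀ L : Submodule k (I ⧸ C), L ⊓ E.map C.mkQ = ⊥ → L = ⊥ := by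
    intro L hL
    have h1 : L.comap C.mkQ ⊓ E = ⊥ := by
      rw [eq_bot_iff]
      rintro x ⟨hxL, hxE⟩
      have h2 : C.mkQ x ∈ L ⊓ E.map C.mkQ := ⟨hxL, ⟨x, hxE, rfl⟩⟩
      rw [hL, Submodule.mem_bot] at h2
      have : (⟨x, hxE⟩ : E) = 0 := hinj (by simpa using h2)
      exact congrArg Subtype.val this
    have h2 : C ≤ L.comap C.mkQ := by
      intro x hx
      have : C.mkQ x = 0 := by simpa using hx
      rw [Submodule.mem_comap, this]
      exact L.zero_mem
    have h3 : L.comap C.mkQ ≤ C := hC.le_of_ge h1 h2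
    rw [eq_bot_iff]
    intro y hy
    obtain ⟨x, rfl⟩ := C.mkQ_surjective y
    simpa using h3 hy
  have hθi : LinearMap.ker θ = ⊥ := by
    apply hess
    rw [eq_bot_iff]
    rintro _ ⟨hx, y, hy, rfl⟩
    have : θ (C.mkQ y) = y := hθ ⟨y, hy⟩
    rw [LinearMap.mem_ker.1 hx] at this
    rw [← this, map_zero]
    exact Submodule.zero_mem _
  have hEθ : E ≤ LinearMap.range θ := fun x hx => ⟨C.mkQ x, hθ ⟨x, hx⟩⟩
  have hmax : LinearMap.range θ ≤ E := by
    refine hE.le_of_ge ⟨hBE.trans hEθ, fun N hN hNB => ?_⟩ hEθ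
    have h1 : N ⊓ E = ⊥ := hE.prop.2 _ inf_le_right (by
      rw [inf_assoc, inf_eq_right.2 hBE, hNB])
    have h2 : N.comap θ = ⊥ := by
      apply hess
      rw [eq_bot_iff]
      rintro _ ⟨hx, y, hy, rfl⟩
      have h3 : θ (C.mkQ y) = y := hθ ⟨y, hy⟩
      have h4 : y ∈ N ⊓ E := ⟨h3 ▸ hx, hy⟩
      rw [h1, Submodule.mem_bot] at h4
      rw [h4, map_zero]
      exact Submodule.zero_mem _
    rw [eq_bot_iff]
    intro x hx
    obtain ⟨y, rfl⟩ := hN hx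
    have : y ∈ N.comap θ := hx
    rw [h2, Submodule.mem_bot] at this
    rw [this, map_zero]
    exact Submodule.zero_mem _
  refine ⟨E, C, hBE, ⟨disjoint_iff.2 (inf_comm E C ▸ hCE), ?_⟩, hE.prop.2⟩
  rw [codisjoint_iff, eq_top_iff]
  intro x _
  have h1 : θ (C.mkQ x) ∈ E := hmax ⟨_, rfl⟩
  have h2 : C.mkQ x = C.mkQ (θ (C.mkQ x)) :=
    LinearMap.ker_eq_bot.1 hθi (hθ ⟨_, h1⟩).symm
  have h3 : x - θ (C.mkQ x) ∈ C := by
    rw [← Submodule.Quotient.mk_eq_zero, ← Submodule.mkQ_apply, map_sub, ← h2, sub_self]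
  have h4 : x = θ (C.mkQ x) + (x - θ (C.mkQ x)) := by abel
  rw [h4]
  exact Submodule.add_mem_sup h1 h3

theorem exists_isInjectiveHull (A : Type v) [AddCommGroup A] [Module k A] :
    ∃ (E : ModuleCat.{v} k) (ι : A →ₗ[k] E), IsInjectiveHull ι := by
  let I : ModuleCat.{v} k := CategoryTheory.Injective.under (ModuleCat.of k A)
  let ι : A →ₗ[k] I := (CategoryTheory.Injective.ι (ModuleCat.of k A)).hom
  have hι : Function.Injective ι := (ModuleCat.mono_iff_injective _).1
    (inferInstance : CategoryTheory.Mono (CategoryTheory.Injective.ι (ModuleCat.of k A)))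
  have hI : CategoryTheory.Injective (ModuleCat.of k I) :=
    (inferInstance : CategoryTheory.Injective
      (CategoryTheory.Injective.under (ModuleCat.of k A)))
  have : Module.Injective k I := Module.injective_module_of_injective_object k I
  obtain ⟨E, C, hE, hc, hess⟩ := exists_essential_isCompl ι
  refine ⟨ModuleCat.of k E, ι.codRestrict E fun x => hE ⟨x, rfl⟩, ?_, ?_, ?_⟩
  · refine ⟨fun X Y _ _ _ _ f hf g => ?_⟩
    obtain ⟨h, hh⟩ := Module.Injective.out f hf (E.subtype ∘ₗ g)
    refine ⟨Submodule.projectionOnto E C hc ∘ₗ h, fun x => ?_⟩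
    rw [LinearMap.comp_apply, hh]
    exact Submodule.projectionOnto_apply_left hc (g x)
  · intro x y hxy
    exact hι (congrArg Subtype.val hxy)
  · intro N hN
    have h1 := hess (N.map E.subtype) (Submodule.map_subtype_le E N) (by
      rw [eq_bot_iff]
      rintro _ ⟨⟨y, hy, rfl⟩, ⟨a, ha⟩⟩
      have : y ∈ N ⊓ LinearMap.range (ι.codRestrict E fun x => hE ⟨x, rfl⟩) :=
        ⟨hy, a, Subtype.ext ha⟩
      rw [hN, Submodule.mem_bot] at this
      rw [this, map_zero]
      exact Submodule.zero_mem _)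
    exact Submodule.map_injective_of_injective E.injective_subtype
      (h1.trans (Submodule.map_bot _).symm)

end InjectiveHull

end NakayamaCore

/-! ### Duals of simple modules -/

namespace NakayamaCore

theorem simple_induction {Λ : Type*} [Ring Λ] {S : Type*} [AddCommGroup S] [Module Λ S]
    [IsSimpleModule Λ S] {p : S → Prop} (h0 : p 0) (hadd : ∀ x y, p x → p y → p (x + y))
    (hsmul : ∀ (a : Λ) x, p x → p (a • x)) {c : S} (hc : c ≠ 0) (hpc : p c) (x : S) : p x := by
  let N : Submodule Λ S :=
    { carrier := {x | p x}
      zero_mem' := h0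
      add_mem' := fun {x y} => hadd x y
      smul_mem' := hsmul }
  have hN : N = ⊤ := (eq_bot_or_eq_top N).resolve_left fun h => hc (by
    have : c ∈ N := hpc
    rwa [h] at this)
  have : x ∈ N := hN ▸ Submodule.mem_top
  exact this

section Duality

open MulOpposite

variable {k : Type v} [CommRing k] [IsArtinianRing k] {E : Type v} [AddCommGroup E] [Module k E]

theorem isSemisimpleModule_of_jacobson_smul {V : Type*} [AddCommGroup V] [Module k V]
    (h : ∀ j ∈ Ring.jacobson k, ∀ x : V, j • x = 0) : IsSemisimpleModule k V := by
  have hV : Module.IsTorsionBySet k V (Ring.jacobson k) := fun x a => h a.1 a.2 x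
  let := hV.module
  exact hV.isSemisimpleModule_iff.1 inferInstance

/-- The part of `E` killed by the radical is semisimple, so the range of `ι` has a complement in it,
and essentiality kills the complement. -/
theorem IsInjectiveHull.mem_range {ι : (k ⧸ Ring.jacobson k) →ₗ[k] E} (hι : IsInjectiveHull ι)
    {x : E} (hx : ∀ j ∈ Ring.jacobson k, j • x = 0) : x ∈ LinearMap.range ι := by
  let N : Submodule k E := Submodule.torsionBySet k E (Ring.jacobson k)
  have hN : ∀ y : E, y ∈ N ↔ ∀ j ∈ Ring.jacobson k, j • y = 0 := fun y => by
    rw [Submodule.mem_torsionBySet_iff]; exact Subtype.forall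
  have : IsSemisimpleModule k N := isSemisimpleModule_of_jacobson_smul fun j hj y =>
    Subtype.ext ((hN y.1).1 y.2 j hj)
  have hle : LinearMap.range ι ≤ N := by
    rintro _ ⟨y, rfl⟩
    obtain ⟨a, rfl⟩ := Submodule.mkQ_surjective _ y
    refine (hN _).2 fun j hj => ?_
    have h0 : (Ring.jacobson k).mkQ (j • a) = 0 :=
      (Submodule.Quotient.mk_eq_zero _).2 (Ideal.mul_mem_right a _ hj)
    rw [← map_smul, ← map_smul, h0, map_zero]
  obtain ⟨C, hC⟩ := exists_isCompl ((LinearMap.range ι).comap N.subtype)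
  have h1 : C.map N.subtype = ⊥ := hι.essential _ (by
    rw [eq_bot_iff]
    rintro _ ⟨⟨y, hy, rfl⟩, hy'⟩
    have : y ∈ (LinearMap.range ι).comap N.subtype ⊓ C := ⟨hy', hy⟩
    rw [hC.inf_eq_bot, Submodule.mem_bot] at this
    rw [this, map_zero]
    exact Submodule.zero_mem _)
  have h2 : C = ⊥ := Submodule.map_injective_of_injective N.injective_subtype
    (h1.trans (Submodule.map_bot _).symm)
  have h3 := hC.sup_eq_top
  rw [h2, sup_bot_eq] at h3
  have : (⟨x, (hN x).2 hx⟩ : N) ∈ (LinearMap.range ι).comap N.subtype := h3 ▸ Submodule.mem_top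
  exact this

/-- An endomorphism of `E` preserves the part killed by the radical; this is cyclic over a
commutative ring, so the endomorphism acts there as a scalar. -/
theorem IsInjectiveHull.exists_smul {ι : (k ⧸ Ring.jacobson k) →ₗ[k] E} (hι : IsInjectiveHull ι)
    (u : E →ₗ[k] E) : ∃ c : k, ∀ x ∈ LinearMap.range ι, u x = c • x := by
  let q := (Ring.jacobson k).mkQ
  have hj : ∀ j ∈ Ring.jacobson k, j • u (ι (q 1)) = 0 := fun j hj => by
    have : j • q 1 = 0 := by
      rw [← map_smul]
      exact (Submodule.Quotient.mk_eq_zero _).2 (Ideal.mul_mem_right 1 _ hj)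
    rw [← map_smul, ← map_smul, this, map_zero, map_zero]
  obtain ⟨y, hy⟩ := hι.mem_range hj
  obtain ⟨c, rfl⟩ := Submodule.mkQ_surjective _ y
  have hq : ∀ a : k, q a = a • q 1 := fun a => by rw [← map_smul, smul_eq_mul, mul_one]
  refine ⟨c, ?_⟩
  rintro _ ⟨z, rfl⟩
  obtain ⟨a, rfl⟩ := Submodule.mkQ_surjective _ z
  change u (ι (q a)) = c • ι (q a)
  change ι (q c) = _ at hy
  rw [hq c] at hy
  rw [hq a, map_smul, map_smul, ← hy, map_smul, smul_comm]

variable {Λ : Type u} [Ring Λ] [Algebra k Λ] {S : Type w} [AddCommGroup S] [Module k S]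
  [Module Λ S] [IsScalarTower k Λ S] [IsSimpleModule Λ S]

/-- Multiplication by `j` is Λ-linear, so on the simple `S` it is injective or zero, and the radical
of `k` is nilpotent. -/
theorem jacobson_smul_eq_zero (Λ : Type u) [Ring Λ] [Algebra k Λ] {S : Type w} [AddCommGroup S]
    [Module k S] [Module Λ S] [IsScalarTower k Λ S] [IsSimpleModule Λ S] {j : k} (hj : j ∈ Ring.jacobson k) (s : S) : j • s = 0 := by
  have hcomm : ∀ (j : k) (a : Λ) (x : S), j • a • x = a • j • x := fun j a x => by
    rw [← algebraMap_smul Λ j, ← algebraMap_smul Λ j, ← mul_smul, ← mul_smul, Algebra.commutes]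
  by_contra hs
  have hinj : ∀ c : S, c ≠ 0 → j • c ≠ 0 := fun c hc h => hs
    (simple_induction (Λ := Λ) (S := S) (p := fun x : S => j • x = (0 : S)) (smul_zero _)
      (fun x y hx hy => by rw [smul_add, hx, hy, add_zero])
      (fun a x hx => by rw [hcomm, hx, smul_zero]) hc h s)
  have hpow : ∀ n : ℕ, j ^ n • s ≠ 0 := fun n => by
    induction n with
    | zero => rw [pow_zero, one_smul]; exact fun h => hs (by rw [h, smul_zero])
    | succ n ih => rw [pow_succ', mul_smul]; exact hinj _ ih
  obtain ⟨n, hn⟩ := IsSemiprimaryRing.isNilpotent (R := k)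
  have : j ^ n = 0 := by
    have := Ideal.pow_mem_pow hj n
    rwa [hn] at this
  exact hpow n (by rw [this, zero_smul])

/-- With `k`-generators `b i` of Λ, the maps `f (b i • ·)` embed `S` in a power of `E`. Extend `g`
to that power; on the image of `S`, which the radical kills, its components are scalars `c i`, and
`a = ∑ c i • b i`. -/
theorem exists_dual_smul_eq [Module.Finite k Λ] {ι : (k ⧸ Ring.jacobson k) →ₗ[k] E}
    (hι : IsInjectiveHull ι) (f g : S →ₗ[k] E) (hf : f ≠ 0) :
    ∃ a : Λ, ∀ s, g s = f (a • s) := by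
  have := hι.injective_module
  obtain ⟨n, b, hb⟩ := Module.Finite.exists_fin (R := k) (M := Λ)
  let Φ : S →ₗ[k] (Fin n → E) :=
    LinearMap.pi fun i => f ∘ₗ (Algebra.lsmul k k S (b i))
  have hΦ : ∀ s i, Φ s i = f (b i • s) := fun s i => rfl
  have hinj : Function.Injective Φ := by
    rw [injective_iff_map_eq_zero]
    intro s hs
    by_contra hs0
    have h1 : ∀ a : Λ, f (a • s) = 0 := fun a => by
      have ha : a ∈ Submodule.span k (Set.range b) := hb ▸ Submodule.mem_top
      induction ha using Submodule.span_induction with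
      | mem x hx =>
        obtain ⟨i, rfl⟩ := hx
        exact congrFun hs i
      | zero => rw [zero_smul, map_zero]
      | add x y _ _ hx hy => rw [add_smul, map_add, hx, hy, add_zero]
      | smul c x _ hx => rw [smul_assoc, map_smul, hx, smul_zero]
    apply hf
    ext x
    have := simple_induction (Λ := Λ) (p := fun x => ∀ a : Λ, f (a • x) = 0)
      (fun a => by rw [smul_zero, map_zero])
      (fun x y hx hy a => by rw [smul_add, map_add, hx, hy, add_zero])
      (fun a x hx a' => by rw [← mul_smul]; exact hx _) hs0 h1 x 1
    rwa [one_smul] at this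
  obtain ⟨h, hh⟩ := Module.Injective.extension_property k E S (Fin n → E) Φ hinj g
  choose c hc using fun i => hι.exists_smul (h ∘ₗ LinearMap.single k (fun _ => E) i)
  refine ⟨∑ i, c i • b i, fun s => ?_⟩
  have h1 : Φ s = ∑ i, LinearMap.single k (fun _ => E) i (Φ s i) :=
    (Finset.univ_sum_single (Φ s)).symm
  rw [← hh, LinearMap.comp_apply, h1, map_sum, Finset.sum_smul, map_sum]
  refine Finset.sum_congr rfl fun i _ => ?_
  rw [smul_assoc, map_smul, ← hΦ]
  refine hc i _ (hι.mem_range fun j hj => ?_)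
  rw [hΦ, ← map_smul, jacobson_smul_eq_zero Λ hj, map_zero]

/-- The cyclic `k`-module generated by `c` is a quotient of the semisimple `k ⧸ rad k`, hence
isomorphic to a summand of it. That summand embeds in `E`, and injectivity extends the map to `S`.
-/
theorem exists_dual_ne_zero (Λ : Type u) [Ring Λ] [Algebra k Λ] {S : Type w} [AddCommGroup S]
    [Module k S] [Module Λ S] [IsScalarTower k Λ S] [IsSimpleModule Λ S] {ι : (k ⧸ Ring.jacobson k) →ₗ[k] E} (hι : IsInjectiveHull ι)
    {c : S} (hc : c ≠ 0) : ∃ f : S →ₗ[k] E, f c ≠ 0 := by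
  have := hι.injective_module
  have : IsSemisimpleModule k (k ⧸ Ring.jacobson k) :=
    isSemisimpleModule_of_jacobson_smul fun j hj x => by
      obtain ⟨a, rfl⟩ := Submodule.mkQ_surjective _ x
      rw [← map_smul]
      exact (Submodule.Quotient.mk_eq_zero _).2 (Ideal.mul_mem_right a _ hj)
  let θ : (k ⧸ Ring.jacobson k) →ₗ[k] S :=
    (Ring.jacobson k).liftQ (LinearMap.toSpanSingleton k S c)
      fun j hj => jacobson_smul_eq_zero Λ hj c
  have hθ : ∀ a : k, θ ((Ring.jacobson k).mkQ a) = a • c := fun a =>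
    Submodule.liftQ_apply _ _ _
  obtain ⟨C, hC⟩ := exists_isCompl (LinearMap.ker θ)
  have hinj : Function.Injective (θ ∘ₗ C.subtype) := by
    rw [injective_iff_map_eq_zero]
    intro x hx
    have : x.1 ∈ LinearMap.ker θ ⊓ C := ⟨hx, x.2⟩
    rw [hC.inf_eq_bot] at this
    exact Subtype.ext this
  obtain ⟨f, hf⟩ := Module.Injective.extension_property k E C S _ hinj (ι ∘ₗ C.subtype)
  refine ⟨f, fun h0 => ?_⟩
  have hCb : C = ⊥ := by
    rw [eq_bot_iff]
    intro x hx
    have h1 : f (θ x) = ι x := LinearMap.congr_fun hf ⟨x, hx⟩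
    obtain ⟨a, rfl⟩ := Submodule.mkQ_surjective _ x
    rw [hθ, map_smul, h0, smul_zero] at h1
    exact (injective_iff_map_eq_zero ι).1 hι.injective _ h1.symm
  have h1 := hC.sup_eq_top
  rw [hCb, sup_bot_eq] at h1
  have h2 : (Ring.jacobson k).mkQ 1 ∈ LinearMap.ker θ := h1 ▸ Submodule.mem_top
  rw [LinearMap.mem_ker, hθ, one_smul] at h2
  exact hc h2

theorem isSimpleModule_dualInto [Module.Finite k Λ] {ι : (k ⧸ Ring.jacobson k) →ₗ[k] E}
    (hι : IsInjectiveHull ι) : IsSimpleModule Λᵐᵒᵖ (DualInto k Λ S E) := by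
  have := IsSimpleModule.nontrivial Λ S
  obtain ⟨c, hc⟩ := exists_ne (0 : S)
  obtain ⟨f, hf⟩ := exists_dual_ne_zero Λ hι hc
  have : Nontrivial (DualInto k Λ S E) :=
    ⟨(f : S →ₗ[k] E), (0 : S →ₗ[k] E), fun h => hf (by
      have h' : f = 0 := h
      rw [h', LinearMap.zero_apply])⟩
  refine isSimpleModule_iff_toSpanSingleton_surjective.2 ⟨this, fun x hx y => ?_⟩
  obtain ⟨a, ha⟩ := exists_dual_smul_eq (Λ := Λ) hι (show S →ₗ[k] E from x)
    (show S →ₗ[k] E from y) hx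
  exact ⟨op a, (LinearMap.ext ha).symm⟩

theorem exists_dualInto_generator {ι : (k ⧸ Ring.jacobson k) →ₗ[k] E}
    (hι : IsInjectiveHull ι) {h : Λ} (hh : IsIdempotentElem h) {c : S} (hc : c ≠ 0)
    (hhc : h • c = c) : ∃ f : DualInto k Λ S E, f ≠ 0 ∧ op h • f = f := by
  obtain ⟨f, hf⟩ := exists_dual_ne_zero Λ hι hc
  refine ⟨op h • (show DualInto k Λ S E from f), fun h0 => hf ?_, ?_⟩
  · have := LinearMap.congr_fun (show f ∘ₗ Algebra.lsmul k k S h = 0 from h0) c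
    change f (h • c) = 0 at this
    rwa [hhc] at this
  · rw [← mul_smul, ← op_mul, hh]

end Duality

end NakayamaCore

namespace NakayamaCore

/-! ### The inverse translate of a simple module -/

section Translate

open MulOpposite

variable (k : Type v) [CommRing k] [IsArtinianRing k] {Λ : Type u} [Ring Λ] [Algebra k Λ]
  [Module.Finite k Λ]

theorem HasTop.trans {R : Type*} [Ring R] (hR : IsSerial R) {A B : Type*} [AddCommGroup A]
    [Module R A] [AddCommGroup B] [Module R B] [Nontrivial A] {e f : R} (he : IsPrim e)
    (hf : IsPrim f) (h₁ : HasTop e A) (h₂ : HasTop f A) (h₃ : HasTop e B) : HasTop f B := by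
  obtain ⟨p, hp⟩ := h₁.exists_surjective
  obtain ⟨q, hq⟩ := h₃.exists_surjective
  exact (HasTop.lift hf.1 (hR.left e he) p hp h₂).of_surjective q hq

/-- If `l • s ≠ 0`, then `S` is another simple quotient of `pim l`. A uniserial module has only one
maximal submodule, and `z` lies in it. -/
theorem smul_eq_zero_of_mem_radical {R : Type*} [Ring R] (hR : IsSerial R) {S K : Type*}
    [AddCommGroup S] [Module R S] [IsSimpleModule R S] [AddCommGroup K] [Module R K]
    [IsSimpleModule R K] {l z : R} (hl : IsPrim l) {c : K} (hc : c ≠ 0) (hlc : l • c = c)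
    (hzl : z * l = z) (hzc : z • c = 0) (s : S) : z • s = 0 := by
  by_cases hs : l • s = 0
  · rw [← hzl, mul_smul, hs, smul_zero]
  have hls : l • l • s = l • s := by rw [← mul_smul, hl.1]
  have hs1 := pimHom_surjective hls (span_eq_top_of_ne_zero hs)
  have hz : z • s = pimHom l (l • s) ⟨z, (mem_pim hl.1).2 hzl⟩ := by
    rw [pimHom_apply, ← mul_smul, hzl]
  rcases hR.left l hl (LinearMap.ker (pimHom l c)) (LinearMap.ker (pimHom l (l • s)))
    with hle | hle
  · rw [hz]
    exact hle hzc
  · obtain ⟨g, hg⟩ := exists_factor _ hs1 (pimHom l c) fun x hx => hle hx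
    have hg0 : g ≠ 0 := fun h0 => hc (by
      have := hg (pimGen l)
      rw [h0] at this
      exact hlc.symm.trans this.symm)
    apply (LinearMap.bijective_of_ne_zero hg0).1
    rw [map_zero, hz, hg]
    exact hzc

/-- The transpose of `D S` is `Λm/Λr` with `r ∈ hΛ`, where `h` belongs to `S`. Uniqueness of
projective covers identifies `Λr` with the radical of the cover of `K`, so this radical has
idempotent `h`. -/
theorem hasTop_of_isTauInv (hR : IsSerial Λ)
    (hL : ∀ e : Λᵐᵒᵖ, IsPrim e → IsUniserial Λᵐᵒᵖ (pim e)) {S K : Type u} [AddCommGroup S]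
    [Module Λ S] [IsSimpleModule Λ S] [AddCommGroup K] [Module Λ K] [IsSimpleModule Λ K]
    {g l : Λ} (hg : IsPrim g) (hl : IsPrim l) {c : K} (hc : c ≠ 0) (hlc : l • c = c)
    [Nontrivial (LinearMap.ker (pimHom l c))] (hgL : HasTop g (LinearMap.ker (pimHom l c)))
    (hT : IsTauInv k Λ S K) : HasTop g S := by
  have : IsArtinianRing Λ := IsArtinianRing.of_finite k Λ
  have : IsArtinianRing Λᵐᵒᵖ := IsArtinianRing.of_finite k Λᵐᵒᵖ
  let : Module k S := Module.restrictScalars k Λ S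
  have : IsScalarTower k Λ S := IsScalarTower.restrictScalars k Λ S
  obtain ⟨E, ι, hι, hT⟩ := hT
  have := isSimpleModule_dualInto (Λ := Λ) (S := S) hι
  have := IsSimpleModule.nontrivial Λ K
  obtain ⟨h, hh, s, hs, hhs⟩ := exists_isPrim_generator (Λ := Λ) S
  obtain ⟨f, hf, hhf⟩ := exists_dualInto_generator hι hh.1 hs hhs
  obtain ⟨m, r, π, hm, hhr, hrm, _, _, hπ, hk⟩ := exists_of_isTranspose hL hh hf hhf hT
  have := projective_pim hm.1
  have := projective_pim hl.1
  obtain ⟨φ, hφ⟩ := ((hR.left l hl).isProjectiveCover (pimHom l c)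
    (pimHom_surjective hlc (span_eq_top_of_ne_zero hc))).exists_equiv
    ((hR.left m hm).isProjectiveCover π hπ)
  let r' : pim m := ⟨r, (mem_pim hm.1).2 hrm⟩
  have hr' : φ r' ∈ LinearMap.ker (pimHom l c) := by
    rw [LinearMap.mem_ker, hφ, hk]
    exact ⟨1, (one_mul r).symm⟩
  have hhL : HasTop h (LinearMap.ker (pimHom l c)) := by
    refine ⟨⟨φ r', hr'⟩, Subtype.ext ?_, eq_top_iff.2 ?_⟩
    · change h • φ r' = φ r'
      rw [← map_smul]
      exact congrArg φ (Subtype.ext hhr)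
    · rintro ⟨y, hy⟩ _
      obtain ⟨x, rfl⟩ := φ.surjective y
      rw [LinearMap.mem_ker, hφ, hk] at hy
      obtain ⟨t, ht⟩ := hy
      refine Submodule.mem_span_singleton.2 ⟨t, Subtype.ext ?_⟩
      change t • φ r' = φ x
      rw [← map_smul]
      exact congrArg φ (Subtype.ext ht.symm)
  exact HasTop.trans hR hh hg hhL hgL (hasTop_of_ne_zero hs hhs)

/-- Write `T` as `Λm/Λr`, let `z` generate the maximal submodule `L` of `Λm`, and put `r = y * z`.
If `y` lies in `rΛ`, then `r = r * (t * z)`: right multiplication by `t * z` fixes `r`, so it is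
invertible, yet its image lies in `L`. Otherwise `y` generates `hΛ`, can be cancelled, and `z` is a
multiple of `r`. -/
theorem isSimpleModule_of_isTauInv (hR : IsSerial Λ)
    (hL : ∀ e : Λᵐᵒᵖ, IsPrim e → IsUniserial Λᵐᵒᵖ (pim e)) {S T : Type u} [AddCommGroup S]
    [Module Λ S] [IsSimpleModule Λ S] [AddCommGroup T] [Module Λ T] [Nontrivial T]
    (hT : IsTauInv k Λ S T) : IsSimpleModule Λ T := by
  have : IsArtinianRing Λ := IsArtinianRing.of_finite k Λ
  have : IsArtinianRing Λᵐᵒᵖ := IsArtinianRing.of_finite k Λᵐᵒᵖ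
  let : Module k S := Module.restrictScalars k Λ S
  have : IsScalarTower k Λ S := IsScalarTower.restrictScalars k Λ S
  obtain ⟨E, ι, hι, hT⟩ := hT
  have := isSimpleModule_dualInto (Λ := Λ) (S := S) hι
  obtain ⟨h, hh, s, hs, hhs⟩ := exists_isPrim_generator (Λ := Λ) S
  obtain ⟨f, hf, hhf⟩ := exists_dualInto_generator hι hh.1 hs hhs
  obtain ⟨m, r, π, hm, hhr, hrm, hr0, hfr, hπ, hk⟩ := exists_of_isTranspose hL hh hf hhf hT
  have hmu := hR.left m hm
  have := finite_pim m
  have hTu := hmu.of_surjective π hπ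
  have : Module.Finite Λ T := Module.Finite.of_surjective π hπ
  obtain ⟨Q, hQ⟩ := IsCoatomic.exists_coatom (Submodule Λ T)
  have hQs : IsSimpleModule Λ (T ⧸ Q) := isSimpleModule_iff_isCoatom.2 hQ
  suffices Q = ⊥ from IsSimpleModule.congr (Submodule.quotEquivOfEqBot Q this).symm
  let r' : pim m := ⟨r, (mem_pim hm.1).2 hrm⟩
  set L := Q.comap π with hLdef
  have hLtop : L ≠ ⊤ := fun h => hQ.1 (by
    rw [eq_top_iff]
    intro x _
    obtain ⟨y, rfl⟩ := hπ x
    exact (h ▸ Submodule.mem_top : y ∈ L))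
  have hr'L : r' ∈ L := by
    have : π r' = 0 := (hk r').2 ⟨1, (one_mul r).symm⟩
    rw [hLdef, Submodule.mem_comap, this]
    exact Q.zero_mem
  have hr'0 : r' ≠ 0 := fun h => hr0 (congrArg Subtype.val h)
  obtain ⟨g, hg, ⟨z, hzL⟩, hgz, hz⟩ := hmu.exists_generator L.subtype ⟨⟨r', hr'L⟩, hr'0⟩
  rw [Submodule.range_subtype] at hz
  change L = Submodule.span Λ {z} at hz
  have hgz' : g * z.1 = z.1 := congrArg (fun w => w.1.1) hgz
  suffices hzr : ∃ t, z.1 = t * r by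
    rw [eq_bot_iff]
    intro x hx
    obtain ⟨y, rfl⟩ := hπ x
    have hy : y ∈ Submodule.span Λ {z} := hz ▸ hx
    obtain ⟨a, rfl⟩ := Submodule.mem_span_singleton.1 hy
    rw [Submodule.mem_bot, map_smul, (hk z).2 hzr, smul_zero]
  obtain ⟨y, hhy, hyg, hryz⟩ : ∃ y, h * y = y ∧ y * g = y ∧ r = y * z.1 := by
    have hr'z : r' ∈ Submodule.span Λ {z} := hz ▸ hr'L
    obtain ⟨y, hy⟩ := Submodule.mem_span_singleton.1 hr'z
    have hy' : y * z.1 = r := congrArg Subtype.val hy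
    refine ⟨h * y * g, by simp only [← mul_assoc, hh.1.eq], by rw [mul_assoc, hg.1], ?_⟩
    rw [mul_assoc, hgz', mul_assoc, hy', hhr]
  have hrf : op r • f = 0 := (hfr r hhr).2 ⟨1, (mul_one r).symm⟩
  by_cases hyf : op y • f = 0
  · exfalso
    obtain ⟨t, ht⟩ := (hfr y hhy).1 hyf
    let H : pim m →ₗ[Λ] pim m := pimHom m (t • z)
    have hHr : H r' = r' := by
      apply Subtype.ext
      change r * (t * z.1) = r
      rw [← mul_assoc, ← ht, ← hryz]
    have : Nontrivial (Submodule.span Λ {r'}) := by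
      rwa [Submodule.nontrivial_iff_ne_bot, Ne, Submodule.span_singleton_eq_bot]
    have hinj : Function.Injective H := hmu.injective_of_comp_injective
      (Submodule.span Λ {r'}).subtype H (by
        rw [injective_iff_map_eq_zero]
        rintro ⟨_, hy⟩ h0
        obtain ⟨a, rfl⟩ := Submodule.mem_span_singleton.1 hy
        have h1 : H (a • r') = 0 := h0
        rw [map_smul, hHr] at h1
        exact Subtype.ext h1)
    apply hLtop
    rw [eq_top_iff]
    intro x _
    obtain ⟨x', rfl⟩ := (injective_endo_bijective H hinj).2 x
    exact L.smul_mem _ (L.smul_mem _ hzL)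
  · obtain ⟨w, hw⟩ := Submodule.mem_span_singleton.1
      (span_eq_top_of_ne_zero (R := Λᵐᵒᵖ) hyf ▸ Submodule.mem_top :
        f ∈ Submodule.span Λᵐᵒᵖ {op y • f})
    have hfw : op (h - y * w.unop) • f = 0 := by
      rw [op_sub, sub_smul, hhf, op_mul, op_unop, mul_smul, hw, sub_self]
    obtain ⟨t, ht⟩ := (hfr (h - y * w.unop) (by
      rw [mul_sub, hh.1, ← mul_assoc, hhy])).1 hfw
    have hhw : ∃ w', h = y * w' := by
      rcases hR.right h hh r y hhr hhy with ⟨a, ha⟩ | ⟨a, ha⟩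
      · refine ⟨w.unop + a * t, ?_⟩
        rw [mul_add, ← mul_assoc, ← ha, ← ht]
        abel
      · exact absurd (by rw [ha, op_mul, mul_smul, hrf, smul_zero]) hyf
    obtain ⟨w', hw'⟩ := hhw
    have hy0 : y ≠ 0 := fun h0 => hyf (by rw [h0, op_zero, zero_smul])
    have hyw : y * (g * w' * y) = y := by
      rw [mul_assoc g, ← mul_assoc y, hyg, ← mul_assoc, ← hw', hhy]
    have hidem : IsIdempotentElem (g * w' * y) := by
      change g * w' * y * (g * w' * y) = _
      rw [mul_assoc (g * w'), hyw]
    rcases hg.2.2 _ hidem (by simp only [← mul_assoc, hg.1.eq]) (by rw [mul_assoc, hyg])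
      with h0 | h0
    · exact absurd (by rw [← hyw, h0, mul_zero]) hy0
    · exact ⟨g * w', by rw [hryz, ← mul_assoc, h0, hgz']⟩

/-- A generator `z` of the radical of the cover of `K` annihilates all simple modules, so it kills a
generator of `D S`. Hence `z` can serve as the connecting map in `isTranspose_of_radical`. -/
theorem isTauInv_of_hasTop (hR : IsSerial Λ)
    (hL : ∀ e : Λᵐᵒᵖ, IsPrim e → IsUniserial Λᵐᵒᵖ (pim e)) {S K : Type u} [AddCommGroup S]
    [Module Λ S] [IsSimpleModule Λ S] [AddCommGroup K] [Module Λ K] [IsSimpleModule Λ K]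
    {g l : Λ} (hg : IsPrim g) (hl : IsPrim l) {c : K} (hc : c ≠ 0) (hlc : l • c = c)
    [Nontrivial (LinearMap.ker (pimHom l c))] (hgL : HasTop g (LinearMap.ker (pimHom l c)))
    (hgS : HasTop g S) : IsTauInv k Λ S K := by
  have : IsArtinianRing Λᵐᵒᵖ := IsArtinianRing.of_finite k Λᵐᵒᵖ
  let : Module k S := Module.restrictScalars k Λ S
  have : IsScalarTower k Λ S := IsScalarTower.restrictScalars k Λ S
  obtain ⟨E, ι, hι⟩ := exists_isInjectiveHull (k := k) (k ⧸ Ring.jacobson k)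
  have := isSimpleModule_dualInto (Λ := Λ) (S := S) hι
  have := IsSimpleModule.nontrivial Λ S
  obtain ⟨s, hs, hgs⟩ := hgS.exists_ne_zero
  obtain ⟨f, hf, hgf⟩ := exists_dualInto_generator hι hg.1 hs hgs
  obtain ⟨z, hz, hzs⟩ := hgL
  have hz0 : z.1.1 ≠ 0 := fun h0 => by
    have : z = 0 := Subtype.ext (Subtype.ext h0)
    rw [this, Submodule.span_zero_singleton] at hzs
    exact bot_ne_top hzs
  have hzl : z.1.1 * l = z.1.1 := (mem_pim hl.1).1 z.1.2
  have hzc : z.1.1 • c = 0 := z.2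
  refine ⟨E, ι, hι, isTranspose_of_radical hR hL hg hl hf hgf hc hlc
    (congrArg (fun w => w.1.1) hz) hzl hz0 (fun y hy => ⟨fun hyc => ?_, ?_⟩) ?_⟩
  · obtain ⟨t, ht⟩ := Submodule.mem_span_singleton.1 (hzs ▸ Submodule.mem_top :
      (⟨⟨y, (mem_pim hl.1).2 hy⟩, hyc⟩ : LinearMap.ker (pimHom l c)) ∈ Submodule.span Λ {z})
    exact ⟨t, (congrArg (fun w => w.1.1) ht).symm⟩
  · rintro ⟨t, rfl⟩
    rw [mul_smul, hzc, smul_zero]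
  · refine LinearMap.ext fun x => ?_
    change (show S →ₗ[k] E from f) (z.1.1 • x) = 0
    rw [smul_eq_zero_of_mem_radical hR hl hc hlc hzl hzc, map_zero]

end Translate

/-! ### Additive closures, tops and socles -/

section Add

variable {Λ : Type u} [Ring Λ] {𝒳 : ModuleCat.{u} Λ → Prop}

theorem InAdd.of_retract {M N : Type u} [AddCommGroup M] [Module Λ M] [AddCommGroup N]
    [Module Λ N] (h : InAdd 𝒳 M) (i : N →ₗ[Λ] M) (r : M →ₗ[Λ] N)
    (hri : r ∘ₗ i = LinearMap.id) : InAdd 𝒳 N := by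
  obtain ⟨n, Y, hY, i', r', h'⟩ := h
  refine ⟨n, Y, hY, i' ∘ₗ i, r ∘ₗ r', ?_⟩
  rw [LinearMap.comp_assoc, ← LinearMap.comp_assoc i, h', LinearMap.id_comp, hri]

theorem InAdd.of_equiv {M N : Type u} [AddCommGroup M] [Module Λ M] [AddCommGroup N]
    [Module Λ N] (h : InAdd 𝒳 M) (ε : N ≃ₗ[Λ] M) : InAdd 𝒳 N :=
  h.of_retract ε.toLinearMap ε.symm.toLinearMap (by ext; simp)

theorem InAdd.of_mem {M : ModuleCat.{u} Λ} (h : 𝒳 M) : InAdd 𝒳 M :=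
  ⟨1, fun _ => M, fun _ => h, LinearMap.pi fun _ => LinearMap.id, LinearMap.proj 0, rfl⟩

theorem inAdd_pi_of_forall {ι : Type*} [Fintype ι] (Z : ι → ModuleCat.{u} Λ) (hZ : ∀ i, 𝒳 (Z i))
    {M : Type u} [AddCommGroup M] [Module Λ M] (i : M →ₗ[Λ] ∀ j, Z j) (r : (∀ j, Z j) →ₗ[Λ] M)
    (hri : r ∘ₗ i = LinearMap.id) : InAdd 𝒳 M := by
  let e := (Fintype.equivFin ι).symm
  let ε := LinearEquiv.piCongrLeft Λ (fun j => Z j) e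
  refine ⟨Fintype.card ι, fun j => Z (e j), fun j => hZ _, ε.symm.toLinearMap ∘ₗ i,
    r ∘ₗ ε.toLinearMap, ?_⟩
  ext x
  simpa using LinearMap.congr_fun hri x

theorem InAdd.pi {n : ℕ} {Y : Fin n → ModuleCat.{u} Λ} (h : ∀ j, InAdd 𝒳 (Y j)) :
    InAdd 𝒳 (∀ j, Y j) := by
  choose m Z hZ i r hri using h
  refine inAdd_pi_of_forall (fun a : (Σ j, Fin (m j)) => Z a.1 a.2) (fun a => hZ a.1 a.2)
    (LinearMap.pi fun a => LinearMap.proj a.2 ∘ₗ i a.1 ∘ₗ LinearMap.proj a.1)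
    (LinearMap.pi fun j => r j ∘ₗ LinearMap.pi fun b =>
      LinearMap.proj (⟨j, b⟩ : Σ j, Fin (m j))) ?_
  exact LinearMap.ext fun x => funext fun j => LinearMap.congr_fun (hri j) (x j)

theorem exists_comp_single_ne_zero {n : ℕ} {Y : Fin n → ModuleCat.{u} Λ} {S : Type*}
    [AddCommGroup S] [Module Λ S] (q : (∀ j, Y j) →ₗ[Λ] S) (hq : q ≠ 0) :
    ∃ j, q ∘ₗ LinearMap.single Λ (fun j => Y j) j ≠ 0 := by
  by_contra h
  push Not at h
  exact hq (LinearMap.pi_ext' h)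

theorem exists_proj_comp_ne_zero {n : ℕ} {Y : Fin n → ModuleCat.{u} Λ} {S : Type*}
    [AddCommGroup S] [Module Λ S] (i : S →ₗ[Λ] ∀ j, Y j) (hi : i ≠ 0) :
    ∃ j, LinearMap.proj j ∘ₗ i ≠ 0 := by
  by_contra h
  push Not at h
  exact hi (LinearMap.ext fun x => funext fun j => LinearMap.congr_fun (h j) x)

theorem ne_zero_of_surjective {V S : Type*} [AddCommGroup V] [Module Λ V]
    [AddCommGroup S] [Module Λ S] [Nontrivial S] (q : V →ₗ[Λ] S) (hq : Function.Surjective q) :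
    q ≠ 0 := by
  rintro rfl
  obtain ⟨s, hs⟩ := exists_ne (0 : S)
  obtain ⟨x, rfl⟩ := hq s
  exact hs rfl

theorem ne_zero_of_injective {V S : Type*} [AddCommGroup V] [Module Λ V]
    [AddCommGroup S] [Module Λ S] [Nontrivial S] (q : S →ₗ[Λ] V) (hq : Function.Injective q) :
    q ≠ 0 := by
  rintro rfl
  obtain ⟨s, hs⟩ := exists_ne (0 : S)
  exact hs (hq rfl)

theorem inAdd_of_simple_submodules {V : Type u} [AddCommGroup V] [Module Λ V]
    [IsSemisimpleModule Λ V] [Module.Finite Λ V]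
    (h : ∀ S : Submodule Λ V, IsSimpleModule Λ S → 𝒳 (ModuleCat.of Λ S)) : InAdd 𝒳 V := by
  obtain ⟨n, S, ε, hS⟩ := IsSemisimpleModule.exists_linearEquiv_fin_dfinsupp Λ V
  let ε' := ε ≪≫ₗ DFinsupp.linearEquivFunOnFintype
  exact ⟨n, fun j => ModuleCat.of Λ (S j), fun j => h _ (hS j), ε'.toLinearMap,
    ε'.symm.toLinearMap, by ext x; exact ε'.symm_apply_apply x⟩

/-- Some summand `Y j` maps non-trivially to `S`; it is then simple and isomorphic to `S`.
Simplicity is asked only of nonzero members of `𝒳`, because `τ⁻ S` may vanish. -/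
theorem InAdd.of_simple_quotient
    (h𝒳 : ∀ S S' : ModuleCat.{u} Λ, Nonempty (S ≃ₗ[Λ] S') → 𝒳 S → 𝒳 S')
    (hs : ∀ S, 𝒳 S → Nontrivial S → IsSimpleModule Λ S) {V : Type u} [AddCommGroup V]
    [Module Λ V] (h : InAdd 𝒳 V) (S : ModuleCat.{u} Λ) [IsSimpleModule Λ S] (q : V →ₗ[Λ] S)
    (hq : Function.Surjective q) : 𝒳 S := by
  obtain ⟨n, Y, hY, i, r, hri⟩ := h
  have := IsSimpleModule.nontrivial Λ S
  have hr : Function.Surjective (q ∘ₗ r) := hq.comp fun x => ⟨i x, LinearMap.congr_fun hri x⟩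
  obtain ⟨j, hj⟩ := exists_comp_single_ne_zero _ (ne_zero_of_surjective _ hr)
  have := hs _ (hY j) (LinearMap.surjective_of_ne_zero hj).nontrivial
  exact h𝒳 _ _ ⟨LinearEquiv.ofBijective _ (LinearMap.bijective_of_ne_zero hj)⟩ (hY j)

theorem InAdd.of_simple_submodule
    (h𝒳 : ∀ S S' : ModuleCat.{u} Λ, Nonempty (S ≃ₗ[Λ] S') → 𝒳 S → 𝒳 S')
    (hs : ∀ S, 𝒳 S → Nontrivial S → IsSimpleModule Λ S) {V : Type u} [AddCommGroup V]
    [Module Λ V] (h : InAdd 𝒳 V) (S : ModuleCat.{u} Λ) [IsSimpleModule Λ S] (j : S →ₗ[Λ] V)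
    (hj : Function.Injective j) : 𝒳 S := by
  obtain ⟨n, Y, hY, i, r, hri⟩ := h
  have := IsSimpleModule.nontrivial Λ S
  have hii : Function.Injective i :=
    Function.LeftInverse.injective (g := r) fun x => LinearMap.congr_fun hri x
  have hi : Function.Injective (i ∘ₗ j) := hii.comp hj
  obtain ⟨a, ha⟩ := exists_proj_comp_ne_zero _ (ne_zero_of_injective _ hi)
  have := hs _ (hY a) (LinearMap.injective_of_ne_zero ha).nontrivial
  exact h𝒳 _ _ ⟨(LinearEquiv.ofBijective _ (LinearMap.bijective_of_ne_zero ha)).symm⟩ (hY a)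

/-- Maps to simple modules factor through the semisimple top, and simple submodules of the top are
also quotients of it. Testing with maps to simple modules behaves well under direct sums. -/
theorem inAdd_top_iff (h𝒳 : ∀ S S' : ModuleCat.{u} Λ, Nonempty (S ≃ₗ[Λ] S') → 𝒳 S → 𝒳 S')
    (hs : ∀ S, 𝒳 S → Nontrivial S → IsSimpleModule Λ S) (M : Type u) [AddCommGroup M]
    [Module Λ M] [IsNoetherian Λ M] [IsArtinian Λ M] :
    InAdd 𝒳 (Top Λ M) ↔ ∀ S : ModuleCat.{u} Λ, IsSimpleModule Λ S →
      ∀ q : M →ₗ[Λ] S, Function.Surjective q → 𝒳 S := by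
  constructor
  · intro h S _ q hq
    exact h.of_simple_quotient h𝒳 hs S ((Module.jacobson Λ M).liftQ q
      (IsSemisimpleModule.jacobson_le_ker _ _ _ _ q)) fun x => by
        obtain ⟨y, rfl⟩ := hq x
        exact ⟨(Module.jacobson Λ M).mkQ y, Submodule.liftQ_apply _ _ _⟩
  · intro h
    have : IsSemisimpleModule Λ (Top Λ M) :=
      (IsArtinian.isSemisimpleModule_iff_jacobson Λ (Top Λ M)).2 (Module.jacobson_quotient_jacobson Λ M)
    refine inAdd_of_simple_submodules fun S hS => ?_
    obtain ⟨C, hC⟩ := exists_isCompl S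
    exact h (ModuleCat.of Λ S) hS (S.projectionOnto C hC ∘ₗ (Module.jacobson Λ M).mkQ)
      ((Submodule.projectionOnto_surjective hC).comp (Submodule.mkQ_surjective _))

theorem inAdd_socle_iff (h𝒳 : ∀ S S' : ModuleCat.{u} Λ, Nonempty (S ≃ₗ[Λ] S') → 𝒳 S → 𝒳 S')
    (hs : ∀ S, 𝒳 S → Nontrivial S → IsSimpleModule Λ S) (M : Type u) [AddCommGroup M]
    [Module Λ M] [IsNoetherian Λ M] :
    InAdd 𝒳 (socle Λ M) ↔ ∀ S : ModuleCat.{u} Λ, IsSimpleModule Λ S →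
      ∀ j : S →ₗ[Λ] M, Function.Injective j → 𝒳 S := by
  constructor
  · intro h S _ j hj
    have : IsSimpleModule Λ (LinearMap.range j) :=
      IsSimpleModule.congr (LinearEquiv.ofInjective j hj).symm
    have hle : LinearMap.range j ≤ socle Λ M := le_sSup this
    exact h.of_simple_submodule h𝒳 hs S (j.codRestrict _ fun x => hle ⟨x, rfl⟩)
      fun x y hxy => hj (congrArg Subtype.val hxy)
  · intro h
    have : IsSemisimpleModule Λ (socle Λ M) := by
      rw [socle, sSup_eq_iSup]
      exact isSemisimpleModule_biSup_of_isSemisimpleModule_submodule fun i hi =>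
        have : IsSimpleModule Λ i := hi
        inferInstance
    exact inAdd_of_simple_submodules fun S hS => h (ModuleCat.of Λ S) hS
      ((socle Λ M).subtype ∘ₗ S.subtype)
      ((Submodule.injective_subtype _).comp (Submodule.injective_subtype _))

end Add

end NakayamaCore

namespace NakayamaCore

/-! ### Local modules and invariance under isomorphism -/

section Local

variable {Λ : Type u} [Ring Λ]

theorem IsUniserial.le_of_isCoatom {A : Type*} [AddCommGroup A] [Module Λ A]
    (h : IsUniserial Λ A) {Q N : Submodule Λ A} (hQ : IsCoatom Q) (hN : N ≠ ⊤) : N ≤ Q :=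
  (h N Q).elim id fun hle => ((hQ.le_iff.1 hle).resolve_left hN).le

theorem exists_simple_quotient (A : Type u) [AddCommGroup A] [Module Λ A] [Module.Finite Λ A]
    [Nontrivial A] : ∃ S : ModuleCat.{u} Λ, IsSimpleModule Λ S ∧
      ∃ q : A →ₗ[Λ] S, Function.Surjective q := by
  obtain ⟨Q, hQ⟩ := IsCoatomic.exists_coatom (Submodule Λ A)
  exact ⟨ModuleCat.of Λ (A ⧸ Q), isSimpleModule_iff_isCoatom.2 hQ, Q.mkQ, Q.mkQ_surjective⟩

theorem IsIndecomposable.nonempty_linearEquiv {A B : Type*} [AddCommGroup A] [Module Λ A]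
    [AddCommGroup B] [Module Λ B] [Nontrivial A] (hB : IsIndecomposable Λ B) (i : A →ₗ[Λ] B)
    (r : B →ₗ[Λ] A) (hri : Function.Bijective (r ∘ₗ i)) : Nonempty (A ≃ₗ[Λ] B) := by
  have hi : Function.Injective i := Function.Injective.of_comp hri.1
  have hc : IsCompl (LinearMap.range i) (LinearMap.ker r) := by
    constructor
    · rw [Submodule.disjoint_def]
      rintro _ ⟨x, rfl⟩ hx
      rw [hri.1 (hx.trans (map_zero (r ∘ₗ i)).symm), map_zero]
    · rw [codisjoint_iff, eq_top_iff]
      intro b _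
      obtain ⟨a, ha⟩ := hri.2 (r b)
      refine Submodule.mem_sup.2 ⟨i a, ⟨a, rfl⟩, b - i a, ?_, add_sub_cancel _ _⟩
      rw [LinearMap.mem_ker, map_sub, ← ha, LinearMap.comp_apply, sub_self]
  have hk := (hB.2 _ _ hc).resolve_left fun h => by
    obtain ⟨x, hx⟩ := exists_ne (0 : A)
    exact hx (hi (by rw [map_zero]; exact (Submodule.mem_bot Λ).1 (h ▸ ⟨x, rfl⟩)))
  exact ⟨LinearEquiv.ofBijective i ⟨hi, fun b => by
    obtain ⟨a, ha⟩ := hri.2 (r b)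
    exact ⟨a, LinearMap.ker_eq_bot.1 hk ha⟩⟩⟩

theorem IsStableGP.of_equiv {N N' : Type u} [AddCommGroup N] [Module Λ N]
    [AddCommGroup N'] [Module Λ N'] (h : IsStableGP (Λ := Λ) N) (ε : N ≃ₗ[Λ] N') :
    IsStableGP (Λ := Λ) N' := by
  obtain ⟨hn, ⟨e, he, ht⟩, hp, C, n, i, r, hri⟩ := h
  refine ⟨ε.symm.toEquiv.nontrivial, ⟨e, he, ht.of_surjective ε.toLinearMap ε.surjective⟩,
    fun _ => hp (Module.Projective.of_equiv ε.symm), C, n, i ∘ₗ ε.symm.toLinearMap,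
    ε.toLinearMap ∘ₗ r, LinearMap.ext fun x => ?_⟩
  have := LinearMap.congr_fun hri (ε.symm x)
  change ε (r (i (ε.symm x))) = x
  change r (i (ε.symm x)) = ε.symm x at this
  rw [this, ε.apply_symm_apply]

theorem IsCoreIdem.of_hasTop (hR : IsSerial Λ) {e f : Λ} (he : IsCoreIdem e) (hf : IsPrim f)
    {A : Type*} [AddCommGroup A] [Module Λ A] [Nontrivial A] (h₁ : HasTop e A)
    (h₂ : HasTop f A) : IsCoreIdem f := by
  obtain ⟨he, N, hN, ht⟩ := he
  exact ⟨hf, N, hN, HasTop.trans hR he hf h₁ h₂ ht⟩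

theorem ClassX.of_equiv {S S' : ModuleCat.{u} Λ} (h : ClassX Λ S) (ε : S ≃ₗ[Λ] S') :
    ClassX Λ S' := by
  obtain ⟨hs, P, π, hπ, hP⟩ := h
  refine ⟨IsSimpleModule.congr ε.symm, P, ε.toLinearMap ∘ₗ π,
    ⟨hπ.projective, ε.surjective.comp hπ.surjective, ?_⟩, hP⟩
  rw [LinearEquiv.ker_comp]
  exact hπ.superfluous

theorem TauInvClass.of_equiv (k : Type v) [CommRing k] [Algebra k Λ] {𝒳 : ModuleCat.{u} Λ → Prop} {T T' : ModuleCat.{u} Λ}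
    (h : TauInvClass k Λ 𝒳 T) (ε : T ≃ₗ[Λ] T') : TauInvClass k Λ 𝒳 T' := by
  obtain ⟨S, hS, E, ι, hι, P₁, P₀, f, p, hfp, ⟨φ⟩⟩ := h
  exact ⟨S, hS, E, ι, hι, P₁, P₀, f, p, hfp, ⟨ε.symm ≪≫ₗ φ⟩⟩

/-- This is where the absence of simple projectives enters: otherwise the radical of a cover could
vanish and have no top. -/
theorem nontrivial_ker_pimHom (hNo : NoSimpleProjective Λ) (S : Type u) [AddCommGroup S]
    [Module Λ S] [IsSimpleModule Λ S] {l : Λ} (hl : IsPrim l) {c : S} (hc : c ≠ 0)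
    (hlc : l • c = c) : Nontrivial (LinearMap.ker (pimHom l c)) := by
  have := projective_pim hl.1
  exact Submodule.nontrivial_iff_ne_bot.2 (ker_ne_bot_of_not_projective (hNo S ‹_›) _
    (pimHom_surjective hlc (span_eq_top_of_ne_zero hc)))

end Local

/-! ### The core criterion for local modules -/

section Core

variable {Λ : Type u} [Ring Λ] [IsArtinianRing Λ]

theorem IsCoreIdem.inCore (hR : IsSerial Λ) {e : Λ} (he : IsCoreIdem e) : InCore Λ (pim e) := by
  obtain ⟨he, N, hN, ht⟩ := he
  obtain ⟨p, hp⟩ := ht.exists_surjective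
  have := hN.nontrivial
  have := projective_pim he.1
  exact InAdd.of_mem (M := ModuleCat.of Λ (pim e))
    (Or.inr ⟨N, p, hN.isIndecNonprojGP hR, (hR.left e he).isProjectiveCover p hp⟩)

/-- The identity of `Y` is a sum of endomorphisms through the `Z j`. If none were onto, all images
would lie in the unique maximal submodule; so one is bijective and `Y` is isomorphic to an
indecomposable `Z j`. -/
theorem isStableGP_or_of_inCore (hR : IsSerial Λ) {Y : Type u} [AddCommGroup Y] [Module Λ Y]
    [Nontrivial Y] {e : Λ} (he : IsPrim e) (ht : HasTop e Y) (h : InCore Λ Y) :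
    IsStableGP (Λ := Λ) Y ∨ ∃ e' : Λ, IsCoreIdem e' ∧ Nonempty (pim e' ≃ₗ[Λ] Y) := by
  have := ht.finite
  have hu := hR.isUniserial he ht
  obtain ⟨n, Z, hZ, i, r, hri⟩ := h
  obtain ⟨j, hj⟩ : ∃ j, Function.Surjective
      ((r ∘ₗ LinearMap.single Λ (fun j => Z j) j) ∘ₗ (LinearMap.proj j ∘ₗ i)) := by
    by_contra hne
    push Not at hne
    obtain ⟨Q, hQ⟩ := IsCoatomic.exists_coatom (Submodule Λ Y)
    refine hQ.1 (eq_top_iff.2 fun y _ => ?_)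
    have hy : r (i y) = y := LinearMap.congr_fun hri y
    rw [← hy, ← LinearMap.sum_single_apply (fun j => Z j) (i y), map_sum]
    exact Submodule.sum_mem _ fun j _ => hu.le_of_isCoatom hQ
      (fun h => hne j (LinearMap.range_eq_top.1 h)) ⟨y, rfl⟩
  have hb := IsNoetherian.bijective_of_surjective_endomorphism _ hj
  rcases hZ j with hG | ⟨N, π, hG, hπ⟩
  · obtain ⟨ε⟩ := hG.2.1.nonempty_linearEquiv _ _ hb
    exact Or.inl ((hG.isStableGP hR).of_equiv ε.symm)
  · right
    have hN := hG.isStableGP hR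
    obtain ⟨e', he', ht'⟩ := hN.top
    obtain ⟨p, hp⟩ := ht'.exists_surjective
    have := hN.nontrivial
    have := projective_pim he'.1
    obtain ⟨φ, -⟩ := hπ.exists_equiv ((hR.left e' he').isProjectiveCover p hp)
    have hb' : Function.Bijective ((r ∘ₗ LinearMap.single Λ (fun j => Z j) j ∘ₗ
        φ.toLinearMap) ∘ₗ (φ.symm.toLinearMap ∘ₗ LinearMap.proj j ∘ₗ i)) := by
      convert hb using 2
      refine LinearMap.ext fun y => ?_
      simp
    obtain ⟨ε⟩ := he'.isIndecomposable.nonempty_linearEquiv _ _ hb'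
    exact ⟨e', ⟨he', N, hN, ht'⟩, ⟨ε.symm⟩⟩

theorem inCore_iff_of_projective (hR : IsSerial Λ) {Y : Type u} [AddCommGroup Y] [Module Λ Y]
    [Nontrivial Y] [Module.Projective Λ Y] {e : Λ} (he : IsPrim e) (p : pim e →ₗ[Λ] Y)
    (hp : Function.Surjective p) : InCore Λ Y ↔ IsCoreIdem e := by
  have ht : HasTop e Y := (hasTop_pim he.1).of_surjective p hp
  constructor
  · intro h
    rcases isStableGP_or_of_inCore hR he ht h with h | ⟨e', he', ⟨ε⟩⟩
    · exact absurd ‹_› h.not_projective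
    · exact he'.of_hasTop hR he
        ((hasTop_pim he'.1.1).of_surjective ε.toLinearMap ε.surjective) ht
  · intro h
    have hi := (hR.left e he).injective_of_projective p hp LinearMap.id Function.injective_id
    exact InAdd.of_equiv (h.inCore hR) (LinearEquiv.ofBijective p ⟨hi, hp⟩).symm

/-- A non-projective member of the core is Gorenstein projective and so is its syzygy, whence both
idempotents are core. Conversely `IsCoreQuot` provides a complete resolution. -/
theorem inCore_iff_of_not_projective (hR : IsSerial Λ) {Y : Type u} [AddCommGroup Y]
    [Module Λ Y] [Nontrivial Y] (hY : ¬ Module.Projective Λ Y) {e g : Λ} (he : IsPrim e)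
    (p : pim e →ₗ[Λ] Y) (hp : Function.Surjective p) (hg : IsPrim g)
    (htg : HasTop g (LinearMap.ker p)) : InCore Λ Y ↔ IsCoreIdem e ∧ IsCoreIdem g := by
  have ht : HasTop e Y := (hasTop_pim he.1).of_surjective p hp
  constructor
  · intro h
    rcases isStableGP_or_of_inCore hR he ht h with h | ⟨e', he', ⟨ε⟩⟩
    · exact ⟨⟨he, ModuleCat.of Λ Y, h, ht⟩, hg, ModuleCat.of Λ (LinearMap.ker p),
        (h.ker hR he p hp).1, htg⟩
    · have := projective_pim he'.1.1
      exact absurd (Module.Projective.of_equiv ε) hY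
  · rintro ⟨h, h'⟩
    have hq : IsCoreQuot (Λ := Λ) (ModuleCat.of Λ Y) := ⟨‹_›, hY, e, h, p, hp, g, h', htg⟩
    exact InAdd.of_mem (M := ModuleCat.of Λ Y) (Or.inl (hq.isIndecNonprojGP hR))

theorem classX_iff (hR : IsSerial Λ) {S : ModuleCat.{u} Λ} [IsSimpleModule Λ S] {e : Λ}
    (he : IsPrim e) (ht : HasTop e S) : ClassX Λ S ↔ IsCoreIdem e := by
  obtain ⟨p, hp⟩ := ht.exists_surjective
  have := projective_pim he.1
  have := IsSimpleModule.nontrivial Λ S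
  have := he.nontrivial
  have hc := (hR.left e he).isProjectiveCover p hp
  rw [← inCore_iff_of_projective hR he LinearMap.id Function.surjective_id]
  constructor
  · rintro ⟨_, P, π, hπ, hP⟩
    obtain ⟨φ, -⟩ := hπ.exists_equiv hc
    exact InAdd.of_equiv hP φ
  · intro h
    exact ⟨‹_›, ModuleCat.of Λ (pim e), p, hc, h⟩

theorem forall_quotient_classX_iff (hR : IsSerial Λ) {Y : Type u} [AddCommGroup Y] [Module Λ Y]
    [Nontrivial Y] {e : Λ} (he : IsPrim e) (ht : HasTop e Y) :
    (∀ S : ModuleCat.{u} Λ, IsSimpleModule Λ S → ∀ q : Y →ₗ[Λ] S, Function.Surjective q →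
      ClassX Λ S) ↔ IsCoreIdem e := by
  have := ht.finite
  constructor
  · intro h
    obtain ⟨S, hS, q, hq⟩ := exists_simple_quotient (Λ := Λ) Y
    exact (classX_iff hR he (ht.of_surjective q hq)).1 (h S hS q hq)
  · intro h S _ q hq
    exact (classX_iff hR he (ht.of_surjective q hq)).2 h

theorem inCore_iff_quotient (hR : IsSerial Λ) {Y : Type u} [AddCommGroup Y] [Module Λ Y]
    [Nontrivial Y] {e : Λ} (he : IsPrim e) (p : pim e →ₗ[Λ] Y) (hp : Function.Surjective p) :
    InCore Λ Y ↔ IsCoreIdem e ∧ ∀ S : ModuleCat.{u} Λ, IsSimpleModule Λ S →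
      ∀ q : LinearMap.ker p →ₗ[Λ] S, Function.Surjective q → ClassX Λ S := by
  have := projective_pim he.1
  by_cases hY : Module.Projective Λ Y
  · have hi := (hR.left e he).injective_of_projective p hp LinearMap.id Function.injective_id
    rw [inCore_iff_of_projective hR he p hp]
    refine ⟨fun h => ⟨h, fun S _ q hq => ?_⟩, fun h => h.1⟩
    have := IsSimpleModule.nontrivial Λ S
    have := hq.nontrivial
    exact absurd (LinearMap.ker_eq_bot.2 hi) ((Submodule.nontrivial_iff_ne_bot).1 this)
  · have : Nontrivial (LinearMap.ker p) :=
      Submodule.nontrivial_iff_ne_bot.2 (ker_ne_bot_of_not_projective hY p hp)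
    have := finite_pim e
    obtain ⟨g, hg, htg⟩ := (hR.isUniserial_submodule he (LinearMap.ker p)).exists_hasTop
    rw [inCore_iff_of_not_projective hR hY he p hp hg htg, forall_quotient_classX_iff hR hg htg]

end Core

/-! ### The socle criterion for local modules -/

section Socle

variable (k : Type v) [CommRing k] [IsArtinianRing k] {Λ : Type u} [Ring Λ] [Algebra k Λ]
  [Module.Finite k Λ]

theorem tauInvClass_iff (hR : IsSerial Λ)
    (hL : ∀ e : Λᵐᵒᵖ, IsPrim e → IsUniserial Λᵐᵒᵖ (pim e)) {S : ModuleCat.{u} Λ}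
    [IsSimpleModule Λ S] {g l : Λ} (hg : IsPrim g) (hl : IsPrim l) {c : S} (hc : c ≠ 0)
    (hlc : l • c = c) [Nontrivial (LinearMap.ker (pimHom l c))]
    (hgL : HasTop g (LinearMap.ker (pimHom l c))) :
    TauInvClass k Λ (ClassX Λ) S ↔ IsCoreIdem g := by
  have : IsArtinianRing Λ := IsArtinianRing.of_finite k Λ
  constructor
  · rintro ⟨S', hX, hT⟩
    have := hX.1
    exact (classX_iff hR hg (hasTop_of_isTauInv k hR hL hg hl hc hlc hgL hT)).1 hX
  · intro h
    have := finite_pim g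
    have := hg.nontrivial
    obtain ⟨S', _, q, hq⟩ := exists_simple_quotient (Λ := Λ) (pim g)
    have ht := (hasTop_pim hg.1).of_surjective q hq
    exact ⟨S', (classX_iff hR hg ht).2 h, isTauInv_of_hasTop k hR hL hg hl hc hlc hgL ht⟩

/-- For non-projective `Y`, the radical of the cover of any simple submodule maps onto `ker p`, so
the socle condition is about the idempotent `g` of the syzygy. For projective `Y` with core `e`,
`IsCoreIdem.exists_hasTop_ker` makes it automatic. -/
theorem inCore_iff_submodule (hR : IsSerial Λ)
    (hL : ∀ e : Λᵐᵒᵖ, IsPrim e → IsUniserial Λᵐᵒᵖ (pim e)) (hNo : NoSimpleProjective Λ)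
    {Y : Type u} [AddCommGroup Y] [Module Λ Y]
    [Nontrivial Y] {e : Λ} (he : IsPrim e) (p : pim e →ₗ[Λ] Y) (hp : Function.Surjective p) :
    InCore Λ Y ↔ IsCoreIdem e ∧ ∀ S : ModuleCat.{u} Λ, IsSimpleModule Λ S →
      ∀ j : S →ₗ[Λ] Y, Function.Injective j → TauInvClass k Λ (ClassX Λ) S := by
  have : IsArtinianRing Λ := IsArtinianRing.of_finite k Λ
  have := projective_pim he.1
  by_cases hY : Module.Projective Λ Y
  · have hi := (hR.left e he).injective_of_projective p hp LinearMap.id Function.injective_id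
    rw [inCore_iff_of_projective hR he p hp]
    refine ⟨fun h => ⟨h, fun S _ j hj => ?_⟩, fun h => h.1⟩
    obtain ⟨l, hl, c, hc, hlc⟩ := exists_isPrim_generator (Λ := Λ) S
    have := nontrivial_ker_pimHom hNo S hl hc hlc
    let ε := LinearEquiv.ofBijective p ⟨hi, hp⟩
    obtain ⟨g, hg, htg⟩ := h.exists_hasTop_ker hR hl hc hlc (ε.symm.toLinearMap ∘ₗ j)
      (ε.symm.injective.comp hj)
    exact (tauInvClass_iff k hR hL hg.1 hl hc hlc htg).2 hg
  · have : Nontrivial (LinearMap.ker p) :=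
      Submodule.nontrivial_iff_ne_bot.2 (ker_ne_bot_of_not_projective hY p hp)
    have := finite_pim e
    obtain ⟨g, hg, htg⟩ := (hR.isUniserial_submodule he (LinearMap.ker p)).exists_hasTop
    have key (S : ModuleCat.{u} Λ) (_ : IsSimpleModule Λ S) (j : S →ₗ[Λ] Y)
        (hj : Function.Injective j) : TauInvClass k Λ (ClassX Λ) S ↔ IsCoreIdem g := by
      obtain ⟨l, hl, c, hc, hlc⟩ := exists_isPrim_generator (Λ := Λ) S
      have := nontrivial_ker_pimHom hNo S hl hc hlc
      obtain ⟨s, hs⟩ := exists_surjective_ker (hR.left e he) hl.1 p hp hc hlc j hj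
      exact tauInvClass_iff k hR hL hg hl hc hlc
        (HasTop.lift hg.1 (hR.isUniserial_submodule hl _) s hs htg)
    rw [inCore_iff_of_not_projective hR hY he p hp hg htg]
    refine and_congr_right fun _ => ⟨fun h S hS j hj => (key S hS j hj).2 h, fun h => ?_⟩
    have ht : HasTop e Y := (hasTop_pim he.1).of_surjective p hp
    have := ht.finite
    obtain ⟨K, hK, -⟩ := (hR.isUniserial he ht).exists_socle
    exact (key (ModuleCat.of Λ K) hK K.subtype K.injective_subtype).1
      (h (ModuleCat.of Λ K) hK K.subtype K.injective_subtype)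

end Socle

/-! ### Passing to direct sums -/

section Decomposition

variable {Λ : Type u} [Ring Λ] {n : ℕ} {Y : Fin n → ModuleCat.{u} Λ} {M : Type u}
  [AddCommGroup M] [Module Λ M]

theorem inAdd_iff_forall {𝒳 : ModuleCat.{u} Λ → Prop} (ε : M ≃ₗ[Λ] ∀ j, Y j) :
    InAdd 𝒳 M ↔ ∀ j, InAdd 𝒳 (Y j) := by
  refine ⟨fun h j => h.of_retract (ε.symm.toLinearMap ∘ₗ LinearMap.single Λ (fun j => Y j) j)
    (LinearMap.proj j ∘ₗ ε.toLinearMap) (LinearMap.ext fun x => by simp), fun h =>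
    (InAdd.pi h).of_equiv ε⟩

theorem forall_quotient_iff {𝒳 : ModuleCat.{u} Λ → Prop} (ε : M ≃ₗ[Λ] ∀ j, Y j) :
    (∀ S : ModuleCat.{u} Λ, IsSimpleModule Λ S → ∀ q : M →ₗ[Λ] S, Function.Surjective q → 𝒳 S) ↔
    ∀ j, ∀ S : ModuleCat.{u} Λ, IsSimpleModule Λ S → ∀ q : Y j →ₗ[Λ] S,
      Function.Surjective q → 𝒳 S := by
  refine ⟨fun h j S hS q hq => h S hS (q ∘ₗ LinearMap.proj j ∘ₗ ε.toLinearMap)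
    (hq.comp ((Function.surjective_eval j).comp ε.surjective)), fun h S hS q hq => ?_⟩
  have := IsSimpleModule.nontrivial Λ S
  obtain ⟨j, hj⟩ := exists_comp_single_ne_zero (Y := Y) (q ∘ₗ ε.symm.toLinearMap)
    (ne_zero_of_surjective _ (hq.comp ε.symm.surjective))
  exact h j S hS _ (LinearMap.surjective_of_ne_zero hj)

theorem forall_submodule_iff {𝒳 : ModuleCat.{u} Λ → Prop} (ε : M ≃ₗ[Λ] ∀ j, Y j) :
    (∀ S : ModuleCat.{u} Λ, IsSimpleModule Λ S → ∀ i : S →ₗ[Λ] M, Function.Injective i → 𝒳 S) ↔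
    ∀ j, ∀ S : ModuleCat.{u} Λ, IsSimpleModule Λ S → ∀ i : S →ₗ[Λ] Y j,
      Function.Injective i → 𝒳 S := by
  refine ⟨fun h j S hS i hi => h S hS
    (ε.symm.toLinearMap ∘ₗ LinearMap.single Λ (fun j => Y j) j ∘ₗ i)
    (ε.symm.injective.comp ((Pi.single_injective j).comp hi)), fun h S hS i hi => ?_⟩
  have := IsSimpleModule.nontrivial Λ S
  obtain ⟨j, hj⟩ := exists_proj_comp_ne_zero (Y := Y) (ε.toLinearMap ∘ₗ i)
    (ne_zero_of_injective _ (ε.injective.comp hi))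
  exact h j S hS _ (LinearMap.injective_of_ne_zero hj)

/-- The kernel of a product of linear maps is the product of the kernels. -/
def kerPiMapEquiv {ι R : Type*} [Ring R] {P Q : ι → Type*} [∀ j, AddCommGroup (P j)]
    [∀ j, Module R (P j)] [∀ j, AddCommGroup (Q j)] [∀ j, Module R (Q j)]
    (p : ∀ j, P j →ₗ[R] Q j) :
    LinearMap.ker (LinearMap.piMap p) ≃ₗ[R] ∀ j, LinearMap.ker (p j) where
  toFun x j := ⟨x.1 j, congrFun x.2 j⟩
  invFun y := ⟨fun j => y j, funext fun j => (y j).2⟩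
  map_add' _ _ := rfl
  map_smul' _ _ := rfl
  left_inv _ := rfl
  right_inv _ := rfl

/-- A maximal submodule `m` above `N` cuts each uniserial factor in everything or in its maximal
submodule, and so contains the kernel of each `p j`. Then `N` together with the kernel stays inside
`m`. -/
theorem isProjectiveCover_piMap {ι R : Type*} [Finite ι] [Ring R] {P Q : ι → Type*}
    [∀ j, AddCommGroup (P j)] [∀ j, Module R (P j)] [∀ j, AddCommGroup (Q j)]
    [∀ j, Module R (Q j)] [∀ j, Module.Projective R (P j)] [∀ j, Module.Finite R (P j)]
    [∀ j, Nontrivial (Q j)] (hu : ∀ j, IsUniserial R (P j)) (p : ∀ j, P j →ₗ[R] Q j)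
    (hp : ∀ j, Function.Surjective (p j)) : IsProjectiveCover (LinearMap.piMap p) where
  projective := by
    classical
    have := Fintype.ofFinite ι
    exact Module.Projective.of_equiv (DFinsupp.linearEquivFunOnFintype (R := R) (M := P))
  surjective := Function.Surjective.piMap hp
  superfluous N hN := by
    classical
    have := Fintype.ofFinite ι
    by_contra hne
    obtain ⟨m, hm, hle⟩ := (eq_top_or_exists_le_coatom N).resolve_left hne
    refine hm.1 (eq_top_iff.2 (hN ▸ sup_le hle fun x hx => ?_))
    have hms : IsSimpleModule R ((∀ j, P j) ⧸ m) := isSimpleModule_iff_isCoatom.2 hm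
    rw [← LinearMap.sum_single_apply P x]
    refine Submodule.sum_mem _ fun j _ => ?_
    rw [← Submodule.Quotient.mk_eq_zero]
    by_cases h0 : m.mkQ ∘ₗ LinearMap.single R P j = 0
    · exact LinearMap.congr_fun h0 (x j)
    · exact (hu j).le_of_isCoatom
        (LinearMap.isCoatom_ker_of_surjective (LinearMap.surjective_of_ne_zero h0))
        (ker_ne_top_of_surjective (p j) (hp j)) (congrFun hx j : p j (x j) = 0)

end Decomposition

end NakayamaCore

/-! ### The equivalence of the three conditions -/

theorem proposition3 (k : Type v) [CommRing k] [IsArtinianRing k]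
    (Λ : Type u) [Ring Λ] [Algebra k Λ] [Module.Finite k Λ]
    (hNakayama : NakayamaCore.IsNakayama Λ) (hNoSimple : NakayamaCore.NoSimpleProjective Λ)
    (M : Type u) [AddCommGroup M] [Module Λ M] (hM : IsFiniteLength Λ M) :
    List.TFAE [
      NakayamaCore.InCore Λ M,
      NakayamaCore.InAdd (NakayamaCore.ClassX Λ) (NakayamaCore.Top Λ M) ∧
        NakayamaCore.InAdd (NakayamaCore.TauInvClass k Λ (NakayamaCore.ClassX Λ))
          (NakayamaCore.socle Λ M),
      NakayamaCore.InAdd (NakayamaCore.ClassX Λ) (NakayamaCore.Top Λ M) ∧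
        ∃ K : ModuleCat.{u} Λ, NakayamaCore.IsSyzygy Λ M K ∧
          NakayamaCore.InAdd (NakayamaCore.ClassX Λ) (NakayamaCore.Top Λ K)] := by
  open NakayamaCore in
  have : IsArtinianRing Λ := IsArtinianRing.of_finite k Λ
  have hR := hNakayama.isSerial
  have hL : ∀ e : Λᵐᵒᵖ, IsPrim e → IsUniserial Λᵐᵒᵖ (pim e) := fun e he =>
    hNakayama.2 _ (finite_pim e) (projective_pim he.1) he.isIndecomposable
  obtain ⟨_, _⟩ := isFiniteLength_iff_isNoetherian_isArtinian.1 hM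
  obtain ⟨n, Y, hY, ⟨ε⟩⟩ := hR.exists_decomposition M
  have hnt : ∀ j, Nontrivial (Y j) := fun j => (hY j).1
  choose e he ht using fun j => (hY j).2
  choose p hp using fun j => (ht j).exists_surjective
  have hXe : ∀ S S' : ModuleCat.{u} Λ, Nonempty (S ≃ₗ[Λ] S') → ClassX Λ S → ClassX Λ S' :=
    fun _ _ ⟨φ⟩ h => h.of_equiv φ
  have hXs : ∀ S, ClassX Λ S → Nontrivial S → IsSimpleModule Λ S := fun _ h _ => h.1
  -- Needed so that the socle can be tested on simple submodules.
  have hTs : ∀ T, TauInvClass k Λ (ClassX Λ) T → Nontrivial T → IsSimpleModule Λ T := by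
    rintro T ⟨S, hS, hST⟩ _
    have := hS.1
    exact isSimpleModule_of_isTauInv k hR hL hST
  have htop : InAdd (ClassX Λ) (Top Λ M) ↔ ∀ j, IsCoreIdem (e j) := by
    rw [inAdd_top_iff hXe hXs, forall_quotient_iff ε]
    exact forall_congr' fun j => forall_quotient_classX_iff hR (he j) (ht j)
  have hsoc : InAdd (TauInvClass k Λ (ClassX Λ)) (socle Λ M) ↔
      ∀ j, ∀ S : ModuleCat.{u} Λ, IsSimpleModule Λ S → ∀ i : S →ₗ[Λ] Y j,
        Function.Injective i → TauInvClass k Λ (ClassX Λ) S := by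
    rw [inAdd_socle_iff (fun _ _ ⟨φ⟩ h => h.of_equiv k φ) hTs, forall_submodule_iff ε]
  have := fun j => projective_pim (he j).1
  have := fun j => finite_pim (e j)
  have hcov := isProjectiveCover_piMap (fun j => hR.left _ (he j)) p hp
  let Z : Fin n → ModuleCat.{u} Λ := fun j => ModuleCat.of Λ (LinearMap.ker (p j))
  -- Projective covers are unique, so any syzygy of `M` is the product of the kernels of the `p j`,
  -- and the condition does not depend on the choice of `K`.
  have hΩ (K : ModuleCat.{u} Λ) (hK : IsSyzygy Λ M K) :
      InAdd (ClassX Λ) (Top Λ K) ↔ ∀ j, ∀ S : ModuleCat.{u} Λ, IsSimpleModule Λ S →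
        ∀ q : LinearMap.ker (p j) →ₗ[Λ] S, Function.Surjective q → ClassX Λ S := by
    obtain ⟨P, π, hπ, ⟨φ⟩⟩ := hK
    have hcov' : IsProjectiveCover (ε.toLinearMap ∘ₗ π) :=
      ⟨hπ.projective, ε.surjective.comp hπ.surjective, by
        rw [LinearEquiv.ker_comp]
        exact hπ.superfluous⟩
    obtain ⟨ψ, hψ⟩ := hcov'.exists_equiv hcov
    have hker : LinearMap.ker π = (LinearMap.ker (LinearMap.piMap p)).map ψ.toLinearMap := by
      ext x
      obtain ⟨y, rfl⟩ := ψ.surjective x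
      rw [Submodule.mem_map_equiv, ψ.symm_apply_apply, LinearMap.mem_ker, LinearMap.mem_ker,
        ← hψ]
      exact ε.map_eq_zero_iff.symm
    let δ : K ≃ₗ[Λ] ∀ j, Z j := φ ≪≫ₗ LinearEquiv.ofEq _ _ hker ≪≫ₗ
      (ψ.submoduleMap _).symm ≪≫ₗ kerPiMapEquiv p
    have : ∀ j, IsNoetherian Λ (Z j) := fun j =>
      inferInstanceAs (IsNoetherian Λ (LinearMap.ker (p j)))
    have : ∀ j, IsArtinian Λ (Z j) := fun j =>
      inferInstanceAs (IsArtinian Λ (LinearMap.ker (p j)))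
    have : IsNoetherian Λ K := isNoetherian_of_linearEquiv δ.symm
    have : IsArtinian Λ K := isArtinian_of_linearEquiv δ.symm
    rw [inAdd_top_iff hXe hXs, forall_quotient_iff δ]
  have hcore : InCore Λ M ↔ ∀ j, InCore Λ (Y j) := inAdd_iff_forall ε
  tfae_have 1 ↔ 2 := by
    rw [hcore, htop, hsoc, ← forall_and]
    exact forall_congr' fun j => inCore_iff_submodule k hR hL hNoSimple (he j) (p j) (hp j)
  tfae_have 1 ↔ 3 := by
    have key : InCore Λ M ↔ InAdd (ClassX Λ) (Top Λ M) ∧ ∀ j, ∀ S : ModuleCat.{u} Λ,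
        IsSimpleModule Λ S → ∀ q : LinearMap.ker (p j) →ₗ[Λ] S, Function.Surjective q →
          ClassX Λ S := by
      rw [hcore, htop, ← forall_and]
      exact forall_congr' fun j => inCore_iff_quotient hR (he j) (p j) (hp j)
    rw [key]
    refine and_congr_right fun _ => ⟨fun h => ?_, fun ⟨K, hK, h⟩ => (hΩ K hK).1 h⟩
    have hK : IsSyzygy Λ M (ModuleCat.of Λ
        (LinearMap.ker (ε.symm.toLinearMap ∘ₗ LinearMap.piMap p))) :=
      ⟨ModuleCat.of Λ (∀ j, pim (e j)), ε.symm.toLinearMap ∘ₗ LinearMap.piMap p,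
        ⟨hcov.projective, ε.symm.surjective.comp hcov.surjective, by
          rw [LinearEquiv.ker_comp]
          exact hcov.superfluous⟩, ⟨LinearEquiv.refl _ _⟩⟩
    exact ⟨_, hK, (hΩ _ hK).2 h⟩
  tfae_finish
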